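/- Let $P$ be a finite partially ordered set of width two (its largest antichain has exactly two elements), with $n$ elements $x$ that carry arbitrary weights $w(x)\in\mathbb R^2$. Let $\mathrm{poly}(P)\subset\mathbb R^2$ be the convex hull of the points $\sum_{x\in L}w(x)$, where $L$ ranges over all lower sets of $P$ (subsets $L$ such that $y\in L$ and $x<y$ imply $x\in L$; the empty set and $P$ are included). Then: (1) $\mathrm{poly}(P)$ has $O(n\log n)$ vertices. (2) $\mathrm{poly}(P)$ can be constructed in time $O(n\log^2 n)$ from the weights and the covering relation of $P$. That is, there is a single real-RAM program (unit-cost addition, subtraction, multiplication and comparison of exact real numbers; unit-cost arithmetic, comparison and array addressing on words of $O(\log n)$ bits) that, for every such $P$ and $w$, given $n$, a list of the covering pairs of $P$ (each pair once, in any order, elements labelled arbitrarily by $0,\dots,n-1$) and the coordinates of the weights, halts after $O(n\log^2 n)$ steps with the list of the vertices of $\mathrm{poly}(P)$, each once, in counterclockwise order. The implied constants are absolute: they do not depend on $P$, $n$ or $w$. -/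

import Mathlib

universe u

noncomputable section

/-! ### Width, lower sets and the projected polygon -/

/-- `P` has width `w`: the largest number of elements of an antichain of `P` is `w`. -/
def HasWidth (P : Type u) [PartialOrder P] (w : ℕ) : Prop :=
  IsGreatest {k : ℕ | ∃ A : Finset P, IsAntichain (· ≤ ·) (A : Set P) ∧ A.card = k} w

/-- The planar point set of a family `F` of subsets of `P`: every member of the family
contributes the sum of the weights of its elements. -/
def projectFamily {P : Type u} [Fintype P] (w : P → ℝ × ℝ) (F : Set (Set P)) : Set (ℝ × ℝ) :=
  (fun S : Set P => ∑ x : P, S.indicator w x) '' F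

/-- `poly(P)`: the convex hull of the projection of the family of all lower sets of `P`. -/
def closurePolygon {P : Type u} [PartialOrder P] [Fintype P] (w : P → ℝ × ℝ) : Set (ℝ × ℝ) :=
  convexHull ℝ (projectFamily w {S : Set P | IsLowerSet S})

/-- The vertices of a planar convex set: its extreme points. -/
def polygonVertices (K : Set (ℝ × ℝ)) : Set (ℝ × ℝ) := K.extremePoints ℝ

/-- The cross product of two plane vectors (positive for a left turn). -/
def cross (a b : ℝ × ℝ) : ℝ := a.1 * b.2 - a.2 * b.1

/-- `v 0, …, v (k - 1)` lists every vertex of `K` exactly once, in counterclockwise cyclic order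
(starting anywhere): every three of them, taken in the order of the list, make a left turn. -/
structure IsVertexCycle (K : Set (ℝ × ℝ)) (k : ℕ) (v : ℕ → ℝ × ℝ) : Prop where
  injOn : Set.InjOn v (Set.Iio k)
  image_eq : v '' Set.Iio k = polygonVertices K
  ccw : ∀ i j l : ℕ, i < j → j < l → l < k → 0 < cross (v j - v i) (v l - v i)

/-! ### A real RAM

Programs are finite pieces of syntax over finitely many scalar variables and arrays. Words are
natural numbers below a bound `B` and serve as counters and addresses; reals are exact and admit
ring operations and comparisons only. There is no conversion between words and reals. -/

namespace RealRAM

/-- The memory: word variables, word arrays, real variables, real arrays. -/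
structure State where
  wvar : ℕ → ℕ
  warr : ℕ → ℕ → ℕ
  rvar : ℕ → ℝ
  rarr : ℕ → ℕ → ℝ

/-- Word expressions. `sub` is truncated subtraction, `div` is integer division
(with value `0` on division by `0`), and `get a i` reads entry `i` of array `a`. -/
inductive WExp where
  | const (k : ℕ)
  | var (x : ℕ)
  | get (a : ℕ) (i : WExp)
  | add (p q : WExp)
  | sub (p q : WExp)
  | mul (p q : WExp)
  | div (p q : WExp)

/-- Real expressions. The only constants are integers. -/
inductive RExp where
  | const (k : ℤ)
  | var (x : ℕ)
  | get (a : ℕ) (i : WExp)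
  | add (p q : RExp)
  | sub (p q : RExp)
  | mul (p q : RExp)

/-- Tests. -/
inductive Test where
  | wlt (p q : WExp)
  | weq (p q : WExp)
  | rlt (p q : RExp)
  | req (p q : RExp)
  | neg (b : Test)
  | conj (b d : Test)
  | disj (b d : Test)

/-- Programs. -/
inductive Prog where
  | skip
  | setW (x : ℕ) (p : WExp)
  | putW (a : ℕ) (i p : WExp)
  | setR (x : ℕ) (p : RExp)
  | putR (a : ℕ) (i : WExp) (p : RExp)
  | seq (c d : Prog)
  | cond (b : Test) (c d : Prog)
  | loop (b : Test) (c : Prog)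

/-- The value of a word expression. -/
def WExp.val (s : State) : WExp → ℕ
  | .const k => k
  | .var x => s.wvar x
  | .get a i => s.warr a (i.val s)
  | .add p q => p.val s + q.val s
  | .sub p q => p.val s - q.val s
  | .mul p q => p.val s * q.val s
  | .div p q => p.val s / q.val s

/-- The number of unit-cost operations in a word expression. -/
def WExp.cost : WExp → ℕ
  | .const _ => 1
  | .var _ => 1
  | .get _ i => i.cost + 1
  | .add p q => p.cost + q.cost + 1
  | .sub p q => p.cost + q.cost + 1
  | .mul p q => p.cost + q.cost + 1
  | .div p q => p.cost + q.cost + 1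

/-- The value of a real expression. -/
def RExp.val (s : State) : RExp → ℝ
  | .const k => (k : ℝ)
  | .var x => s.rvar x
  | .get a i => s.rarr a (i.val s)
  | .add p q => p.val s + q.val s
  | .sub p q => p.val s - q.val s
  | .mul p q => p.val s * q.val s

/-- The number of unit-cost operations in a real expression. -/
def RExp.cost : RExp → ℕ
  | .const _ => 1
  | .var _ => 1
  | .get _ i => i.cost + 1
  | .add p q => p.cost + q.cost + 1
  | .sub p q => p.cost + q.cost + 1
  | .mul p q => p.cost + q.cost + 1

/-- The truth of a test. -/
def Test.Holds (s : State) : Test → Prop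
  | .wlt p q => p.val s < q.val s
  | .weq p q => p.val s = q.val s
  | .rlt p q => p.val s < q.val s
  | .req p q => p.val s = q.val s
  | .neg b => ¬ b.Holds s
  | .conj b d => b.Holds s ∧ d.Holds s
  | .disj b d => b.Holds s ∨ d.Holds s

/-- The number of unit-cost operations in a test (no short-circuiting). -/
def Test.cost : Test → ℕ
  | .wlt p q => p.cost + q.cost + 1
  | .weq p q => p.cost + q.cost + 1
  | .rlt p q => p.cost + q.cost + 1
  | .req p q => p.cost + q.cost + 1
  | .neg b => b.cost + 1
  | .conj b d => b.cost + d.cost + 1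
  | .disj b d => b.cost + d.cost + 1

/-- Store a word in a variable. -/
def State.setW (s : State) (x v : ℕ) : State :=
  { s with wvar := Function.update s.wvar x v }

/-- Store a word in an array. -/
def State.putW (s : State) (a i v : ℕ) : State :=
  { s with warr := Function.update s.warr a (Function.update (s.warr a) i v) }

/-- Store a real in a variable. -/
def State.setR (s : State) (x : ℕ) (v : ℝ) : State :=
  { s with rvar := Function.update s.rvar x v }

/-- Store a real in an array. -/
def State.putR (s : State) (a i : ℕ) (v : ℝ) : State :=
  { s with rarr := Function.update s.rarr a (Function.update (s.rarr a) i v) }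

/-- `Exec B c s t s'`: started in state `s`, the program `c` halts in state `s'` after exactly `t`
steps, and all words and addresses that it stores or stores to are below `B`. A word assignment
that overflows has no execution. (Expressions have constant size, so that the intermediate values
inside an expression exceed `B` by at most a fixed power when the variables are below `B`.) -/
inductive Exec (B : ℕ) : Prog → State → ℕ → State → Prop
  | skip (s : State) : Exec B .skip s 1 s
  | setW (s : State) (x : ℕ) (p : WExp) (hp : p.val s < B) :
      Exec B (.setW x p) s (p.cost + 1) (s.setW x (p.val s))
  | putW (s : State) (a : ℕ) (i p : WExp) (hi : i.val s < B) (hp : p.val s < B) :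
      Exec B (.putW a i p) s (i.cost + p.cost + 1) (s.putW a (i.val s) (p.val s))
  | setR (s : State) (x : ℕ) (p : RExp) :
      Exec B (.setR x p) s (p.cost + 1) (s.setR x (p.val s))
  | putR (s : State) (a : ℕ) (i : WExp) (p : RExp) (hi : i.val s < B) :
      Exec B (.putR a i p) s (i.cost + p.cost + 1) (s.putR a (i.val s) (p.val s))
  | seq {c d : Prog} {s s₁ s₂ : State} {t₁ t₂ : ℕ} (hc : Exec B c s t₁ s₁)
      (hd : Exec B d s₁ t₂ s₂) : Exec B (.seq c d) s (t₁ + t₂) s₂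
  | condTrue {b : Test} {c d : Prog} {s s₁ : State} {t : ℕ} (hb : b.Holds s)
      (hc : Exec B c s t s₁) : Exec B (.cond b c d) s (b.cost + t) s₁
  | condFalse {b : Test} {c d : Prog} {s s₁ : State} {t : ℕ} (hb : ¬ b.Holds s)
      (hd : Exec B d s t s₁) : Exec B (.cond b c d) s (b.cost + t) s₁
  | loopTrue {b : Test} {c : Prog} {s s₁ s₂ : State} {t₁ t₂ : ℕ} (hb : b.Holds s)
      (hc : Exec B c s t₁ s₁) (hl : Exec B (.loop b c) s₁ t₂ s₂) :
      Exec B (.loop b c) s (b.cost + t₁ + t₂) s₂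
  | loopFalse {b : Test} {c : Prog} {s : State} (hb : ¬ b.Holds s) :
      Exec B (.loop b c) s b.cost s

/-- The initial memory for a weighted partial order on the labels `0, …, n - 1`, given by a list
of covering pairs (lower element, upper element) and the planar weights of the elements.
Word variables `0` and `1` hold `n` and the number of pairs, word arrays `0` and `1` hold the lower
and the upper elements of the pairs, real arrays `0` and `1` hold the coordinates of the
weights, and all other cells are `0`. -/
def inputState {n : ℕ} (covers : List (Fin n × Fin n)) (w : Fin n → ℝ × ℝ) : State where
  wvar x := if x = 0 then n else if x = 1 then covers.length else 0
  warr a i :=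
    if h : i < covers.length then
      if a = 0 then ((covers[i]).1 : ℕ) else if a = 1 then ((covers[i]).2 : ℕ) else 0
    else 0
  rvar _ := 0
  rarr a i :=
    if h : i < n then
      if a = 0 then (w ⟨i, h⟩).1 else if a = 1 then (w ⟨i, h⟩).2 else 0
    else 0

/-- The final memory holds the polygon `K`: word variable `2` is the number of its vertices, and
real arrays `2` and `3` hold the coordinates of the vertices in counterclockwise cyclic order. -/
def Outputs (s : State) (K : Set (ℝ × ℝ)) : Prop :=
  IsVertexCycle K (s.wvar 2) (fun i => (s.rarr 2 i, s.rarr 3 i))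

end RealRAM

/-- `covers` lists each pair of the covering relation of `P` exactly once, in any order, where the
elements of `P` are labelled by `e`. -/
def IsCoverList {P : Type u} [PartialOrder P] {n : ℕ} (e : Fin n ≃ P)
    (covers : List (Fin n × Fin n)) : Prop :=
  covers.Nodup ∧ ∀ i j : Fin n, (i, j) ∈ covers ↔ e i ⋖ e j

end

/-! Split `P` into two chains. A lower set meets each chain in a prefix, so the lower sets are the
pairs `(i, j)` of prefix lengths with `F j ≤ i < G j`, where `F` and `G` are monotone and record the
relations between the chains (`PrefixBounds.projectFamily_eq`). The weight of such a lower set is `a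
i + c j`, a sum of two prefix sums. If all pairs of a rectangle `I × J` are feasible, its points
form the Minkowski sum of the sets `{a i}` and `{c j}`; the boundary of the hull of this sum is
found by merging the edges of two convex chains by slope, and it has at most `|I| + |J|` points on
each side (`minkowski_wp`). It remains to cut the region between the two staircases into rectangles
of small total side length.

Take dyadic blocks of rows, and call a column full for a block if all its pairs in the block are
feasible. The columns that are full for a block but not for its parent form an interval, hence one
rectangle. Its width is at most the growth of `F`, respectively `G`, over the parent, so the widths
telescope to `O(n)` on each of the `O(log n)` levels, and the heights also add up to `O(n)` per
level. A feasible pair lies in a full column of its own row, while no column is full for all rows,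
because the rows are padded by empty ones; so the pair falls into a rectangle at some level. Thus
`O(n log n)` candidate points span the polygon (`pairProg_wp`, `levelLoop_wp`, `candidates_wp`).

Only the functionals `(u, 1)` and their negatives are tested; these suffice for finite sets by
`subset_convexHull_of_dirVal`. The upper side is treated with `σ = 1`, the lower side as the upper
side of the reflected points with `σ = -1`. A chain of strict right turns is globally convex, and an
upper and a reflected lower chain together give the vertices in counterclockwise order
(`isVertexCycle_of_chains`).

The chains are built greedily, level by level, in a topological order. Width two leaves at most two
minimal elements in the rest. Each of them lies above the end of some chain, and of two minimal
elements at least one lies above the end of any given chain, so they can be matched to the chains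
(`LevelInv.pair`). The numbers `α x` and `β x` of chain elements below `x` are propagated as maxima
along covering pairs.

Sorting dominates the time: `O(n log n)` on each level and `O(n log² n)` for the hull of all
candidates. The bound on the number of vertices is read off from the output of the same program,
which is verified in a Hoare logic that also counts steps. -/

namespace RealRAM

infixr:60 " ;; " => Prog.seq

/-! ### Time-bounded weakest preconditions for the real RAM -/

section StateSimp

variable (s : State) (x v a i : ℕ) (r : ℝ)

@[simp] theorem State.setW_wvar : (s.setW x v).wvar = Function.update s.wvar x v := rfl
@[simp] theorem State.setW_warr : (s.setW x v).warr = s.warr := rfl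
@[simp] theorem State.setW_rvar : (s.setW x v).rvar = s.rvar := rfl
@[simp] theorem State.setW_rarr : (s.setW x v).rarr = s.rarr := rfl
@[simp] theorem State.putW_wvar : (s.putW a i v).wvar = s.wvar := rfl
@[simp] theorem State.putW_warr :
    (s.putW a i v).warr = Function.update s.warr a (Function.update (s.warr a) i v) := rfl
@[simp] theorem State.putW_rvar : (s.putW a i v).rvar = s.rvar := rfl
@[simp] theorem State.putW_rarr : (s.putW a i v).rarr = s.rarr := rfl
@[simp] theorem State.setR_wvar : (s.setR x r).wvar = s.wvar := rfl
@[simp] theorem State.setR_warr : (s.setR x r).warr = s.warr := rfl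
@[simp] theorem State.setR_rvar : (s.setR x r).rvar = Function.update s.rvar x r := rfl
@[simp] theorem State.setR_rarr : (s.setR x r).rarr = s.rarr := rfl
@[simp] theorem State.putR_wvar : (s.putR a i r).wvar = s.wvar := rfl
@[simp] theorem State.putR_warr : (s.putR a i r).warr = s.warr := rfl
@[simp] theorem State.putR_rvar : (s.putR a i r).rvar = s.rvar := rfl
@[simp] theorem State.putR_rarr :
    (s.putR a i r).rarr = Function.update s.rarr a (Function.update (s.rarr a) i r) := rfl

end StateSimp

/-- From `s`, the program halts within `T` steps in a state that satisfies `Q`. -/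
def Wp (B : ℕ) (c : Prog) (T : ℕ) (Q : State → Prop) (s : State) : Prop :=
  ∃ t s', Exec B c s t s' ∧ t ≤ T ∧ Q s'

/-- The verification condition of a program without loops. -/
def Prog.Vc (B : ℕ) : Prog → (State → Prop) → State → Prop
  | .skip, Q, s => Q s
  | .setW x p, Q, s => p.val s < B ∧ Q (s.setW x (p.val s))
  | .putW a i p, Q, s => i.val s < B ∧ p.val s < B ∧ Q (s.putW a (i.val s) (p.val s))
  | .setR x p, Q, s => Q (s.setR x (p.val s))
  | .putR a i p, Q, s => i.val s < B ∧ Q (s.putR a (i.val s) (p.val s))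
  | .seq c d, Q, s => c.Vc B (d.Vc B Q) s
  | .cond b c d, Q, s => (b.Holds s → c.Vc B Q s) ∧ (¬ b.Holds s → d.Vc B Q s)
  | .loop _ _, _, _ => False

/-- The running time of a program without loops. -/
def Prog.flatCost : Prog → ℕ
  | .skip => 1
  | .setW _ p => p.cost + 1
  | .putW _ i p => i.cost + p.cost + 1
  | .setR _ p => p.cost + 1
  | .putR _ i p => i.cost + p.cost + 1
  | .seq c d => c.flatCost + d.flatCost
  | .cond b c d => b.cost + max c.flatCost d.flatCost
  | .loop _ _ => 0

theorem Wp.mono {B : ℕ} {c : Prog} {T T' : ℕ} {Q Q' : State → Prop} {s : State}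
    (h : Wp B c T Q s) (hT : T ≤ T') (hQ : ∀ s', Q s' → Q' s') : Wp B c T' Q' s := by
  obtain ⟨t, s', h1, h2, h3⟩ := h
  exact ⟨t, s', h1, h2.trans hT, hQ _ h3⟩

theorem Wp.imp {B : ℕ} {c : Prog} {T : ℕ} {Q Q' : State → Prop} {s : State}
    (h : Wp B c T Q s) (hQ : ∀ s', Q s' → Q' s') : Wp B c T Q' s := h.mono le_rfl hQ

theorem Wp.seq {B : ℕ} {c d : Prog} {T₁ T₂ : ℕ} {R Q : State → Prop} {s : State}
    (h : Wp B c T₁ R s) (h' : ∀ s₁, R s₁ → Wp B d T₂ Q s₁) : Wp B (c ;; d) (T₁ + T₂) Q s := by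
  obtain ⟨t, s', h1, h2, h3⟩ := h
  obtain ⟨t', s'', h1', h2', h3'⟩ := h' s' h3
  exact ⟨t + t', s'', .seq h1 h1', by omega, h3'⟩

/-- This turns code without loops into symbolic evaluation: `simp` unfolds `Vc`, and `flatCost`
depends on the syntax alone. A conditional is charged for its dearer branch, so the time is only
bounded above. -/
theorem Wp.of_vc {B : ℕ} {c : Prog} {Q : State → Prop} {s : State} (h : c.Vc B Q s) :
    Wp B c c.flatCost Q s := by
  induction c generalizing Q s with
  | skip => exact ⟨_, _, .skip s, le_rfl, h⟩
  | setW x p => exact ⟨_, _, .setW s x p h.1, le_rfl, h.2⟩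
  | putW a i p => exact ⟨_, _, .putW s a i p h.1 h.2.1, le_rfl, h.2.2⟩
  | setR x p => exact ⟨_, _, .setR s x p, le_rfl, h⟩
  | putR a i p => exact ⟨_, _, .putR s a i p h.1, le_rfl, h.2⟩
  | seq c d ihc ihd => exact (ihc h).seq fun s₁ h₁ => ihd h₁
  | cond b c d ihc ihd =>
    by_cases hb : b.Holds s
    · obtain ⟨t, s', h1, h2, h3⟩ := ihc (h.1 hb)
      exact ⟨_, s', .condTrue hb h1, Nat.add_le_add_left (h2.trans (le_max_left _ _)) _, h3⟩
    · obtain ⟨t, s', h1, h2, h3⟩ := ihd (h.2 hb)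
      exact ⟨_, s', .condFalse hb h1, Nat.add_le_add_left (h2.trans (le_max_right _ _)) _, h3⟩
  | loop b c => exact h.elim

theorem Test.cost_pos (b : Test) : 0 < b.cost := by
  cases b <;> simp [Test.cost]

theorem Wp.cond {B : ℕ} {b : Test} {c d : Prog} {T : ℕ} {Q : State → Prop} {s : State}
    (h : b.Holds s → Wp B c T Q s) (h' : ¬ b.Holds s → Wp B d T Q s) :
    Wp B (.cond b c d) (b.cost + T) Q s := by
  by_cases hb : b.Holds s
  · obtain ⟨t, s', h1, h2, h3⟩ := h hb
    exact ⟨_, s', .condTrue hb h1, by omega, h3⟩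
  · obtain ⟨t, s', h1, h2, h3⟩ := h' hb
    exact ⟨_, s', .condFalse hb h1, by omega, h3⟩

/-- The loop rule: `Φ` is a potential that pays for every round. -/
theorem Wp.loop {B : ℕ} {b : Test} {c : Prog} {s : State} (I : State → Prop) (Φ : State → ℕ)
    (N : ℕ) (h0 : I s) (hN : Φ s ≤ N)
    (h : ∀ s, I s → b.Holds s →
      ∃ T, Wp B c T (fun s' => I s' ∧ Φ s' + T + b.cost ≤ Φ s) s) :
    Wp B (.loop b c) (N + b.cost) (fun s' => I s' ∧ ¬ b.Holds s') s := by
  refine Wp.mono ?_ (Nat.add_le_add_right hN _) fun _ h => h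
  clear hN
  -- The cost of a test is positive, so every round lowers the potential, and one induction gives
  -- both termination and the time bound.
  induction hk : Φ s using Nat.strong_induction_on generalizing s with
  | _ k ih =>
    by_cases hb : b.Holds s
    · obtain ⟨T, t, s', h1, h2, h3, h4⟩ := h s h0 hb
      have hp := b.cost_pos
      obtain ⟨t', s'', h1', h2', h3'⟩ := ih (Φ s') (by omega) h3 rfl
      exact ⟨_, s'', .loopTrue hb h1 h1', by omega, h3'⟩
    · exact ⟨_, s, .loopFalse hb, by omega, h0, hb⟩

/-- The loop rule when every round takes at most `T` steps. -/
theorem Wp.loop_const {B : ℕ} {b : Test} {c : Prog} {s : State} (I : State → Prop)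
    (m : State → ℕ) (T N : ℕ) (h0 : I s) (hN : m s ≤ N)
    (h : ∀ s, I s → b.Holds s → Wp B c T (fun s' => I s' ∧ m s' < m s) s) :
    Wp B (.loop b c) (N * (T + b.cost) + b.cost) (fun s' => I s' ∧ ¬ b.Holds s') s := by
  refine Wp.loop I (fun s => m s * (T + b.cost)) _ h0 (Nat.mul_le_mul_right _ hN)
    fun s hs hb => ⟨T, (h s hs hb).imp ?_⟩
  rintro s' ⟨h1, h2⟩
  refine ⟨h1, ?_⟩
  have : (m s' + 1) * (T + b.cost) ≤ m s * (T + b.cost) := Nat.mul_le_mul_right _ h2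
  linarith

/-- The loop rule for a body without loops. -/
theorem Wp.loop_flat {B : ℕ} {b : Test} {c : Prog} {s : State} (I : State → Prop)
    (m : State → ℕ) (N : ℕ) (h0 : I s) (hN : m s ≤ N)
    (h : ∀ s, I s → b.Holds s → c.Vc B (fun s' => I s' ∧ m s' < m s) s) :
    Wp B (.loop b c) (N * (c.flatCost + b.cost) + b.cost) (fun s' => I s' ∧ ¬ b.Holds s') s :=
  Wp.loop_const I m c.flatCost N h0 hN fun s hs hb => Wp.of_vc (h s hs hb)

/-- The word variables that a program may change. -/
def Prog.wv : Prog → List ℕ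
  | .setW x _ => [x]
  | .seq c d => c.wv ++ d.wv
  | .cond _ c d => c.wv ++ d.wv
  | .loop _ c => c.wv
  | _ => []

/-- The word arrays that a program may change. -/
def Prog.wa : Prog → List ℕ
  | .putW a _ _ => [a]
  | .seq c d => c.wa ++ d.wa
  | .cond _ c d => c.wa ++ d.wa
  | .loop _ c => c.wa
  | _ => []

/-- The real arrays that a program may change. -/
def Prog.ra : Prog → List ℕ
  | .putR a _ _ => [a]
  | .seq c d => c.ra ++ d.ra
  | .cond _ c d => c.ra ++ d.ra
  | .loop _ c => c.ra
  | _ => []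

/-- `s'` agrees with `s` on everything that `c` cannot change. -/
structure Frame (c : Prog) (s s' : State) : Prop where
  wvar : ∀ x, x ∉ c.wv → s'.wvar x = s.wvar x
  warr : ∀ x, x ∉ c.wa → s'.warr x = s.warr x
  rarr : ∀ x, x ∉ c.ra → s'.rarr x = s.rarr x

/-- The lists of changeable cells are computed from the syntax. Whether a cell survives a
subprogram, loops included, is thus settled by `decide` and need not be part of a loop invariant. -/
theorem Exec.frame {B : ℕ} {c : Prog} {s s' : State} {t : ℕ} (h : Exec B c s t s') :
    Frame c s s' := by
  induction h with
  | skip s => exact ⟨fun _ _ => rfl, fun _ _ => rfl, fun _ _ => rfl⟩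
  | setW s x p hp =>
    refine ⟨fun y hy => ?_, fun _ _ => rfl, fun _ _ => rfl⟩
    simp [Prog.wv] at hy
    simp [hy]
  | putW s a i p hi hp =>
    refine ⟨fun _ _ => rfl, fun y hy => ?_, fun _ _ => rfl⟩
    simp [Prog.wa] at hy
    simp [hy]
  | setR s x p => exact ⟨fun _ _ => rfl, fun _ _ => rfl, fun _ _ => rfl⟩
  | putR s a i p hi =>
    refine ⟨fun _ _ => rfl, fun _ _ => rfl, fun y hy => ?_⟩
    simp [Prog.ra] at hy
    simp [hy]
  | seq _ _ ih1 ih2 =>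
    refine ⟨fun y hy => ?_, fun y hy => ?_, fun y hy => ?_⟩ <;>
    simp only [Prog.wv, Prog.wa, Prog.ra, List.mem_append, not_or] at hy
    · rw [ih2.wvar y hy.2, ih1.wvar y hy.1]
    · rw [ih2.warr y hy.2, ih1.warr y hy.1]
    · rw [ih2.rarr y hy.2, ih1.rarr y hy.1]
  | condTrue _ _ ih =>
    refine ⟨fun y hy => ?_, fun y hy => ?_, fun y hy => ?_⟩ <;>
    simp only [Prog.wv, Prog.wa, Prog.ra, List.mem_append, not_or] at hy
    · exact ih.wvar y hy.1
    · exact ih.warr y hy.1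
    · exact ih.rarr y hy.1
  | condFalse _ _ ih =>
    refine ⟨fun y hy => ?_, fun y hy => ?_, fun y hy => ?_⟩ <;>
    simp only [Prog.wv, Prog.wa, Prog.ra, List.mem_append, not_or] at hy
    · exact ih.wvar y hy.2
    · exact ih.warr y hy.2
    · exact ih.rarr y hy.2
  | loopTrue _ _ _ ih1 ih2 =>
    refine ⟨fun y hy => ?_, fun y hy => ?_, fun y hy => ?_⟩
    · rw [ih2.wvar y hy, ih1.wvar y hy]
    · rw [ih2.warr y hy, ih1.warr y hy]
    · rw [ih2.rarr y hy, ih1.rarr y hy]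
  | loopFalse _ => exact ⟨fun _ _ => rfl, fun _ _ => rfl, fun _ _ => rfl⟩

theorem Wp.framed {B : ℕ} {c : Prog} {T : ℕ} {Q : State → Prop} {s : State} (h : Wp B c T Q s) :
    Wp B c T (fun s' => Q s' ∧ Frame c s s') s := by
  obtain ⟨t, s', h1, h2, h3⟩ := h
  exact ⟨t, s', h1, h2, h3, h1.frame⟩

/-- Sequential composition with a time budget; the second part may use the frame of the first. -/
theorem Wp.step {B : ℕ} {c d : Prog} {T₁ T₂ T : ℕ} {R Q : State → Prop} {s : State}
    (h : Wp B c T₁ R s) (h' : ∀ s₁, R s₁ → Frame c s s₁ → Wp B d T₂ Q s₁) (hT : T₁ + T₂ ≤ T) :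
    Wp B (c ;; d) T Q s :=
  (h.framed.seq fun s₁ h₁ => h' s₁ h₁.1 h₁.2).mono hT fun _ h => h

/-- A block without loops with a time budget. -/
theorem Wp.flat {B : ℕ} {c : Prog} {T : ℕ} {Q : State → Prop} {s : State} (h : c.Vc B Q s)
    (hT : c.flatCost ≤ T) : Wp B c T Q s :=
  (Wp.of_vc h).mono hT fun _ h => h

end RealRAM

/-! ### Merge sort -/

/-- `f` is monotone on the interval `[a, b)`. -/
def SortedOn {α : Type*} [LinearOrder α] (f : ℕ → α) (a b : ℕ) : Prop :=
  ∀ x y, a ≤ x → x ≤ y → y < b → f x ≤ f y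

theorem SortedOn.mono {α : Type*} [LinearOrder α] {f : ℕ → α} {a b a' b' : ℕ}
    (h : SortedOn f a b) (ha : a ≤ a') (hb : b' ≤ b) : SortedOn f a' b' :=
  fun x y h1 h2 h3 => h x y (ha.trans h1) h2 (h3.trans_le hb)

/-- The invariant of a pass that merges blocks of length `s` of `P` into blocks of length `2 * s`
of `O`: the block `[lo, hi)` is being merged, with `i` and `j` the next elements of its halves and
`o` the next position of the output. -/
structure MergeInv {α : Type*} [LinearOrder α] (P O : ℕ → α) (s m lo mid hi i j o : ℕ) : Prop where
  lo_i : lo ≤ i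
  i_mid : i ≤ mid
  mid_j : mid ≤ j
  j_hi : j ≤ hi
  hi_m : hi ≤ m
  hi_lo : hi ≤ lo + 2 * s
  sum : o + mid = i + j
  dvd_lo : 2 * s ∣ lo
  dvd_hi : hi = m ∨ 2 * s ∣ hi
  left : SortedOn P lo mid
  right : SortedOn P mid hi
  done : ∀ b, 2 * s ∣ b → b + 2 * s ≤ lo → SortedOn O b (b + 2 * s)
  cur : SortedOn O lo o
  cur_left : ∀ x y, lo ≤ x → x < o → i ≤ y → y < mid → O x ≤ P y
  cur_right : ∀ x y, lo ≤ x → x < o → j ≤ y → y < hi → O x ≤ P y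
  out_mem : ∀ x, x < o → ∃ y, y < m ∧ O x = P y
  mem_out : ∀ y, (y < i ∨ mid ≤ y ∧ y < j) → ∃ x, x < o ∧ O x = P y

namespace MergeInv

variable {α : Type*} [LinearOrder α] {P O : ℕ → α} {s m lo mid hi i j o : ℕ}

theorem zero (hs : 0 < s) : MergeInv P O s m 0 0 0 0 0 0 := by
  constructor <;> first | omega | simp [SortedOn]

theorem dvd_gap {d a b : ℕ} (ha : d ∣ a) (hb : d ∣ b) (h : a < b) : a + d ≤ b := by
  obtain ⟨u, rfl⟩ := ha
  obtain ⟨v, rfl⟩ := hb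
  have : u < v := lt_of_mul_lt_mul_left h (Nat.zero_le d)
  calc d * u + d = d * (u + 1) := by ring
    _ ≤ d * v := Nat.mul_le_mul_left _ this

/-- The finished block joins the blocks recorded in `done`. Its end `o` is a multiple of `2 * s`,
because only a block that ends at `m` may have another end, and `o < m`. -/
theorem newBlock (h : MergeInv P O s m lo mid hi i j o) (ho : o = hi) (hm : o < m)
    (hP : ∀ b, s ∣ b → b < m → SortedOn P b (min (b + s) m)) :
    MergeInv P O s m o (min (o + s) m) (min (o + 2 * s) m) o (min (o + s) m) o := by
  obtain ⟨h1, h2, h3, h4, h5, h6, h7, h8, h9, h10, h11, h12, h13, h14, h15, h16, h17⟩ := h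
  have hd : 2 * s ∣ o := by
    rcases h9 with h9 | h9
    · omega
    · exact ho ▸ h9
  have hso : s ∣ o := (Dvd.intro_left 2 rfl).trans hd
  refine ⟨le_rfl, by omega, by omega, by omega, by omega, by omega, by omega, hd, ?_, ?_, ?_, ?_,
    ?_, ?_, ?_, h16, ?_⟩
  · by_cases hc : o + 2 * s ≤ m
    · exact .inr (by rw [min_eq_left hc]; exact hd.add dvd_rfl)
    · exact .inl (min_eq_right (by omega))
  · exact hP o hso hm
  · by_cases hc : o + s < m
    · rw [min_eq_left hc.le, show o + 2 * s = o + s + s by ring]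
      exact hP _ (hso.add dvd_rfl) hc
    · exact fun x y hx hy hxy => by omega
  · intro b hb hbo
    by_cases hbl : b + 2 * s ≤ lo
    · exact h12 b hb hbl
    -- A block of length `2 * s` that ends by `o` and was not recorded before can only start at
    -- `lo`, since `o ≤ lo + 2 * s`.
    · have : b = lo := by
        rcases lt_trichotomy b lo with hlt | hlt | hlt
        · exact absurd (dvd_gap hb h8 hlt) hbl
        · exact hlt
        · have := dvd_gap h8 hb hlt
          omega
      subst this
      exact h13.mono le_rfl (by omega)
  · exact fun x y hx hy hxy => by omega
  · exact fun x y hx hy => by omega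
  · exact fun x y hx hy => by omega
  · intro y hy
    refine h17 y ?_
    omega

/-- Nothing that still waits is below `P i`: the rest of the left half because that half is sorted,
the rest of the right half because its head is not smaller and it is sorted too. -/
theorem takeLeft (h : MergeInv P O s m lo mid hi i j o) (hi' : i < mid)
    (hle : j < hi → P i ≤ P j) :
    MergeInv P (Function.update O o (P i)) s m lo mid hi (i + 1) j (o + 1) := by
  obtain ⟨h1, h2, h3, h4, h5, h6, h7, h8, h9, h10, h11, h12, h13, h14, h15, h16, h17⟩ := h
  have hne : ∀ x, x < o → Function.update O o (P i) x = O x := fun x hx =>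
    Function.update_of_ne hx.ne _ _
  refine ⟨by omega, by omega, h3, h4, h5, h6, by omega, h8, h9, h10, h11, ?_, ?_, ?_, ?_, ?_, ?_⟩
  · intro b hb hbl x y hx hxy hy
    rw [hne x (by omega), hne y (by omega)]
    exact h12 b hb hbl x y hx hxy hy
  · intro x y hx hxy hy
    rcases Nat.lt_succ_iff_lt_or_eq.1 hy with hy | rfl
    · rw [hne x (by omega), hne y hy]
      exact h13 x y hx hxy hy
    · rw [Function.update_self]
      rcases hxy.lt_or_eq with hxy | rfl
      · rw [hne x hxy]
        exact h14 x i hx hxy le_rfl hi'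
      · rw [Function.update_self]
  · intro x y hx hxo hy hym
    rcases Nat.lt_succ_iff_lt_or_eq.1 hxo with hxo | rfl
    · rw [hne x hxo]
      exact h14 x y hx hxo (by omega) hym
    · rw [Function.update_self]
      exact h10 i y h1 (by omega) hym
  · intro x y hx hxo hy hyh
    rcases Nat.lt_succ_iff_lt_or_eq.1 hxo with hxo | rfl
    · rw [hne x hxo]
      exact h15 x y hx hxo hy hyh
    · rw [Function.update_self]
      exact (hle (by omega)).trans (h11 j y h3 hy hyh)
  · intro x hx
    rcases Nat.lt_succ_iff_lt_or_eq.1 hx with hx | rfl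
    · rw [hne x hx]
      exact h16 x hx
    · exact ⟨i, by omega, Function.update_self ..⟩
  · intro y hy
    by_cases hyi : y = i
    · exact ⟨o, by omega, by rw [hyi, Function.update_self]⟩
    · obtain ⟨x, hx, hxy⟩ := h17 y (by omega)
      exact ⟨x, by omega, by rw [hne x hx, hxy]⟩

theorem takeRight (h : MergeInv P O s m lo mid hi i j o) (hj : j < hi)
    (hle : i < mid → P j ≤ P i) :
    MergeInv P (Function.update O o (P j)) s m lo mid hi i (j + 1) (o + 1) := by
  obtain ⟨h1, h2, h3, h4, h5, h6, h7, h8, h9, h10, h11, h12, h13, h14, h15, h16, h17⟩ := h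
  have hne : ∀ x, x < o → Function.update O o (P j) x = O x := fun x hx =>
    Function.update_of_ne hx.ne _ _
  refine ⟨by omega, by omega, by omega, by omega, h5, h6, by omega, h8, h9, h10, h11, ?_, ?_, ?_,
    ?_, ?_, ?_⟩
  · intro b hb hbl x y hx hxy hy
    rw [hne x (by omega), hne y (by omega)]
    exact h12 b hb hbl x y hx hxy hy
  · intro x y hx hxy hy
    rcases Nat.lt_succ_iff_lt_or_eq.1 hy with hy | rfl
    · rw [hne x (by omega), hne y hy]
      exact h13 x y hx hxy hy
    · rw [Function.update_self]
      rcases hxy.lt_or_eq with hxy | rfl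
      · rw [hne x hxy]
        exact h15 x j hx hxy le_rfl hj
      · rw [Function.update_self]
  · intro x y hx hxo hy hym
    rcases Nat.lt_succ_iff_lt_or_eq.1 hxo with hxo | rfl
    · rw [hne x hxo]
      exact h14 x y hx hxo hy hym
    · rw [Function.update_self]
      exact (hle (by omega)).trans (h10 i y h1 hy hym)
  · intro x y hx hxo hy hyh
    rcases Nat.lt_succ_iff_lt_or_eq.1 hxo with hxo | rfl
    · rw [hne x hxo]
      exact h15 x y hx hxo (by omega) hyh
    · rw [Function.update_self]
      exact h11 j y h3 (by omega) hyh
  · intro x hx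
    rcases Nat.lt_succ_iff_lt_or_eq.1 hx with hx | rfl
    · rw [hne x hx]
      exact h16 x hx
    · exact ⟨j, by omega, Function.update_self ..⟩
  · intro y hy
    by_cases hyi : y = j
    · exact ⟨o, by omega, by rw [hyi, Function.update_self]⟩
    · obtain ⟨x, hx, hxy⟩ := h17 y (by omega)
      exact ⟨x, by omega, by rw [hne x hx, hxy]⟩

theorem finish (h : MergeInv P O s m lo mid hi i j m) :
    (∀ b, 2 * s ∣ b → b < m → SortedOn O b (min (b + 2 * s) m)) ∧
      (∀ x, x < m → ∃ y, y < m ∧ O x = P y) ∧ (∀ y, y < m → ∃ x, x < m ∧ O x = P y) := by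
  obtain ⟨h1, h2, h3, h4, h5, h6, h7, h8, h9, h10, h11, h12, h13, h14, h15, h16, h17⟩ := h
  refine ⟨fun b hb hbm => ?_, h16, fun y hy => h17 y (by omega)⟩
  by_cases hbl : b + 2 * s ≤ lo
  · exact (h12 b hb hbl).mono le_rfl (min_le_left _ _)
  · have : lo ≤ b := by
      by_contra hlt
      exact hbl (dvd_gap hb h8 (by omega))
    exact h13.mono this (min_le_right _ _)

end MergeInv

/-! ### The sorting program -/

namespace RealRAM

/-- The point whose coordinates are entry `i` of the real arrays `a` and `b`. -/
def State.pt (s : State) (a b i : ℕ) : ℝ × ℝ := (s.rarr a i, s.rarr b i)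

@[simp] theorem State.setW_pt (s : State) (x v a b : ℕ) : (s.setW x v).pt a b = s.pt a b := rfl
@[simp] theorem State.putW_pt (s : State) (x i v a b : ℕ) :
    (s.putW x i v).pt a b = s.pt a b := rfl

/-- The minimum of two words. -/
def WExp.min (p q : WExp) : WExp := .sub p (.sub p q)

@[simp] theorem WExp.min_val (p q : WExp) (s : State) :
    (p.min q).val s = Min.min (p.val s) (q.val s) := by
  simp only [WExp.min, WExp.val]
  omega

/-- The maximum of two words. -/
def WExp.max (p q : WExp) : WExp := .add p (.sub q p)

@[simp] theorem WExp.max_val (p q : WExp) (s : State) :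
    (p.max q).val s = Max.max (p.val s) (q.val s) := by
  simp only [WExp.max, WExp.val]
  omega

/-- Increment a word variable. -/
def Prog.inc (x : ℕ) : Prog := .setW x (.add (.var x) (.const 1))

/-- Lexicographic comparison of the points `i` and `j` in the arrays `8` and `9`. -/
def lexLE (i j : WExp) : Test :=
  .disj (.rlt (.get 8 i) (.get 8 j))
    (.conj (.req (.get 8 i) (.get 8 j)) (.neg (.rlt (.get 9 j) (.get 9 i))))

theorem lexLE_holds (i j : WExp) (s : State) :
    (lexLE i j).Holds s ↔ toLex (s.pt 8 9 (i.val s)) ≤ toLex (s.pt 8 9 (j.val s)) := by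
  simp [lexLE, Test.Holds, RExp.val, Prod.Lex.toLex_le_toLex, State.pt]

/-- One round of a merging pass. -/
def mergeStep : Prog :=
  .cond (.weq (.var 35) (.var 32))
    (.setW 30 (.var 35) ;;
      .setW 31 (.min (.add (.var 35) (.var 22)) (.var 20)) ;;
      .setW 32 (.min (.add (.var 35) (.mul (.const 2) (.var 22))) (.var 20)) ;;
      .setW 33 (.var 35) ;; .setW 34 (.var 31)) .skip ;;
  .cond (.conj (.wlt (.var 33) (.var 31))
      (.disj (.neg (.wlt (.var 34) (.var 32))) (lexLE (.var 33) (.var 34))))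
    (.putR 10 (.var 35) (.get 8 (.var 33)) ;; .putR 11 (.var 35) (.get 9 (.var 33)) ;; .inc 33)
    (.putR 10 (.var 35) (.get 8 (.var 34)) ;; .putR 11 (.var 35) (.get 9 (.var 34)) ;; .inc 34) ;;
  .inc 35

/-- Copy the sort buffer back. -/
def copyBack : Prog :=
  .setW 35 (.const 0) ;;
  .loop (.wlt (.var 35) (.var 20))
    (.putR 8 (.var 35) (.get 10 (.var 35)) ;; .putR 9 (.var 35) (.get 11 (.var 35)) ;; .inc 35)

/-- A merging pass. -/
def mergePass : Prog :=
  (.setW 30 (.const 0) ;; .setW 31 (.const 0) ;; .setW 32 (.const 0) ;; .setW 33 (.const 0) ;;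
    .setW 34 (.const 0) ;; .setW 35 (.const 0)) ;;
  .loop (.wlt (.var 35) (.var 20)) mergeStep ;;
  copyBack

/-- Sort the first `n` points of the arrays `8` and `9` lexicographically, where `n` is the value of
word variable `20`. -/
def sortProg : Prog :=
  .setW 22 (.const 1) ;;
  .loop (.wlt (.var 22) (.var 20))
    (mergePass ;; .setW 22 (.mul (.const 2) (.var 22)))

/-- The points of the sort array in the lexicographic order. -/
def State.lexPt (s : State) (a b i : ℕ) : ℝ ×ₗ ℝ := toLex (s.pt a b i)

theorem update_pt (f g : ℕ → ℝ) (o : ℕ) (a b : ℝ) :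
    (fun i => toLex (Function.update f o a i, Function.update g o b i)) =
      Function.update (fun i => toLex (f i, g i)) o (toLex (a, b)) := by
  ext1 i
  by_cases h : i = o
  · subst h; simp
  · simp [h]

theorem mergeStep_vc {B : ℕ} {s : State} {Q : State → Prop}
    (hB : 2 * s.wvar 20 + 2 ≤ B) (hpos : 0 < s.wvar 22)
    (hP : ∀ b, s.wvar 22 ∣ b → b < s.wvar 20 →
      SortedOn (s.lexPt 8 9) b (min (b + s.wvar 22) (s.wvar 20)))
    (h : MergeInv (s.lexPt 8 9) (s.lexPt 10 11) (s.wvar 22) (s.wvar 20) (s.wvar 30) (s.wvar 31)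
      (s.wvar 32) (s.wvar 33) (s.wvar 34) (s.wvar 35))
    (ho : s.wvar 35 < s.wvar 20)
    (hQ : ∀ s' : State, Frame mergeStep s s' → s'.wvar 35 = s.wvar 35 + 1 →
      MergeInv (s.lexPt 8 9) (s'.lexPt 10 11) (s.wvar 22) (s.wvar 20) (s'.wvar 30) (s'.wvar 31)
        (s'.wvar 32) (s'.wvar 33) (s'.wvar 34) (s'.wvar 35) → Q s') :
    Wp B mergeStep mergeStep.flatCost Q s := by
  have key : Wp B mergeStep mergeStep.flatCost (fun s' => s'.wvar 35 = s.wvar 35 + 1 ∧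
      MergeInv (s.lexPt 8 9) (s'.lexPt 10 11) (s.wvar 22) (s.wvar 20) (s'.wvar 30) (s'.wvar 31)
        (s'.wvar 32) (s'.wvar 33) (s'.wvar 34) (s'.wvar 35)) s := by
    -- The merging half of the round is treated for an arbitrary state with the same real arrays, so
    -- that it serves both with and without the opening of a new block.
    have second : ∀ s₁ : State, s₁.rarr = s.rarr → s₁.wvar 20 = s.wvar 20 →
        s₁.wvar 35 = s.wvar 35 →
        s₁.wvar 35 < s₁.wvar 32 →
        MergeInv (s.lexPt 8 9) (s.lexPt 10 11) (s.wvar 22) (s.wvar 20) (s₁.wvar 30) (s₁.wvar 31)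
          (s₁.wvar 32) (s₁.wvar 33) (s₁.wvar 34) (s₁.wvar 35) →
        Prog.Vc B (.cond (.conj (.wlt (.var 33) (.var 31))
      (.disj (.neg (.wlt (.var 34) (.var 32))) (lexLE (.var 33) (.var 34))))
    (.putR 10 (.var 35) (.get 8 (.var 33)) ;; .putR 11 (.var 35) (.get 9 (.var 33)) ;; .inc 33)
    (.putR 10 (.var 35) (.get 8 (.var 34)) ;; .putR 11 (.var 35) (.get 9 (.var 34)) ;; .inc 34) ;;
  .inc 35) (fun s' => s'.wvar 35 = s.wvar 35 + 1 ∧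
      MergeInv (s.lexPt 8 9) (s'.lexPt 10 11) (s.wvar 22) (s.wvar 20) (s'.wvar 30) (s'.wvar 31)
        (s'.wvar 32) (s'.wvar 33) (s'.wvar 34) (s'.wvar 35)) s₁ := by
      intro s₁ hr h20 h35 hhi h
      have a1 := h.i_mid
      have a2 := h.mid_j
      have a3 := h.j_hi
      have a4 := h.hi_m
      have a5 := h.sum
      simp only [Prog.Vc, Prog.inc, WExp.val, Test.Holds, lexLE_holds, RExp.val]
      refine ⟨fun hc => ?_, fun hc => ?_⟩
      · have := h.takeLeft hc.1 (fun hj => by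
          have := hc.2.resolve_left (not_not.2 hj)
          simpa [State.lexPt, State.pt, hr] using this)
        have e' : s.lexPt 8 9 = fun i => toLex (s.rarr 8 i, s.rarr 9 i) := rfl
        have e : ∀ t : State, t.lexPt 10 11 = fun i => toLex (t.rarr 10 i, t.rarr 11 i) :=
          fun t => rfl
        simp [h35, hr, e, update_pt] at this ⊢
        exact ⟨by omega, by omega, by omega, this⟩
      · have hj : s₁.wvar 34 < s₁.wvar 32 := by
          by_contra hj
          exact hc ⟨by omega, .inl hj⟩
        have := h.takeRight hj (fun hi => by
          have : ¬ (toLex (s₁.pt 8 9 (s₁.wvar 33)) ≤ toLex (s₁.pt 8 9 (s₁.wvar 34))) :=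
            fun hle => hc ⟨hi, .inr hle⟩
          simpa [State.lexPt, State.pt, hr] using (not_le.1 this).le)
        have e' : s.lexPt 8 9 = fun i => toLex (s.rarr 8 i, s.rarr 9 i) := rfl
        have e : ∀ t : State, t.lexPt 10 11 = fun i => toLex (t.rarr 10 i, t.rarr 11 i) :=
          fun t => rfl
        simp [h35, hr, e, update_pt] at this ⊢
        exact ⟨by omega, by omega, by omega, this⟩
    refine Wp.of_vc ?_
    have a1 := h.i_mid
    have a2 := h.mid_j
    have a3 := h.j_hi
    have a4 := h.hi_m
    have a5 := h.sum
    rw [mergeStep, Prog.Vc, Prog.Vc]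
    refine ⟨fun hc => ?_, fun hc => ?_⟩
    · simp only [Test.Holds, WExp.val] at hc
      have hn := h.newBlock hc ho hP
      simp only [Prog.Vc, WExp.val, WExp.min_val, State.setW_wvar]
      simp only [Function.update_self, ne_eq, Nat.reduceEqDiff, not_false_eq_true,
        Function.update_of_ne]
      refine ⟨by omega, by omega, by omega, by omega, by omega, second _ rfl ?_ ?_ ?_ ?_⟩
      · simp
      · simp
      · simp
        omega
      · simpa using hn
    · simp only [Test.Holds, WExp.val] at hc
      exact second s rfl rfl rfl (by omega) h
  exact key.framed.imp fun s' hs' => hQ s' hs'.2 hs'.1.1 hs'.1.2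

theorem copyBack_wp {B : ℕ} {s : State} (hB : s.wvar 20 + 2 ≤ B) :
    Wp B copyBack (30 * s.wvar 20 + 30)
      (fun s' => ∀ x, x < s.wvar 20 → s'.pt 8 9 x = s.pt 10 11 x) s := by
  refine Wp.step (T₁ := 2) (T₂ := s.wvar 20 * 30 + 3) (R := fun s' => s' = s.setW 35 0)
    (Wp.flat ⟨by simp only [WExp.val]; omega, rfl⟩ (by decide)) (fun s₁ hs₁ _ => ?_) (by omega)
  refine (Wp.loop_flat
    (fun s' => s'.wvar 20 = s.wvar 20 ∧ s'.rarr 10 = s.rarr 10 ∧ s'.rarr 11 = s.rarr 11 ∧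
      s'.wvar 35 ≤ s.wvar 20 ∧ ∀ x, x < s'.wvar 35 → s'.pt 8 9 x = s.pt 10 11 x)
    (fun s' => s.wvar 20 - s'.wvar 35) (s.wvar 20) ?_ ?_ ?_).mono ?_ ?_
  · subst hs₁
    simp
  · omega
  · rintro s' ⟨a1, a2, a3, a4, a5⟩ hb
    simp only [Test.Holds, WExp.val, a1] at hb
    simp only [Prog.Vc, Prog.inc, WExp.val, RExp.val]
    simp [a1, a2, a3]
    refine ⟨by omega, by omega, ⟨by omega, fun x hx => ?_⟩, by omega⟩
    by_cases hxe : x = s'.wvar 35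
    · subst hxe
      simp [State.pt]
    · have := a5 x (by omega)
      simpa [State.pt, hxe] using this
  · simp [Prog.flatCost, Test.cost, WExp.cost, RExp.cost, Prog.inc]
    omega
  · rintro s' ⟨⟨a1, a2, a3, a4, a5⟩, hb⟩ x hx
    simp only [Test.Holds, WExp.val, a1] at hb
    exact a5 x (by omega)

theorem mergePass_wp {B : ℕ} {s : State} (hB : 2 * s.wvar 20 + 2 ≤ B) (hs : 0 < s.wvar 22)
    (hP : ∀ b, s.wvar 22 ∣ b → b < s.wvar 20 →
      SortedOn (s.lexPt 8 9) b (min (b + s.wvar 22) (s.wvar 20))) :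
    Wp B mergePass (200 * s.wvar 20 + 50)
      (fun s' => (∀ b, 2 * s.wvar 22 ∣ b → b < s.wvar 20 →
          SortedOn (s'.lexPt 8 9) b (min (b + 2 * s.wvar 22) (s.wvar 20))) ∧
        (∀ x, x < s.wvar 20 → ∃ y, y < s.wvar 20 ∧ s'.pt 8 9 x = s.pt 8 9 y) ∧
        (∀ y, y < s.wvar 20 → ∃ x, x < s.wvar 20 ∧ s'.pt 8 9 x = s.pt 8 9 y)) s := by
  refine Wp.step (T₁ := 12) (T₂ := s.wvar 20 * 123 + 3 + (30 * s.wvar 20 + 30))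
    (R := fun s' => s'.rarr = s.rarr ∧
      s'.wvar 30 = 0 ∧ s'.wvar 31 = 0 ∧ s'.wvar 32 = 0 ∧ s'.wvar 33 = 0 ∧ s'.wvar 34 = 0 ∧
      s'.wvar 35 = 0) ?_ (fun s₁ hs₁ hf₁ => ?_) (by omega)
  · refine Wp.flat ?_ (by decide)
    simp [Prog.Vc, WExp.val]
    omega
  have cost : mergeStep.flatCost ≤ 120 := by decide
  refine Wp.step (R := fun s' => (s'.wvar 20 = s.wvar 20 ∧ s'.wvar 22 = s.wvar 22 ∧
      s'.rarr 8 = s.rarr 8 ∧ s'.rarr 9 = s.rarr 9 ∧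
      MergeInv (s.lexPt 8 9) (s'.lexPt 10 11) (s.wvar 22) (s.wvar 20) (s'.wvar 30) (s'.wvar 31)
        (s'.wvar 32) (s'.wvar 33) (s'.wvar 34) (s'.wvar 35)) ∧ ¬ s'.wvar 35 < s'.wvar 20)
    ((Wp.loop_const _ (fun s' => s.wvar 20 - s'.wvar 35) 120 (s.wvar 20) ?_ ?_ ?_)) ?_ le_rfl
  · obtain ⟨a0, a3, a4, a5, a6, a7, a8⟩ := hs₁
    have e : ∀ a b, s₁.lexPt a b = s.lexPt a b := fun a b => by
      ext1 i
      simp [State.lexPt, State.pt, a0]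
    rw [e, a3, a4, a5, a6, a7, a8, a0]
    exact ⟨hf₁.wvar 20 (by decide), hf₁.wvar 22 (by decide), rfl, rfl, .zero hs⟩
  · omega
  · rintro s' ⟨a1, a2, a3, a4, a5⟩ hb
    simp only [Test.Holds, WExp.val, a1] at hb
    have hpt : s'.lexPt 8 9 = s.lexPt 8 9 := by
      ext1 i
      simp [State.lexPt, State.pt, a3, a4]
    refine Wp.mono (mergeStep_vc (by rw [a1]; exact hB) (by rw [a2]; exact hs) ?_ ?_ (by rw [a1]; exact hb) ?_) cost
      (fun _ h => h)
    · rw [a1, a2, hpt]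
      exact hP
    · rw [a1, a2, hpt]
      exact a5
    · intro s'' hf hw hm
      rw [hpt, a1, a2] at hm
      refine ⟨⟨?_, ?_, ?_, ?_, hm⟩, by omega⟩
      · rw [hf.wvar 20 (by decide), a1]
      · rw [hf.wvar 22 (by decide), a2]
      · rw [hf.rarr 8 (by decide), a3]
      · rw [hf.rarr 9 (by decide), a4]
  · rintro s₂ ⟨⟨a1, a2, a3, a4, a5⟩, hb⟩ -
    -- The output position cannot pass the end of the block: `o = i + j - mid ≤ hi ≤ m`.
    have ho : s₂.wvar 35 = s.wvar 20 := by
      have b1 := a5.i_mid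
      have b2 := a5.j_hi
      have b3 := a5.hi_m
      have b4 := a5.sum
      omega
    rw [ho] at a5
    obtain ⟨f1, f2, f3⟩ := a5.finish
    refine (copyBack_wp (by omega)).mono (by rw [a1]) fun s' hs' => ?_
    rw [a1] at hs'
    refine ⟨fun b hb1 hb2 x y hx hxy hy => ?_, fun x hx => ?_, fun x hx => ?_⟩
    · simp only [State.lexPt]
      rw [hs' x (by omega), hs' y (by omega)]
      exact f1 b hb1 hb2 x y hx hxy hy
    · rw [hs' x hx]
      exact f2 x hx
    · obtain ⟨y, hy, hyx⟩ := f3 x hx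
      refine ⟨y, hy, ?_⟩
      rw [hs' y hy]
      exact hyx

/-- Merge sort: the result is sorted and consists of the same points. -/
theorem sortProg_wp {B k : ℕ} {s : State} (hB : 2 * s.wvar 20 + 2 ≤ B) (hk : s.wvar 20 ≤ 2 ^ k) :
    Wp B sortProg (300 * (s.wvar 20 + 1) * (k + 1))
      (fun s' => SortedOn (s'.lexPt 8 9) 0 (s.wvar 20) ∧
        (∀ x, x < s.wvar 20 → ∃ y, y < s.wvar 20 ∧ s'.pt 8 9 x = s.pt 8 9 y) ∧
        (∀ y, y < s.wvar 20 → ∃ x, x < s.wvar 20 ∧ s'.pt 8 9 x = s.pt 8 9 y)) s := by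
  set m := s.wvar 20 with hm
  refine Wp.step (T₁ := 2) (T₂ := k * (200 * m + 54 + 3) + 3) (R := fun s' => s' = s.setW 22 1)
    (Wp.flat ⟨by simp only [WExp.val]; omega, rfl⟩ (by decide)) (fun s₁ hs₁ _ => ?_)
    (by nlinarith)
  refine (Wp.loop_const
    (fun s' => s'.wvar 20 = m ∧ (∃ r, r ≤ k ∧ s'.wvar 22 = 2 ^ r) ∧
      (∀ b, s'.wvar 22 ∣ b → b < m →
          SortedOn (s'.lexPt 8 9) b (min (b + s'.wvar 22) m)) ∧
        (∀ x, x < m → ∃ y, y < m ∧ s'.pt 8 9 x = s.pt 8 9 y) ∧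
        (∀ y, y < m → ∃ x, x < m ∧ s'.pt 8 9 x = s.pt 8 9 y))
    -- The block length is a power of two, and it is below `2 ^ k` as long as the loop runs, so its
    -- logarithm counts the passes.
    (fun s' => k - Nat.log 2 (s'.wvar 22)) (200 * m + 54) k ?_ ?_ ?_).imp ?_
  · subst hs₁
    refine ⟨by simp [hm], ⟨0, by simp⟩, ?_, fun x hx => ⟨x, hx, rfl⟩, fun x hx => ⟨x, hx, rfl⟩⟩
    intro b _ _ x y hx hxy hy
    simp at hy
    have : x = y := by omega
    rw [this]
  · omega
  · rintro s' ⟨a1, ⟨r, hr, a2⟩, a3, a4, a5⟩ hb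
    simp only [Test.Holds, WExp.val, a1, a2] at hb
    have hrk : r < k := by
      by_contra hc
      have : (2 : ℕ) ^ k ≤ 2 ^ r := Nat.pow_le_pow_right (by norm_num) (by omega)
      omega
    refine Wp.step (T₂ := 4) (mergePass_wp (s := s') (by omega) (by rw [a2]; positivity)
      (by rw [a1]; exact a3)) ?_ (by rw [a1])
    rintro s₂ ⟨b1, b2, b3⟩ hf
    rw [a1] at b1 b2 b3
    have w22 := hf.wvar 22 (by decide)
    have w20 := hf.wvar 20 (by decide)
    refine Wp.flat ?_ (by decide)
    simp only [Prog.Vc, WExp.val]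
    refine ⟨by rw [w22, a2]; omega, ⟨?_, ⟨r + 1, by omega, ?_⟩, ?_, ?_, ?_⟩, ?_⟩
    · simp [w20, a1]
    · simp [w22, a2, pow_succ, mul_comm]
    · simp only [State.setW_wvar, Function.update_self, w22]
      exact b1
    · intro x hx
      obtain ⟨y, hy, hxy⟩ := b2 x hx
      obtain ⟨z, hz, hyz⟩ := a4 y hy
      exact ⟨z, hz, by rw [← hyz, ← hxy]; rfl⟩
    · intro x hx
      obtain ⟨y, hy, hxy⟩ := a5 x hx
      obtain ⟨z, hz, hyz⟩ := b3 y hy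
      exact ⟨z, hz, by rw [← hxy, ← hyz]; rfl⟩
    · simp only [State.setW_wvar, Function.update_self, w22, a2]
      rw [show 2 * 2 ^ r = 2 ^ (r + 1) by ring, Nat.log_pow (by norm_num),
        Nat.log_pow (by norm_num)]
      omega
  · rintro s' ⟨⟨a1, ⟨r, hr, a2⟩, a3, a4, a5⟩, hb⟩
    simp only [Test.Holds, WExp.val, a1] at hb
    exact ⟨fun x y hx hxy hy => a3 0 (dvd_zero _) (by omega) x y hx hxy (by omega), a4, a5⟩

end RealRAM

/-! ### Upper chains and the scan -/

/-- The value of the functional `(u, 1)` at `p`. -/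
def dirVal (u : ℝ) (p : ℝ × ℝ) : ℝ := p.2 + u * p.1

/-- `v 0, …, v (k - 1)` is the upper boundary of the convex hull of `S` from its
lexicographically smallest to its lexicographically largest point, without collinear triples. -/
structure UpperChain (S : Set (ℝ × ℝ)) (k : ℕ) (v : ℕ → ℝ × ℝ) : Prop where
  pos : 0 < k
  mem : ∀ i, i < k → v i ∈ S
  lex : ∀ i, i + 1 < k → toLex (v i) < toLex (v (i + 1))
  turn : ∀ i, i + 2 < k → cross (v (i + 1) - v i) (v (i + 2) - v i) < 0
  dom : ∀ u, ∀ p ∈ S, ∃ i, i < k ∧ dirVal u p ≤ dirVal u (v i)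
  first : ∀ p ∈ S, toLex (v 0) ≤ toLex p
  last : ∀ p ∈ S, toLex p ≤ toLex (v (k - 1))

/-- In terms of the values of the functional, the cross product is `(q.1 - p.1) * (val r - val q) -
(r.1 - q.1) * (val q - val p)`. If `q` strictly beats both neighbours, this is negative, unless all
three abscissae agree; then `toLex q ≤ toLex r` gives the contradiction. Hence the scan may discard
`q`. -/
theorem dirVal_le_of_not_right_turn {p q r : ℝ × ℝ} (u : ℝ) (h1 : toLex p < toLex q)
    (h2 : toLex q ≤ toLex r) (h : 0 ≤ cross (q - p) (r - p)) :
    dirVal u q ≤ dirVal u p ∨ dirVal u q ≤ dirVal u r := by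
  by_contra! hc
  obtain ⟨c1, c2⟩ := hc
  rw [Prod.Lex.toLex_lt_toLex] at h1
  rw [Prod.Lex.toLex_le_toLex] at h2
  simp only [cross, dirVal, Prod.fst_sub, Prod.snd_sub] at *
  have e : (q.1 - p.1) * (r.2 - p.2) - (q.2 - p.2) * (r.1 - p.1) =
      (q.1 - p.1) * ((r.2 + u * r.1) - (q.2 + u * q.1)) -
      (r.1 - q.1) * ((q.2 + u * q.1) - (p.2 + u * p.1)) := by ring
  rw [e] at h
  have ha : 0 ≤ q.1 - p.1 := by rcases h1 with h1 | h1 <;> linarith [h1]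
  have hb : 0 ≤ r.1 - q.1 := by rcases h2 with h2 | h2 <;> linarith [h2]
  rcases ha.lt_or_eq with ha | ha
  · nlinarith
  rcases hb.lt_or_eq with hb | hb
  · nlinarith
  rcases h2 with h2 | h2
  · linarith
  · rw [h2.1] at c2
    linarith

/-- The invariant of the scan of the sorted points `P 0, …, P (m - 1)`: the first `i` points have
been scanned, and `V 0, …, V (t - 1)` is the stack. -/
structure ScanInv (P V : ℕ → ℝ × ℝ) (m t i : ℕ) : Prop where
  i_le : i ≤ m
  t_le : t ≤ i
  t_pos : 0 < i → 0 < t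
  bot : 0 < t → V 0 = P 0
  mem : ∀ x, x < t → ∃ y, y < i ∧ V x = P y
  lex : ∀ x, x + 1 < t → toLex (V x) < toLex (V (x + 1))
  turn : ∀ x, x + 2 < t → cross (V (x + 1) - V x) (V (x + 2) - V x) < 0
  dom : ∀ u y, y < i →
    (∃ x, x < t ∧ dirVal u (P y) ≤ dirVal u (V x)) ∨ i < m ∧ dirVal u (P y) ≤ dirVal u (P i)
  top : i = m → 0 < m → V (t - 1) = P (m - 1)

namespace ScanInv

variable {P V : ℕ → ℝ × ℝ} {m t i : ℕ}

theorem zero : ScanInv P V m 0 0 := by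
  constructor <;> omega

/-- In each direction the popped point is dominated by the point beneath it or by `P i`. The latter
is not yet on the stack, which is why `dom` admits `P i` as a witness. -/
theorem pop (h : ScanInv P V m t i) (hP : SortedOn (fun x => toLex (P x)) 0 m) (ht : 1 < t)
    (hi : i < m) (hc : 0 ≤ cross (V (t - 1) - V (t - 2)) (P i - V (t - 2))) :
    ScanInv P V m (t - 1) i where
  i_le := h.i_le
  t_le := by have := h.t_le; omega
  t_pos := by omega
  bot _ := h.bot (by omega)
  mem x hx := h.mem x (by omega)
  lex x hx := h.lex x (by omega)
  turn x hx := h.turn x (by omega)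
  top := by omega
  dom u y hy := by
    rcases h.dom u y hy with ⟨x, hx, hxy⟩ | hr
    · by_cases hxt : x = t - 1
      · obtain ⟨z, hz, hzt⟩ := h.mem (t - 1) (by omega)
        have h1 := h.lex (t - 2) (by omega)
        rw [show t - 2 + 1 = t - 1 by omega] at h1
        have h2 : toLex (V (t - 1)) ≤ toLex (P i) := by
          rw [hzt]
          exact hP z i (Nat.zero_le _) hz.le hi
        subst hxt
        rcases dirVal_le_of_not_right_turn u h1 h2 hc with h3 | h3
        · exact .inl ⟨t - 2, by omega, hxy.trans h3⟩
        · exact .inr ⟨hi, hxy.trans h3⟩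
      · exact .inl ⟨x, by omega, hxy⟩
    · exact .inr hr

/-- A repeated point must not be pushed, since `lex` is strict. It is already on top of the stack
and takes over the role of `P i` in `dom`. -/
theorem skip (h : ScanInv P V m t i) (ht : 0 < t) (hi : i < m) (he : V (t - 1) = P i) :
    ScanInv P V m t (i + 1) where
  i_le := hi
  t_le := by have := h.t_le; omega
  t_pos _ := ht
  bot := h.bot
  mem x hx := by
    obtain ⟨y, hy, hxy⟩ := h.mem x hx
    exact ⟨y, by omega, hxy⟩
  lex := h.lex
  turn := h.turn
  dom u y hy := by
    rcases Nat.lt_succ_iff_lt_or_eq.1 hy with hy | rfl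
    · rcases h.dom u y hy with hl | ⟨-, hr⟩
      · exact .inl hl
      · exact .inl ⟨t - 1, by omega, he ▸ hr⟩
    · exact .inl ⟨t - 1, by omega, he ▸ le_rfl⟩
  top him hm := by rw [he, ← him]; rfl

theorem push (h : ScanInv P V m t i) (hP : SortedOn (fun x => toLex (P x)) 0 m)
    (hi : i < m) (hne : 0 < t → V (t - 1) ≠ P i)
    (hc : 1 < t → cross (V (t - 1) - V (t - 2)) (P i - V (t - 2)) < 0) :
    ScanInv P (Function.update V t (P i)) m (t + 1) (i + 1) := by
  have ne : ∀ x, x < t → Function.update V t (P i) x = V x := fun x hx =>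
    Function.update_of_ne hx.ne _ _
  refine ⟨hi, by have := h.t_le; omega, by omega, fun _ => ?_, fun x hx => ?_, fun x hx => ?_,
    fun x hx => ?_, fun u y hy => ?_, fun him hm => ?_⟩
  · by_cases ht : t = 0
    · have hi0 : i = 0 := by
        by_contra hi0
        have := h.t_pos (by omega)
        omega
      subst ht hi0
      simp
    · rw [ne 0 (by omega)]
      exact h.bot (by omega)
  · rcases Nat.lt_succ_iff_lt_or_eq.1 hx with hx | rfl
    · obtain ⟨y, hy, hxy⟩ := h.mem x hx
      exact ⟨y, by omega, by rw [ne x hx, hxy]⟩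
    · exact ⟨i, by omega, Function.update_self ..⟩
  · by_cases hxt : x + 1 < t
    · rw [ne x (by omega), ne _ hxt]
      exact h.lex x hxt
    · obtain rfl : t = x + 1 := by omega
      rw [ne x (by omega), Function.update_self]
      obtain ⟨z, hz, hzt⟩ := h.mem x (by omega)
      refine lt_of_le_of_ne ?_ fun he => hne (by omega) (toLex.injective he)
      rw [hzt]
      exact hP z i (Nat.zero_le _) hz.le hi
  · by_cases hxt : x + 2 < t
    · rw [ne x (by omega), ne _ hxt, ne _ (by omega)]
      exact h.turn x hxt
    · obtain rfl : t = x + 2 := by omega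
      rw [ne x (by omega), ne (x + 1) (by omega), Function.update_self]
      exact hc (by omega)
  · left
    rcases Nat.lt_succ_iff_lt_or_eq.1 hy with hy | rfl
    · rcases h.dom u y hy with ⟨x, hx, hxy⟩ | ⟨-, hr⟩
      · exact ⟨x, by omega, by rwa [ne x hx]⟩
      · exact ⟨t, by omega, by rwa [Function.update_self]⟩
    · exact ⟨t, by omega, by rw [Function.update_self]⟩
  · rw [show t + 1 - 1 = t by omega, Function.update_self, ← him]
    rfl

theorem upperChain (h : ScanInv P V m t m) (hP : SortedOn (fun x => toLex (P x)) 0 m)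
    (hm : 0 < m) : UpperChain (P '' Set.Iio m) t V where
  pos := h.t_pos hm
  mem x hx := by
    obtain ⟨y, hy, hxy⟩ := h.mem x hx
    exact ⟨y, hy, hxy.symm⟩
  lex := h.lex
  turn := h.turn
  dom u p hp := by
    obtain ⟨y, hy, rfl⟩ := hp
    rcases h.dom u y hy with hl | hr
    · exact hl
    · omega
  first p hp := by
    obtain ⟨y, hy, rfl⟩ := hp
    rw [h.bot (h.t_pos hm)]
    exact hP 0 y le_rfl (Nat.zero_le _) hy
  last p hp := by
    obtain ⟨y, hy, rfl⟩ := hp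
    have hy : y < m := hy
    rw [h.top rfl hm]
    exact hP y (m - 1) (Nat.zero_le _) (by omega) (by omega)

end ScanInv

/-! ### The scanning program -/

namespace RealRAM

/-- The cross product of the vectors with coordinates `a`, `b` and `c`, `d`. -/
def RExp.cross (a b c d : RExp) : RExp := .sub (.mul a d) (.mul b c)

/-- One round of the scan. -/
def scanStep : Prog :=
  .cond (.conj (.wlt (.const 1) (.var 21)) (.neg (.rlt
      (.cross (.sub (.get 12 (.sub (.var 21) (.const 1))) (.get 12 (.sub (.var 21) (.const 2))))
        (.sub (.get 13 (.sub (.var 21) (.const 1))) (.get 13 (.sub (.var 21) (.const 2))))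
        (.sub (.get 8 (.var 33)) (.get 12 (.sub (.var 21) (.const 2))))
        (.sub (.get 9 (.var 33)) (.get 13 (.sub (.var 21) (.const 2)))))
      (.const 0))))
    (.setW 21 (.sub (.var 21) (.const 1)))
    (.cond (.conj (.wlt (.const 0) (.var 21))
        (.conj (.req (.get 12 (.sub (.var 21) (.const 1))) (.get 8 (.var 33)))
          (.req (.get 13 (.sub (.var 21) (.const 1))) (.get 9 (.var 33)))))
      (.inc 33)
      (.putR 12 (.var 21) (.get 8 (.var 33)) ;; .putR 13 (.var 21) (.get 9 (.var 33)) ;;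
        .inc 21 ;; .inc 33))

/-- The upper chain of the sorted points in the arrays `8` and `9`. -/
def scanProg : Prog :=
  (.setW 21 (.const 0) ;; .setW 33 (.const 0)) ;;
  .loop (.wlt (.var 33) (.var 20)) scanStep

theorem update_pt' (f g : ℕ → ℝ) (o : ℕ) (p : ℝ × ℝ) :
    (fun i => (Function.update f o p.1 i, Function.update g o p.2 i)) =
      Function.update (fun i => (f i, g i)) o p := by
  ext1 i
  by_cases h : i = o
  · subst h; simp
  · simp [h]

/-- A round either pops a point or consumes one while the stack grows by at most one; both lower `2
* (m - i) + t`, where `i` is the position and `t` the height of the stack. This makes the scan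
linear. -/
theorem scanStep_vc {B : ℕ} {s : State} {P : ℕ → ℝ × ℝ} {m : ℕ} (hB : m + 2 ≤ B)
    (hm : s.wvar 20 = m) (hPs : s.pt 8 9 = P) (hP : SortedOn (fun x => toLex (P x)) 0 m)
    (hi : s.wvar 33 < m) (h : ScanInv P (s.pt 12 13) m (s.wvar 21) (s.wvar 33)) :
    scanStep.Vc B (fun s' => (s'.wvar 20 = m ∧ s'.pt 8 9 = P ∧
      ScanInv P (s'.pt 12 13) m (s'.wvar 21) (s'.wvar 33)) ∧
      2 * (m - s'.wvar 33) + s'.wvar 21 < 2 * (m - s.wvar 33) + s.wvar 21) s := by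
  have ht := h.t_le
  have hx : ∀ i, s.rarr 8 i = (P i).1 := fun i => by rw [← hPs]; rfl
  have hy : ∀ i, s.rarr 9 i = (P i).2 := fun i => by rw [← hPs]; rfl
  simp only [scanStep, Prog.Vc, Test.Holds, Prog.inc]
  refine ⟨fun hc => ⟨?_, ⟨hm, hPs, ?_⟩, ?_⟩, fun hc => ⟨fun hd => ⟨?_, ⟨?_, hPs, ?_⟩, ?_⟩,
    fun hd => ⟨?_, ?_, ?_, ?_, ⟨?_, ?_, ?_⟩, ?_⟩⟩⟩
  · simp only [WExp.val]
    omega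
  · simp only [WExp.val, RExp.val, RExp.cross, hx, hy] at hc
    have := h.pop hP hc.1 hi (by simpa [cross, State.pt] using hc.2)
    simpa [WExp.val] using this
  · simp [WExp.val] at hc ⊢
    omega
  · simp only [WExp.val]
    omega
  · simpa using hm
  · simp only [WExp.val, RExp.val, hx, hy] at hd
    have := h.skip hd.1 hi (Prod.ext hd.2.1 hd.2.2)
    simpa [WExp.val] using this
  · simp [WExp.val]
    omega
  · simp only [WExp.val]
    omega
  · simp [WExp.val]
    omega
  · simp [WExp.val]
    omega
  · simp [WExp.val]
    omega
  · simpa using hm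
  · rw [← hPs]
    ext1 i
    simp [State.pt]
  · simp only [WExp.val, RExp.val, RExp.cross, hx, hy] at hc hd
    have := h.push hP hi (fun h1 h2 => hd ⟨h1, congrArg Prod.fst h2, congrArg Prod.snd h2⟩)
      (fun h1 => by
        by_contra h2
        exact hc ⟨h1, by simpa [cross, State.pt] using h2⟩)
    have e : ∀ t : State, t.pt 12 13 = fun i => (t.rarr 12 i, t.rarr 13 i) := fun t => rfl
    rw [e] at this ⊢
    simpa [WExp.val, RExp.val, update_pt', hx, hy] using this
  · simp [WExp.val]
    omega

theorem scanProg_wp {B : ℕ} {s : State} (hB : s.wvar 20 + 2 ≤ B) (hm : 0 < s.wvar 20)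
    (hP : SortedOn (s.lexPt 8 9) 0 (s.wvar 20)) :
    Wp B scanProg (300 * s.wvar 20 + 30)
      (fun s' => s'.wvar 21 ≤ s.wvar 20 ∧
        UpperChain (s.pt 8 9 '' Set.Iio (s.wvar 20)) (s'.wvar 21) (s'.pt 12 13)) s := by
  refine Wp.step (T₁ := 10) (T₂ := 2 * s.wvar 20 * 123 + 3)
    (R := fun s' => s'.wvar 21 = 0 ∧ s'.wvar 33 = 0 ∧ s'.wvar 20 = s.wvar 20 ∧
      s'.rarr = s.rarr) ?_ (fun s₁ hs₁ _ => ?_) (by omega)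
  · refine Wp.flat ?_ (by decide)
    simp [Prog.Vc, WExp.val]
    omega
  · obtain ⟨a1, a2, a3, a4⟩ := hs₁
    have hf : scanStep.flatCost ≤ 120 := by decide
    refine (Wp.loop_flat (fun s' => s'.wvar 20 = s.wvar 20 ∧ s'.pt 8 9 = s.pt 8 9 ∧
      ScanInv (s.pt 8 9) (s'.pt 12 13) (s.wvar 20) (s'.wvar 21) (s'.wvar 33))
      (fun s' => 2 * (s.wvar 20 - s'.wvar 33) + s'.wvar 21) (2 * s.wvar 20) ?_ ?_ ?_).mono ?_ ?_
    · refine ⟨a3, ?_, ?_⟩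
      · ext1 i
        simp [State.pt, a4]
      · rw [a1, a2]
        exact .zero
    · omega
    · rintro s' ⟨b1, b2, b3⟩ hb
      simp only [Test.Holds, WExp.val, b1] at hb
      exact scanStep_vc hB b1 b2 hP hb b3
    · simp only [Test.cost, WExp.cost]
      have : 2 * s.wvar 20 * (scanStep.flatCost + (1 + 1 + 1)) ≤ 2 * s.wvar 20 * 123 :=
        Nat.mul_le_mul_left _ (by omega)
      omega
    · rintro s' ⟨⟨b1, b2, b3⟩, hb⟩
      simp only [Test.Holds, WExp.val, b1] at hb
      have := b3.i_le
      have e : s'.wvar 33 = s.wvar 20 := by omega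
      rw [e] at b3
      exact ⟨b3.t_le, b3.upperChain hP hm⟩

end RealRAM

/-! ### Minkowski sums of chains -/

theorem dirVal_add (u : ℝ) (p q : ℝ × ℝ) : dirVal u (p + q) = dirVal u p + dirVal u q := by
  simp [dirVal]; ring

theorem dirVal_sub (u : ℝ) (p q : ℝ × ℝ) : dirVal u (p - q) = dirVal u p - dirVal u q := by
  simp [dirVal]; ring

theorem toLex_sub_pos {p q : ℝ × ℝ} (h : toLex p < toLex q) :
    0 < (q - p).1 ∨ (q - p).1 = 0 ∧ 0 < (q - p).2 := by
  rw [Prod.Lex.toLex_lt_toLex] at h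
  simp only [Prod.fst_sub, Prod.snd_sub, sub_pos, sub_eq_zero]
  exact h.imp id fun h => ⟨h.1.symm, h.2⟩

/-- Among lexicographically positive vectors, turning clockwise means becoming less steep. So if `e`
does not ascend with respect to `(u, 1)`, neither does a vector `f` that is not counterclockwise
from `e`. -/
theorem dirVal_nonpos_of_cross_nonpos {e f : ℝ × ℝ} (u : ℝ) (he : 0 < e.1 ∨ e.1 = 0 ∧ 0 < e.2)
    (hf : 0 < f.1 ∨ f.1 = 0 ∧ 0 < f.2) (hc : cross e f ≤ 0) (h : dirVal u e ≤ 0) :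
    dirVal u f ≤ 0 := by
  simp only [dirVal, cross] at *
  have hf1 : 0 ≤ f.1 := by rcases hf with hf | hf <;> linarith [hf]
  rcases he with he | ⟨he, he2⟩
  · by_contra hc'
    push Not at hc'
    nlinarith
  · rw [he] at h
    linarith

namespace UpperChain

variable {S S' : Set (ℝ × ℝ)} {r r' : ℕ} {a b : ℕ → ℝ × ℝ}

/-- The edges turn clockwise, so every functional `(u, 1)` is unimodal along the chain: once it
fails to increase, it never increases again. The statement about the next edge carries the
induction. -/
theorem dirVal_le_of_le (h : UpperChain S r a) (u : ℝ) {k : ℕ}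
    (hk : dirVal u (a (k + 1)) ≤ dirVal u (a k)) {l : ℕ} (hkl : k ≤ l) (hl : l < r) :
    dirVal u (a l) ≤ dirVal u (a k) ∧ (l + 1 < r → dirVal u (a (l + 1)) ≤ dirVal u (a l)) := by
  induction l, hkl using Nat.le_induction with
  | base => exact ⟨le_rfl, fun _ => hk⟩
  | succ l hkl ih =>
    obtain ⟨h1, h2⟩ := ih (by omega)
    refine ⟨(h2 hl).trans h1, fun hl2 => ?_⟩
    have ht := h.turn l hl2
    have e1 := toLex_sub_pos (h.lex l hl)
    have e2 := toLex_sub_pos (h.lex (l + 1) hl2)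
    have hc : cross (a (l + 1) - a l) (a (l + 1 + 1) - a (l + 1)) ≤ 0 := by
      refine le_trans (le_of_eq ?_) ht.le
      simp only [cross, Prod.fst_sub, Prod.snd_sub]
      ring
    have := dirVal_nonpos_of_cross_nonpos u e1 e2 hc (by
      rw [dirVal_sub]
      linarith [h2 hl])
    rw [dirVal_sub] at this
    linarith

/-- If the edge of `a` at `k` is at least as steep as the edge of `b` at `l`, then the pairs that
use `a k` and a point of `b` beyond `l` are dominated by others. -/
theorem advance (ha : UpperChain S r a) (hb : UpperChain S' r' b) (u : ℝ) {k l l' : ℕ}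
    (hk : k + 1 < r)
    (hc : l + 1 < r' → cross (a (k + 1) - a k) (b (l + 1) - b l) ≤ 0) (hl : l ≤ l')
    (hl' : l' < r') :
    dirVal u (b l') ≤ dirVal u (b l) ∨ dirVal u (a k) ≤ dirVal u (a (k + 1)) := by
  by_cases he : dirVal u (a k) ≤ dirVal u (a (k + 1))
  · exact .inr he
  · rcases hl.eq_or_lt with rfl | hll
    · exact .inl le_rfl
    · refine .inl (hb.dirVal_le_of_le u ?_ hl hl').1
      have := dirVal_nonpos_of_cross_nonpos u (toLex_sub_pos (ha.lex k hk))
        (toLex_sub_pos (hb.lex l (by omega))) (hc (by omega)) (by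
          rw [dirVal_sub]
          linarith)
      rw [dirVal_sub] at this
      linarith

end UpperChain

/-- Every pair of chain points is dominated by a point of `O` or by a pair from `(k, l)` on. -/
def PairsDominated (a b : ℕ → ℝ × ℝ) (r r' : ℕ) (O : Set (ℝ × ℝ)) (k l : ℕ) : Prop :=
  ∀ u k' l', k' < r → l' < r' → (∃ o ∈ O, dirVal u (a k' + b l') ≤ dirVal u o) ∨
    ∃ k₁ l₁, k ≤ k₁ ∧ k₁ < r ∧ l ≤ l₁ ∧ l₁ < r' ∧
      dirVal u (a k' + b l') ≤ dirVal u (a k₁ + b l₁)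

namespace PairsDominated

variable {S S' : Set (ℝ × ℝ)} {a b : ℕ → ℝ × ℝ} {r r' k l : ℕ} {O : Set (ℝ × ℝ)}

/-- Only the pairs with first index `k` are given up. In each direction, either `a (k + 1)` is no
worse than `a k`, or no later point of `b` is better than `b l`, and then the recorded sum `a k + b
l` dominates them. -/
theorem advanceLeft (h : PairsDominated a b r r' O k l) (ha : UpperChain S r a)
    (hb : UpperChain S' r' b) (hk : k + 1 < r)
    (hc : l + 1 < r' → cross (a (k + 1) - a k) (b (l + 1) - b l) ≤ 0) {O' : Set (ℝ × ℝ)}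
    (hO : O ⊆ O') (hO' : a k + b l ∈ O') : PairsDominated a b r r' O' (k + 1) l := by
  intro u k' l' hk' hl'
  rcases h u k' l' hk' hl' with ⟨o, ho, hle⟩ | ⟨k₁, l₁, h1, h2, h3, h4, h5⟩
  · exact .inl ⟨o, hO ho, hle⟩
  · rcases h1.eq_or_lt with rfl | h1
    · rw [dirVal_add u (a k) (b l₁)] at h5
      rcases ha.advance hb u hk hc h3 h4 with h6 | h6
      · refine .inl ⟨_, hO', ?_⟩
        rw [dirVal_add u (a k)]
        linarith
      · refine .inr ⟨k + 1, l₁, le_rfl, hk, h3, h4, ?_⟩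
        rw [dirVal_add u (a (k + 1))]
        linarith
    · exact .inr ⟨k₁, l₁, h1, h2, h3, h4, h5⟩

theorem advanceRight (h : PairsDominated a b r r' O k l) (ha : UpperChain S r a)
    (hb : UpperChain S' r' b) (hl : l + 1 < r')
    (hc : k + 1 < r → 0 < cross (a (k + 1) - a k) (b (l + 1) - b l)) {O' : Set (ℝ × ℝ)}
    (hO : O ⊆ O') (hO' : a k + b l ∈ O') : PairsDominated a b r r' O' k (l + 1) := by
  intro u k' l' hk' hl'
  rcases h u k' l' hk' hl' with ⟨o, ho, hle⟩ | ⟨k₁, l₁, h1, h2, h3, h4, h5⟩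
  · exact .inl ⟨o, hO ho, hle⟩
  · rcases h3.eq_or_lt with rfl | h3
    · rw [dirVal_add u (a k₁) (b l)] at h5
      have hc' : k + 1 < r → cross (b (l + 1) - b l) (a (k + 1) - a k) ≤ 0 := fun hk => by
        have := hc hk
        simp only [cross] at this ⊢
        linarith
      rcases hb.advance ha u hl hc' h1 h2 with h6 | h6
      · refine .inl ⟨_, hO', ?_⟩
        rw [dirVal_add u (a k)]
        linarith
      · refine .inr ⟨k₁, l + 1, h1, h2, le_rfl, hl, ?_⟩
        rw [dirVal_add u (a k₁) (b (l + 1))]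
        linarith
    · exact .inr ⟨k₁, l₁, h1, h2, h3, h4, h5⟩

end PairsDominated

/-! ### The merging program for Minkowski sums -/

namespace RealRAM

/-- Copy the points `lo, …, hi - 1` of the arrays `a` and `b`, multiplied by `σ`, to the arrays
`c` and `d`, where `lo` and `hi` are the values of the word variables `23` and `24`. -/
def collect (a b c d : ℕ) (σ : ℤ) : Prog :=
  .setW 20 (.const 0) ;;
  .loop (.wlt (.add (.var 23) (.var 20)) (.var 24))
    (.putR c (.var 20) (.mul (.const σ) (.get a (.add (.var 23) (.var 20)))) ;;
      .putR d (.var 20) (.mul (.const σ) (.get b (.add (.var 23) (.var 20)))) ;; .inc 20)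

theorem collect_wp {B : ℕ} {s : State} {a b c d : ℕ} {σ : ℤ} (hac : a ≠ c) (had : a ≠ d)
    (hbc : b ≠ c) (hbd : b ≠ d) (hcd : c ≠ d) (hB : s.wvar 24 + 2 ≤ B) :
    Wp B (collect a b c d σ) (40 * (s.wvar 24 - s.wvar 23) + 40)
      (fun s' => s'.wvar 20 = s.wvar 24 - s.wvar 23 ∧
        ∀ x, x < s.wvar 24 - s.wvar 23 → s'.pt c d x = (σ : ℝ) • s.pt a b (s.wvar 23 + x)) s := by
  refine Wp.step (T₁ := 2) (T₂ := (s.wvar 24 - s.wvar 23) * 40 + 5)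
    (R := fun s' => s' = s.setW 20 0)
    (Wp.flat ⟨by simp only [WExp.val]; omega, rfl⟩ (by decide)) (fun s₁ hs₁ _ => ?_) (by omega)
  refine (Wp.loop_flat
    (fun s' => s'.wvar 23 = s.wvar 23 ∧ s'.wvar 24 = s.wvar 24 ∧ s'.rarr a = s.rarr a ∧
      s'.rarr b = s.rarr b ∧ s'.wvar 20 ≤ s.wvar 24 - s.wvar 23 ∧
      ∀ x, x < s'.wvar 20 → s'.pt c d x = (σ : ℝ) • s.pt a b (s.wvar 23 + x))
    (fun s' => s.wvar 24 - s.wvar 23 - s'.wvar 20) (s.wvar 24 - s.wvar 23) ?_ ?_ ?_).mono ?_ ?_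
  · subst hs₁
    simp
  · omega
  · rintro s' ⟨a1, a2, a3, a4, a5, a6⟩ hb
    simp only [Test.Holds, WExp.val, a1, a2] at hb
    simp only [Prog.Vc, Prog.inc, WExp.val, RExp.val]
    simp [a1, a2, a3, a4, hac, had, hbc, hbd]
    refine ⟨by omega, by omega, ⟨by omega, fun x hx => ?_⟩, by omega⟩
    by_cases hxe : x = s'.wvar 20
    · subst hxe
      simp [State.pt, hcd, hcd.symm]
    · have := a6 x (by omega)
      simpa [State.pt, hxe, hcd, hcd.symm] using this
  · simp [Prog.flatCost, Test.cost, WExp.cost, RExp.cost, Prog.inc]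
    omega
  · rintro s' ⟨⟨a1, a2, a3, a4, a5, a6⟩, hb⟩
    simp only [Test.Holds, WExp.val, a1, a2] at hb
    have : s'.wvar 20 = s.wvar 24 - s.wvar 23 := by omega
    exact ⟨this, this ▸ a6⟩

/-- The upper chain of the points `lo, …, hi - 1` of the arrays `a` and `b`, multiplied by `σ`. -/
def hullOf (a b : ℕ) (σ : ℤ) : Prog := collect a b 8 9 σ ;; sortProg ;; scanProg

theorem hullOf_wp {B k m : ℕ} {s : State} {a b : ℕ} {σ : ℤ} (ha8 : a ≠ 8) (ha9 : a ≠ 9)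
    (hb8 : b ≠ 8) (hb9 : b ≠ 9) (hB : 2 * s.wvar 24 + 2 ≤ B) (hlt : s.wvar 23 < s.wvar 24)
    (hm : s.wvar 24 - s.wvar 23 ≤ m) (hk : m ≤ 2 ^ k) :
    Wp B (hullOf a b σ) (700 * (m + 1) * (k + 1))
      (fun s' => s'.wvar 21 ≤ s.wvar 24 - s.wvar 23 ∧
        UpperChain ((fun i => (σ : ℝ) • s.pt a b i) '' Set.Ico (s.wvar 23) (s.wvar 24))
          (s'.wvar 21) (s'.pt 12 13)) s := by
  refine Wp.step (T₁ := 40 * m + 40) (T₂ := 300 * (m + 1) * (k + 1) + (300 * m + 30))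
    ((collect_wp ha8 ha9 hb8 hb9 (by decide) (by omega)).mono (by omega) fun _ h => h)
    (fun s₁ hs₁ hf₁ => ?_) (by nlinarith)
  obtain ⟨a1, a2⟩ := hs₁
  refine Wp.step ((sortProg_wp (k := k) (by omega) (by omega)).mono (Nat.mul_le_mul_right _
    (Nat.mul_le_mul_left _ (by omega))) fun _ h => h) (fun s₂ hs₂ hf₂ => ?_) le_rfl
  obtain ⟨b1, b2, b3⟩ := hs₂
  have e := hf₂.wvar 20 (by decide)
  refine ((scanProg_wp (by omega) (by omega) (by rw [e]; exact b1)).mono (by omega) ?_)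
  rintro s' ⟨c1, c2⟩
  refine ⟨by omega, ?_⟩
  -- Sorting is known to preserve only the set of points, not multiplicities; `UpperChain` sees no
  -- more than the set.
  convert c2 using 1
  ext p
  rw [e]
  constructor
  · rintro ⟨i, hi, rfl⟩
    obtain ⟨hi1, hi2⟩ := hi
    obtain ⟨x, hx, hxy⟩ := b3 (i - s.wvar 23) (by omega)
    refine ⟨x, hx, ?_⟩
    rw [hxy, a2 _ (by omega)]
    simp only
    congr 2
    omega
  · rintro ⟨x, hx, rfl⟩
    obtain ⟨y, hy, hxy⟩ := b2 x hx
    refine ⟨s.wvar 23 + y, ⟨by omega, by omega⟩, ?_⟩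
    rw [hxy, a2 _ (by omega)]

/-- Append the sum of the current points of the two chains, multiplied by `σ`, to the arrays `16`
and `17`. -/
def emit (σ : ℤ) : Prog :=
  .putR 16 (.var 26) (.mul (.const σ) (.add (.get 14 (.var 33)) (.get 12 (.var 34)))) ;;
  .putR 17 (.var 26) (.mul (.const σ) (.add (.get 15 (.var 33)) (.get 13 (.var 34)))) ;;
  .inc 26

/-- Append the boundary of the Minkowski sum of the chains in the arrays `14`, `15` and `12`, `13`,
multiplied by `σ`, to the arrays `16` and `17`. -/
def minkowski (σ : ℤ) : Prog :=
  (.setW 33 (.const 0) ;; .setW 34 (.const 0)) ;;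
  .loop (.disj (.wlt (.add (.var 33) (.const 1)) (.var 25))
      (.wlt (.add (.var 34) (.const 1)) (.var 21)))
    (emit σ ;;
      .cond (.disj (.neg (.wlt (.add (.var 34) (.const 1)) (.var 21)))
        (.conj (.wlt (.add (.var 33) (.const 1)) (.var 25)) (.neg (.rlt (.const 0) (.cross
          (.sub (.get 14 (.add (.var 33) (.const 1))) (.get 14 (.var 33)))
          (.sub (.get 15 (.add (.var 33) (.const 1))) (.get 15 (.var 33)))
          (.sub (.get 12 (.add (.var 34) (.const 1))) (.get 12 (.var 34)))
          (.sub (.get 13 (.add (.var 34) (.const 1))) (.get 13 (.var 34))))))))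
        (.inc 33) (.inc 34)) ;;
  emit σ

/-- The invariant of the merge of the two chains. -/
structure MinkInv (a b : ℕ → ℝ × ℝ) (r r' : ℕ) (σ : ℝ) (T₀ T : ℕ → ℝ × ℝ) (N₀ N k l : ℕ) :
    Prop where
  k_lt : k < r
  l_lt : l < r'
  sum : N = N₀ + k + l
  old : ∀ x, x < N₀ → T x = T₀ x
  new : ∀ x, N₀ ≤ x → x < N → ∃ i j, i < r ∧ j < r' ∧ T x = σ • (a i + b j)
  dom : PairsDominated a b r r' {o | ∃ x, N₀ ≤ x ∧ x < N ∧ o = σ • T x} k l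

theorem emit_vc {B : ℕ} {s : State} {σ : ℤ} {Q : State → Prop} (hB : s.wvar 26 + 2 ≤ B)
    (hQ : ∀ s' : State, (∀ x, x ≠ 26 → s'.wvar x = s.wvar x) → s'.wvar 26 = s.wvar 26 + 1 →
      s'.pt 12 13 = s.pt 12 13 → s'.pt 14 15 = s.pt 14 15 →
      s'.pt 16 17 = Function.update (s.pt 16 17) (s.wvar 26)
        ((σ : ℝ) • (s.pt 14 15 (s.wvar 33) + s.pt 12 13 (s.wvar 34))) → Q s') :
    (emit σ).Vc B Q s := by
  simp only [emit, Prog.Vc, Prog.inc]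
  refine ⟨by simp only [WExp.val]; omega, by simp [WExp.val]; omega, by simp [WExp.val]; omega,
    hQ _ ?_ ?_ ?_ ?_ ?_⟩
  · intro x hx
    simp [hx]
  · simp [WExp.val]
  · ext1 i
    simp [State.pt]
  · ext1 i
    simp [State.pt]
  · have e : ∀ t : State, t.pt 16 17 = fun i => (t.rarr 16 i, t.rarr 17 i) := fun t => rfl
    rw [e, e, ← update_pt']
    simp [WExp.val, RExp.val, State.pt]

namespace MinkInv

variable {a b : ℕ → ℝ × ℝ} {r r' N₀ N k l : ℕ} {σ : ℝ} {T₀ T : ℕ → ℝ × ℝ}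

/-- The chains consist of points already multiplied by `σ`, while the stored sums are multiplied by
`σ` once more. Since `σ * σ = 1`, a further factor recovers the sum of chain points that dominates.
-/
theorem emitted (h : MinkInv a b r r' σ T₀ T N₀ N k l) (hσ : σ * σ = 1) :
    (∀ x, x < N₀ → Function.update T N (σ • (a k + b l)) x = T₀ x) ∧
    (∀ x, N₀ ≤ x → x < N + 1 → ∃ i j, i < r ∧ j < r' ∧
      Function.update T N (σ • (a k + b l)) x = σ • (a i + b j)) ∧
    {o | ∃ x, N₀ ≤ x ∧ x < N ∧ o = σ • T x} ⊆
      {o | ∃ x, N₀ ≤ x ∧ x < N + 1 ∧ o = σ • Function.update T N (σ • (a k + b l)) x} ∧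
    a k + b l ∈
      {o | ∃ x, N₀ ≤ x ∧ x < N + 1 ∧ o = σ • Function.update T N (σ • (a k + b l)) x} := by
  have hN := h.sum
  refine ⟨fun x hx => ?_, fun x hx hxN => ?_, ?_, ?_⟩
  · rw [Function.update_of_ne (by omega)]
    exact h.old x hx
  · by_cases hxe : x = N
    · exact ⟨k, l, h.k_lt, h.l_lt, by rw [hxe, Function.update_self]⟩
    · rw [Function.update_of_ne hxe]
      exact h.new x hx (by omega)
  · rintro o ⟨x, h1, h2, rfl⟩
    exact ⟨x, h1, by omega, by rw [Function.update_of_ne (by omega)]⟩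
  · exact ⟨N, by omega, by omega, by rw [Function.update_self, smul_smul, hσ, one_smul]⟩

end MinkInv

/-- Every round emits the current pair and advances one index, and the last pair is emitted after
the loop. Thus chains of `r` and `r'` points yield `r + r' - 1` points that dominate all `r * r'`
sums: a rectangle costs the sum of its sides, not its area. -/
theorem minkowski_wp {B : ℕ} {s : State} {σ : ℤ} {S S' : Set (ℝ × ℝ)} (hσ : (σ : ℝ) * σ = 1)
    (hA : UpperChain S (s.wvar 25) (s.pt 14 15)) (hC : UpperChain S' (s.wvar 21) (s.pt 12 13))
    (hB : s.wvar 26 + s.wvar 25 + s.wvar 21 + 2 ≤ B) :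
    Wp B (minkowski σ) (200 * (s.wvar 25 + s.wvar 21) + 100)
      (fun s' => s'.wvar 26 + 1 = s.wvar 26 + s.wvar 25 + s.wvar 21 ∧
        (∀ x, x < s.wvar 26 → s'.pt 16 17 x = s.pt 16 17 x) ∧
        (∀ x, s.wvar 26 ≤ x → x < s'.wvar 26 →
          ∃ p ∈ S, ∃ q ∈ S', s'.pt 16 17 x = (σ : ℝ) • (p + q)) ∧
        (∀ u, ∀ p ∈ S, ∀ q ∈ S', ∃ x, s.wvar 26 ≤ x ∧ x < s'.wvar 26 ∧
          dirVal u (p + q) ≤ dirVal u ((σ : ℝ) • s'.pt 16 17 x))) s := by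
  set a := s.pt 14 15 with ha
  set b := s.pt 12 13 with hb
  set r := s.wvar 25 with hr
  set r' := s.wvar 21 with hr'
  set N₀ := s.wvar 26 with hN₀
  refine Wp.step (T₁ := 10) (T₂ := ((r + r') * (140 + 11) + 11) + 40)
    (R := fun s' => s'.wvar 21 = r' ∧ s'.wvar 25 = r ∧ s'.wvar 26 = N₀ ∧ s'.wvar 33 = 0 ∧
      s'.wvar 34 = 0 ∧ s'.rarr = s.rarr) ?_ (fun s₁ hs₁ _ => ?_) (by omega)
  · refine Wp.flat ?_ (by decide)
    simp [Prog.Vc, WExp.val]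
    omega
  obtain ⟨a1, a2, a3, a4, a5, a6⟩ := hs₁
  have hcost : (emit σ ;;
      .cond (.disj (.neg (.wlt (.add (.var 34) (.const 1)) (.var 21)))
        (.conj (.wlt (.add (.var 33) (.const 1)) (.var 25)) (.neg (.rlt (.const 0) (.cross
          (.sub (.get 14 (.add (.var 33) (.const 1))) (.get 14 (.var 33)))
          (.sub (.get 15 (.add (.var 33) (.const 1))) (.get 15 (.var 33)))
          (.sub (.get 12 (.add (.var 34) (.const 1))) (.get 12 (.var 34)))
          (.sub (.get 13 (.add (.var 34) (.const 1))) (.get 13 (.var 34))))))))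
        (.inc 33) (.inc 34) : Prog).flatCost ≤ 140 := by
    simp [Prog.flatCost, emit, Prog.inc, WExp.cost, RExp.cost, RExp.cross, Test.cost]
  have ptpt : ∀ x y, s₁.pt x y = s.pt x y := fun x y => by
    ext1 i
    simp [State.pt, a6]
  refine Wp.step (T₂ := 40) (R := fun s' => (s'.wvar 21 = r' ∧ s'.wvar 25 = r ∧ s'.pt 14 15 = a ∧
      s'.pt 12 13 = b ∧ MinkInv a b r r' σ (s.pt 16 17) (s'.pt 16 17) N₀ (s'.wvar 26)
      (s'.wvar 33) (s'.wvar 34)) ∧ ¬ (s'.wvar 33 + 1 < s'.wvar 25 ∨ s'.wvar 34 + 1 < s'.wvar 21))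
    (Wp.loop_const _ (fun s' => r + r' - s'.wvar 33 - s'.wvar 34) 140 (r + r') ?_ ?_ ?_)
    ?_ le_rfl
  · refine ⟨a1, a2, ptpt _ _, ptpt _ _, ?_⟩
    rw [a3, a4, a5, ptpt]
    refine ⟨hA.pos, hC.pos, rfl, fun _ _ => rfl, fun x h1 h2 => by omega, ?_⟩
    exact fun u k' l' hk hl => .inr ⟨k', l', Nat.zero_le _, hk, Nat.zero_le _, hl, le_rfl⟩
  · omega
  · rintro s₂ ⟨b1, b2, b3, b4, b5⟩ hg
    refine Wp.flat ?_ hcost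
    simp only [Test.Holds, WExp.val, b1, b2] at hg
    have := b5.sum
    have := b5.k_lt
    have := b5.l_lt
    rw [Prog.Vc]
    refine emit_vc (by omega) fun s₃ w w26 e12 e14 e16 => ?_
    obtain ⟨c1, c2, c3, c4⟩ := b5.emitted hσ
    rw [b3, b4] at e16
    rw [← e16] at c1 c2 c3 c4
    have x1 : ∀ i, s₃.rarr 14 i = (a i).1 := fun i => by rw [← b3, ← e14]; rfl
    have x2 : ∀ i, s₃.rarr 15 i = (a i).2 := fun i => by rw [← b3, ← e14]; rfl
    have x3 : ∀ i, s₃.rarr 12 i = (b i).1 := fun i => by rw [← b4, ← e12]; rfl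
    have x4 : ∀ i, s₃.rarr 13 i = (b i).2 := fun i => by rw [← b4, ← e12]; rfl
    have w21 := w 21 (by decide)
    have w25 := w 25 (by decide)
    have w33 := w 33 (by decide)
    have w34 := w 34 (by decide)
    rw [b1] at w21
    rw [b2] at w25
    simp only [Prog.Vc, Prog.inc, Test.Holds, WExp.val, RExp.val, RExp.cross, x1, x2, x3, x4,
      w21, w25, w33, w34]
    refine ⟨fun hc => ?_, fun hc => ?_⟩
    · have hk : s₂.wvar 33 + 1 < r := by
        rcases hc with hc | hc
        · exact hg.resolve_right hc
        · exact hc.1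
      refine ⟨by omega, ⟨?_, ?_, ?_, ?_, ?_⟩, ?_⟩
      · simp [w21]
      · simp [w25]
      · rw [State.setW_pt, e14, b3]
      · rw [State.setW_pt, e12, b4]
      · simp only [State.setW_pt, State.setW_wvar, Function.update_self, ne_eq, Nat.reduceEqDiff,
          not_false_eq_true, Function.update_of_ne, w34, w26]
        refine ⟨hk, b5.l_lt, by omega, c1, c2, ?_⟩
        refine b5.dom.advanceLeft hA hC hk (fun hl => ?_) c3 c4
        have := (hc.resolve_left (not_not.2 hl)).2
        simpa [cross] using this
      · simp [w34]
        omega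
    · have hl : s₂.wvar 34 + 1 < r' := by
        by_contra hl
        exact hc (.inl hl)
      refine ⟨by omega, ⟨?_, ?_, ?_, ?_, ?_⟩, ?_⟩
      · simp [w21]
      · simp [w25]
      · rw [State.setW_pt, e14, b3]
      · rw [State.setW_pt, e12, b4]
      · simp only [State.setW_pt, State.setW_wvar, Function.update_self, ne_eq, Nat.reduceEqDiff,
          not_false_eq_true, Function.update_of_ne, w33, w26]
        refine ⟨b5.k_lt, hl, by omega, c1, c2, ?_⟩
        refine b5.dom.advanceRight hA hC hl (fun hk => ?_) c3 c4
        by_contra hneg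
        exact hc (.inr ⟨hk, by simpa [cross] using hneg⟩)
      · simp [w33]
        omega
  · rintro s₂ ⟨⟨b1, b2, b3, b4, b5⟩, hg⟩ -
    rw [b1, b2] at hg
    have h1 := b5.sum
    have h2 := b5.k_lt
    have h3 := b5.l_lt
    refine Wp.flat (emit_vc (by omega) fun s₃ w w26 e12 e14 e16 => ?_) ?_
    · obtain ⟨c1, c2, c3, c4⟩ := b5.emitted hσ
      rw [b3, b4] at e16
      rw [← e16] at c1 c2 c3 c4
      refine ⟨by omega, c1, fun x hx hxN => ?_, fun u p hp q hq => ?_⟩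
      · obtain ⟨i, j, hi, hj, hij⟩ := c2 x hx (by omega)
        exact ⟨_, hA.mem i hi, _, hC.mem j hj, hij⟩
      · obtain ⟨i, hi, hpi⟩ := hA.dom u p hp
        obtain ⟨j, hj, hqj⟩ := hC.dom u q hq
        have : dirVal u (p + q) ≤ dirVal u (a i + b j) := by
          rw [dirVal_add, dirVal_add]
          linarith
        rcases b5.dom u i j hi hj with ⟨o, ho, hle⟩ | ⟨k₁, l₁, g1, g2, g3, g4, g5⟩
        · obtain ⟨x, y1, y2, rfl⟩ := c3 ho
          exact ⟨x, y1, by omega, this.trans hle⟩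
        · obtain ⟨x, y1, y2, y3⟩ := c4
          refine ⟨x, y1, by omega, ?_⟩
          rw [← y3]
          -- When the loop ends, both indices stand at the last points of their chains, so the only
          -- remaining pair is the one just emitted.
          have e1 : k₁ = s₂.wvar 33 := by omega
          have e2 : l₁ = s₂.wvar 34 := by omega
          rw [← e1, ← e2]
          exact this.trans g5
    · simp [Prog.flatCost, emit, Prog.inc, WExp.cost, RExp.cost]

end RealRAM

/-! ### The candidate points -/

namespace RealRAM

/-- Append the boundary of the Minkowski sum of the points `40, …, 41 - 1` (values of word
variables) of the arrays `4`, `5` and the points `42, …, 43 - 1` of the arrays `6`, `7`. -/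
def rectProg (σ : ℤ) : Prog :=
  .cond (.wlt (.var 40) (.var 41))
    ((.setW 23 (.var 40) ;; .setW 24 (.var 41)) ;; hullOf 4 5 σ ;;
      (.setW 23 (.const 0) ;; .setW 24 (.var 21)) ;; collect 12 13 14 15 1 ;;
      (.setW 25 (.var 20) ;; .setW 23 (.var 42) ;; .setW 24 (.var 43)) ;; hullOf 6 7 σ ;;
      minkowski σ)
    .skip

/-- What the program may change is independent of `σ`. After rewriting to the closed term `rectProg
0`, membership can be decided by evaluation. -/
theorem rectProg_wv (σ : ℤ) : (rectProg σ).wv = (rectProg 0).wv := rfl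
theorem rectProg_wa (σ : ℤ) : (rectProg σ).wa = (rectProg 0).wa := rfl
theorem rectProg_ra (σ : ℤ) : (rectProg σ).ra = (rectProg 0).ra := rfl
theorem hullOf_wv (a b : ℕ) (σ : ℤ) : (hullOf a b σ).wv = (hullOf 0 0 0).wv := rfl
theorem hullOf_ra (a b : ℕ) (σ : ℤ) : (hullOf a b σ).ra = (hullOf 0 0 0).ra := rfl

theorem UpperChain.congr_fun {S : Set (ℝ × ℝ)} {k : ℕ} {v w : ℕ → ℝ × ℝ}
    (h : UpperChain S k v) (hw : ∀ i, i < k → w i = v i) : UpperChain S k w where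
  pos := h.pos
  mem i hi := by rw [hw i hi]; exact h.mem i hi
  lex i hi := by rw [hw _ hi, hw i (by omega)]; exact h.lex i hi
  turn i hi := by rw [hw _ hi, hw i (by omega), hw _ (by omega)]; exact h.turn i hi
  dom u p hp := by
    obtain ⟨i, hi, hle⟩ := h.dom u p hp
    exact ⟨i, hi, by rwa [hw i hi]⟩
  first p hp := by rw [hw 0 h.pos]; exact h.first p hp
  last p hp := by rw [hw _ (by have := h.pos; omega)]; exact h.last p hp

/-- Each side is reduced to a chain before the merge, so the cost is that of sorting `m` and `m'`
points. The stored points are unreflected sums of the input because `σ * σ = 1`. An empty range of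
columns generates nothing. -/
theorem rectProg_wp {B k M m m' : ℕ} {s : State} {σ : ℤ} (hσ : (σ : ℝ) * σ = 1)
    (hB : s.wvar 26 + 4 * M + 4 ≤ B) (h41 : s.wvar 41 ≤ M) (h43 : s.wvar 43 ≤ M) (hM : M ≤ 2 ^ k)
    (hj : s.wvar 42 < s.wvar 43) (hm : s.wvar 41 - s.wvar 40 = m)
    (hm' : s.wvar 43 - s.wvar 42 = m') :
    Wp B (rectProg σ) (1000 * (m + m' + 3) * (k + 1))
      (fun s' => s.wvar 26 ≤ s'.wvar 26 ∧ s'.wvar 26 ≤ s.wvar 26 + m + m' ∧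
        (∀ x, x < s.wvar 26 → s'.pt 16 17 x = s.pt 16 17 x) ∧
        (∀ x, s.wvar 26 ≤ x → x < s'.wvar 26 → ∃ i j, s.wvar 40 ≤ i ∧ i < s.wvar 41 ∧
          s.wvar 42 ≤ j ∧ j < s.wvar 43 ∧ s'.pt 16 17 x = s.pt 4 5 i + s.pt 6 7 j) ∧
        (∀ u i j, s.wvar 40 ≤ i → i < s.wvar 41 → s.wvar 42 ≤ j → j < s.wvar 43 →
          ∃ x, x < s'.wvar 26 ∧ dirVal u ((σ : ℝ) • (s.pt 4 5 i + s.pt 6 7 j)) ≤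
            dirVal u ((σ : ℝ) • s'.pt 16 17 x))) s := by
  have hk1 : (m + m' + 3) ≤ (m + m' + 3) * (k + 1) := Nat.le_mul_of_pos_right _ (by omega)
  have hk2 : (m + 1) ≤ (m + 1) * (k + 1) := Nat.le_mul_of_pos_right _ (by omega)
  have hk3 : (m + m' + 3) * (k + 1) = (m + 1) * (k + 1) + (m' + 1) * (k + 1) + (k + 1) := by ring
  refine (Wp.cond (T := 700 * (m + 1) * (k + 1) + 40 * m + 40 + 700 * (m' + 1) * (k + 1) +
    200 * (m + m') + 120) (fun hb => ?_) fun hb => ?_).mono ?_ (fun _ h => h)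
  · simp only [Test.Holds, WExp.val] at hb
    refine Wp.step (T₁ := 4) (R := fun s' => s'.wvar 23 = s.wvar 40 ∧ s'.wvar 24 = s.wvar 41 ∧
      s'.rarr = s.rarr)
      (T₂ := 700 * (m + 1) * (k + 1) + (4 + ((40 * m + 40) + (6 + (700 * (m' + 1) * (k + 1) +
        (200 * (m + m') + 100)))))) ?_ (fun s₁ h₁ f₁ => ?_) (by omega)
    · refine Wp.flat ?_ (by decide)
      simp [Prog.Vc, WExp.val]
      omega
    obtain ⟨a1, a2, a3⟩ := h₁
    refine Wp.step (hullOf_wp (m := m) (k := k) (by decide) (by decide) (by decide) (by decide)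
      (by omega) (by omega) (by omega) (by omega)) (fun s₂ h₂ f₂ => ?_) le_rfl
    obtain ⟨b1, b2⟩ := h₂
    refine Wp.step (R := fun s' => s'.wvar 23 = 0 ∧ s'.wvar 24 = s₂.wvar 21 ∧
      s'.rarr = s₂.rarr) ?_ (fun s₃ h₃ f₃ => ?_) le_rfl
    · refine Wp.flat ?_ (by decide)
      simp [Prog.Vc, WExp.val]
      omega
    obtain ⟨c1, c2, c3⟩ := h₃
    refine Wp.step ((collect_wp (by decide) (by decide) (by decide) (by decide) (by decide)
      (by omega)).mono (T' := 40 * m + 40) (by omega) fun _ h => h)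
      (fun s₄ h₄ f₄ => ?_) le_rfl
    obtain ⟨d1, d2⟩ := h₄
    refine Wp.step (R := fun s' => s'.wvar 25 = s₄.wvar 20 ∧ s'.wvar 23 = s₄.wvar 42 ∧
      s'.wvar 24 = s₄.wvar 43 ∧ s'.rarr = s₄.rarr) ?_ (fun s₅ h₅ f₅ => ?_) le_rfl
    · have e43 : s₄.wvar 43 = s.wvar 43 := by
        rw [f₄.wvar 43 (by decide), f₃.wvar 43 (by decide),
          f₂.wvar 43 (by rw [hullOf_wv]; decide), f₁.wvar 43 (by decide)]
      have e42 : s₄.wvar 42 = s.wvar 42 := by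
        rw [f₄.wvar 42 (by decide), f₃.wvar 42 (by decide),
          f₂.wvar 42 (by rw [hullOf_wv]; decide), f₁.wvar 42 (by decide)]
      refine Wp.flat ?_ (by decide)
      simp [Prog.Vc, WExp.val]
      omega
    obtain ⟨e1, e2, e3, e4⟩ := h₅
    have x43 : s₄.wvar 43 = s.wvar 43 := by
      rw [f₄.wvar 43 (by decide), f₃.wvar 43 (by decide),
        f₂.wvar 43 (by rw [hullOf_wv]; decide), f₁.wvar 43 (by decide)]
    have x42 : s₄.wvar 42 = s.wvar 42 := by
      rw [f₄.wvar 42 (by decide), f₃.wvar 42 (by decide),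
        f₂.wvar 42 (by rw [hullOf_wv]; decide), f₁.wvar 42 (by decide)]
    have x26 : s₅.wvar 26 = s.wvar 26 := by
      rw [f₅.wvar 26 (by decide), f₄.wvar 26 (by decide), f₃.wvar 26 (by decide),
        f₂.wvar 26 (by rw [hullOf_wv]; decide), f₁.wvar 26 (by decide)]
    have r5 : ∀ a, a ∉ (hullOf 0 0 0).ra → a ≠ 14 → a ≠ 15 → s₅.rarr a = s.rarr a := by
      intro a ha h14 h15
      have : a ∉ (collect 12 13 14 15 1).ra := by simp [collect, Prog.ra, h14, h15, Prog.inc]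
      rw [e4, f₄.rarr a this, c3, f₂.rarr a (by rw [hullOf_ra]; exact ha), a3]
    have chainA : UpperChain ((fun i => (σ : ℝ) • s.pt 4 5 i) ''
        Set.Ico (s.wvar 40) (s.wvar 41)) (s₅.wvar 25) (s₅.pt 14 15) := by
      have : s₁.pt 4 5 = s.pt 4 5 := by
        ext1 i
        simp [State.pt, a3]
      rw [a1, a2, this] at b2
      rw [e1, d1, c1, c2, Nat.sub_zero]
      refine UpperChain.congr_fun b2 fun i hi => ?_
      have := d2 i (by omega)
      rw [c1, zero_add, Int.cast_one, one_smul] at this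
      simp only [State.pt, e4]
      simp only [State.pt, c3] at this
      exact this
    refine Wp.step (hullOf_wp (m := m') (k := k) (by decide) (by decide) (by decide) (by decide)
      (by omega) (by omega) (by omega) (by omega)) (fun s₆ h₆ f₆ => ?_) le_rfl
    obtain ⟨g1, g2⟩ := h₆
    have y25 : s₆.wvar 25 = s₅.wvar 25 := f₆.wvar 25 (by rw [hullOf_wv]; decide)
    have y26 : s₆.wvar 26 = s.wvar 26 := by
      rw [f₆.wvar 26 (by rw [hullOf_wv]; decide), x26]
    have z : ∀ a, a ∉ (hullOf 0 0 0).ra → s₆.rarr a = s₅.rarr a := fun a ha =>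
      f₆.rarr a (by rw [hullOf_ra]; exact ha)
    have p14 : s₆.pt 14 15 = s₅.pt 14 15 := by
      ext1 i
      simp only [State.pt]
      rw [z 14 (by decide), z 15 (by decide)]
    have p67 : s₅.pt 6 7 = s.pt 6 7 := by
      ext1 i
      simp only [State.pt]
      rw [r5 6 (by decide) (by decide) (by decide), r5 7 (by decide) (by decide) (by decide)]
    have p16 : s₆.pt 16 17 = s.pt 16 17 := by
      ext1 i
      simp only [State.pt]
      rw [z 16 (by decide), z 17 (by decide), r5 16 (by decide) (by decide) (by decide),
        r5 17 (by decide) (by decide) (by decide)]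
    rw [p67, e2, e3, x42, x43] at g2
    rw [e2, e3, x42, x43] at g1
    rw [← p14, ← y25] at chainA
    have hr : s₆.wvar 25 ≤ m := by
      rw [y25, e1, d1, c1, c2, Nat.sub_zero]
      omega
    refine (minkowski_wp (s := s₆) hσ chainA g2 (by omega)).mono (by omega) ?_
    rintro s₇ ⟨i1, i2, i3, i4⟩
    have q1 := chainA.pos
    have q2 := g2.pos
    rw [y26] at i1 i2 i3 i4
    rw [p16] at i2
    refine ⟨by omega, by omega, i2, fun x hx hx' => ?_, fun u i j h1 h2 h3 h4 => ?_⟩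
    · obtain ⟨_, ⟨i, hi, rfl⟩, _, ⟨j, hj, rfl⟩, hij⟩ := i3 x hx hx'
      refine ⟨i, j, hi.1, hi.2, hj.1, hj.2, ?_⟩
      rw [hij]
      simp only
      rw [← smul_add, smul_smul, hσ, one_smul]
    · obtain ⟨x, hx, hx', hle⟩ := i4 u _ ⟨i, ⟨h1, h2⟩, rfl⟩ _ ⟨j, ⟨h3, h4⟩, rfl⟩
      refine ⟨x, hx', ?_⟩
      rw [smul_add]
      exact hle
  · simp only [Test.Holds, WExp.val] at hb
    refine Wp.flat ?_ (show Prog.flatCost .skip ≤ _ by simp only [Prog.flatCost]; omega)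
    refine ⟨le_rfl, by omega, fun _ _ => rfl, fun x h1 h2 => by omega, fun u i j h1 h2 => by omega⟩
  · simp only [Test.cost, WExp.cost]
    have h1 : 1000 * (m + m' + 3) * (k + 1) = 1000 * ((m + 1) * (k + 1)) +
      1000 * ((m' + 1) * (k + 1)) + 1000 * (k + 1) := by ring
    have h2 : 700 * (m + 1) * (k + 1) = 700 * ((m + 1) * (k + 1)) := by ring
    have h3 : 700 * (m' + 1) * (k + 1) = 700 * ((m' + 1) * (k + 1)) := by ring
    have h4 : (m' + 1) ≤ (m' + 1) * (k + 1) := Nat.le_mul_of_pos_right _ (by omega)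
    omega

end RealRAM

/-! ### The decomposition into rectangles -/

/-- The pair `(i, j)` lies in the region between the two staircases. -/
def Feas (F G : ℕ → ℕ) (i j : ℕ) : Prop := F j ≤ i ∧ i < G j

/-- Column `i` contains the whole block of `d` rows from `b` on. -/
def FullBlock (F G : ℕ → ℕ) (b d i : ℕ) : Prop := F (b + d - 1) ≤ i ∧ i < G b

/-- The first `N` points of `T` dominate `q` in all directions on the side given by `σ`. -/
def Covered (σ : ℝ) (T : ℕ → ℝ × ℝ) (N : ℕ) (q : ℝ × ℝ) : Prop :=
  ∀ u, ∃ x, x < N ∧ dirVal u (σ • q) ≤ dirVal u (σ • T x)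

theorem Covered.mono {σ : ℝ} {T T' : ℕ → ℝ × ℝ} {N N' : ℕ} {q : ℝ × ℝ} (h : Covered σ T N q)
    (hN : N ≤ N') (hT : ∀ x, x < N → T' x = T x) : Covered σ T' N' q := fun u => by
  obtain ⟨x, hx, hle⟩ := h u
  exact ⟨x, by omega, by rwa [hT x hx]⟩

/-- Two staircases of height `M` on the rows `0, …, S - 1`. -/
structure Staircase (F G : ℕ → ℕ) (S M : ℕ) : Prop where
  F_mono : ∀ x y, x ≤ y → y ≤ S → F x ≤ F y
  G_mono : ∀ x y, x ≤ y → y ≤ S → G x ≤ G y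
  F_le : ∀ x, x ≤ S → F x ≤ M
  G_le : ∀ x, x ≤ S → G x ≤ M
  F_last : M ≤ F (S - 1)

/-- The points from `N₀` on were generated by feasible pairs, and the earlier ones are unchanged. -/
structure Generated (A C : ℕ → ℝ × ℝ) (F G : ℕ → ℕ) (T₀ T : ℕ → ℝ × ℝ) (N₀ N : ℕ) : Prop where
  le : N₀ ≤ N
  old : ∀ x, x < N₀ → T x = T₀ x
  new : ∀ x, N₀ ≤ x → x < N → ∃ i j, Feas F G i j ∧ T x = A i + C j

theorem Generated.refl {A C : ℕ → ℝ × ℝ} {F G : ℕ → ℕ} {T : ℕ → ℝ × ℝ} {N : ℕ} :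
    Generated A C F G T T N N := ⟨le_rfl, fun _ _ => rfl, fun x h1 h2 => by omega⟩

theorem Generated.trans {A C : ℕ → ℝ × ℝ} {F G : ℕ → ℕ} {T₀ T₁ T₂ : ℕ → ℝ × ℝ} {N₀ N₁ N₂ : ℕ}
    (h : Generated A C F G T₀ T₁ N₀ N₁) (h' : Generated A C F G T₁ T₂ N₁ N₂) :
    Generated A C F G T₀ T₂ N₀ N₂ where
  le := h.le.trans h'.le
  old x hx := by rw [h'.old x (hx.trans_le h.le), h.old x hx]
  new x hx hx' := by
    by_cases hx1 : x < N₁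
    · obtain ⟨i, j, hf, he⟩ := h.new x hx hx1
      exact ⟨i, j, hf, by rw [h'.old x hx1, he]⟩
    · exact h'.new x (by omega) hx'

/-! ### The program for the rectangles -/

namespace RealRAM

/-- The rectangles of the pair of blocks of length `28` (value of a word variable) from row `29`
on. -/
def pairProg (σ : ℤ) : Prog :=
  (.setW 40 (.get 7 (.sub (.add (.var 29) (.var 28)) (.const 1))) ;;
    .setW 41 (.min (.get 9 (.var 29))
      (.get 7 (.sub (.add (.var 29) (.mul (.const 2) (.var 28))) (.const 1)))) ;;
    .setW 42 (.var 29) ;; .setW 43 (.add (.var 29) (.var 28))) ;;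
  rectProg σ ;;
  (.setW 40 (.max (.get 7 (.sub (.add (.var 29) (.mul (.const 2) (.var 28))) (.const 1)))
      (.get 9 (.var 29))) ;;
    .setW 41 (.get 9 (.add (.var 29) (.var 28))) ;;
    .setW 42 (.add (.var 29) (.var 28)) ;;
    .setW 43 (.add (.var 29) (.mul (.const 2) (.var 28)))) ;;
  rectProg σ ;;
  .setW 29 (.add (.var 29) (.mul (.const 2) (.var 28)))

/-- All rectangles. -/
def candidates (σ : ℤ) : Prog :=
  .setW 28 (.const 1) ;;
  .loop (.wlt (.var 28) (.var 27))
    (.setW 29 (.const 0) ;; .loop (.wlt (.var 29) (.var 27)) (pairProg σ) ;;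
      .setW 28 (.mul (.const 2) (.var 28)))

theorem pairProg_wv (σ : ℤ) : (pairProg σ).wv = (pairProg 0).wv := rfl
theorem pairProg_wa (σ : ℤ) : (pairProg σ).wa = (pairProg 0).wa := rfl
theorem pairProg_ra (σ : ℤ) : (pairProg σ).ra = (pairProg 0).ra := rfl

/-- A column that is full for the first half of the rows but not for both halves satisfies `F (p + d
- 1) ≤ i < min (G p) (F (p + 2 * d - 1))`; for the second half the range is `max (F (p + 2 * d - 1))
(G p) ≤ i < G (p + d)`. So each half contributes a single rectangle of feasible pairs. By
monotonicity the first width is at most the growth `m` of `F` over the double block, and the second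
at most the growth `m'` of `G`; over a level these bounds telescope. -/
theorem pairProg_wp {B k S M d p N : ℕ} {s : State} {σ : ℤ} {F G : ℕ → ℕ} {A C : ℕ → ℝ × ℝ}
    (hσ : (σ : ℝ) * σ = 1) (hF : s.warr 7 = F) (hG : s.warr 9 = G) (hA : s.pt 4 5 = A)
    (hC : s.pt 6 7 = C) (hN : s.wvar 26 = N)
    (hFG : Staircase F G S M) (hS : S = 2 ^ k) (hM : M ≤ S) (hs : s.wvar 28 = d)
    (hp : s.wvar 29 = p) (hd : 0 < d) (hpS : p + 2 * d ≤ S)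
    (hB : N + 6 * S + 4 ≤ B) {m m' : ℕ} (hm : F (p + 2 * d) = F p + m)
    (hm' : G (p + 2 * d) = G p + m') :
    Wp B (pairProg σ) (1000 * (m + m' + 2 * d + 7) * (k + 1))
      (fun s' => s'.wvar 29 = p + 2 * d ∧ s'.wvar 26 ≤ N + m + m' + 2 * d ∧
        Generated A C F G (s.pt 16 17) (s'.pt 16 17) N (s'.wvar 26) ∧
        (∀ j i, p ≤ j → j < p + d → FullBlock F G p d i → ¬ FullBlock F G p (2 * d) i →
          Covered σ (s'.pt 16 17) (s'.wvar 26) (A i + C j)) ∧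
        (∀ j i, p + d ≤ j → j < p + d + d → FullBlock F G (p + d) d i →
          ¬ FullBlock F G p (2 * d) i →
          Covered σ (s'.pt 16 17) (s'.wvar 26) (A i + C j))) s := by
  have f1 := hFG.F_mono p (p + d - 1) (by omega) (by omega)
  have f2 := hFG.F_mono (p + d - 1) (p + 2 * d - 1) (by omega) (by omega)
  have f3 := hFG.F_mono (p + 2 * d - 1) (p + 2 * d) (by omega) (by omega)
  have g1 := hFG.G_mono p (p + d) (by omega) (by omega)
  have g2 := hFG.G_mono (p + d) (p + 2 * d) (by omega) (by omega)
  have l1 := hFG.G_le p (by omega)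
  have l2 := hFG.G_le (p + d) (by omega)
  have l3 := hFG.F_le (p + 2 * d - 1) (by omega)
  set m₁ := min (G p) (F (p + 2 * d - 1)) - F (p + d - 1) with hm₁
  set m₂ := G (p + d) - max (F (p + 2 * d - 1)) (G p) with hm₂
  have hb1 : m₁ ≤ m := by omega
  have hb2 : m₂ ≤ m' := by omega
  refine Wp.step (T₁ := 100) (T₂ := 1000 * (m₁ + d + 3) * (k + 1) + (100 +
    (1000 * (m₂ + d + 3) * (k + 1) + 20))) (R := fun s' => s'.wvar 40 = F (p + d - 1) ∧
      s'.wvar 41 = min (G p) (F (p + 2 * d - 1)) ∧ s'.wvar 42 = p ∧ s'.wvar 43 = p + d ∧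
      s'.rarr = s.rarr) ?_ (fun s₁ h₁ f₁ => ?_) ?_
  · refine Wp.flat ?_ (by decide)
    simp [Prog.Vc, WExp.val, hF, hG, hs, hp]
    omega
  · obtain ⟨a1, a2, a3, a4, a5⟩ := h₁
    have pt1 : ∀ a b, s₁.pt a b = s.pt a b := fun a b => by
      ext1 i
      simp [State.pt, a5]
    have w26 : s₁.wvar 26 = N := by rw [f₁.wvar 26 (by decide), hN]
    refine Wp.step (rectProg_wp (k := k) (M := S) (m := m₁) (m' := d) hσ (by omega) (by omega)
      (by omega) hS.le (by omega) (by omega) (by omega)) (fun s₂ h₂ f₂ => ?_) le_rfl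
    obtain ⟨b1, b2, b3, b4, b5⟩ := h₂
    rw [a1, a2, a3, a4, pt1, pt1, hA, hC] at b4 b5
    rw [pt1] at b3
    rw [w26] at b1 b2 b3 b4
    have c7 : s₂.warr 7 = F := by
      rw [f₂.warr 7 (by rw [rectProg_wa]; decide), f₁.warr 7 (by decide), hF]
    have c9 : s₂.warr 9 = G := by
      rw [f₂.warr 9 (by rw [rectProg_wa]; decide), f₁.warr 9 (by decide), hG]
    have c28 : s₂.wvar 28 = d := by
      rw [f₂.wvar 28 (by rw [rectProg_wv]; decide), f₁.wvar 28 (by decide), hs]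
    have c29 : s₂.wvar 29 = p := by
      rw [f₂.wvar 29 (by rw [rectProg_wv]; decide), f₁.wvar 29 (by decide), hp]
    have c4 : s₂.pt 4 5 = A := by
      rw [← hA, ← pt1 4 5]
      ext1 i
      simp only [State.pt]
      rw [f₂.rarr 4 (by rw [rectProg_ra]; decide), f₂.rarr 5 (by rw [rectProg_ra]; decide)]
    have c6 : s₂.pt 6 7 = C := by
      rw [← hC, ← pt1 6 7]
      ext1 i
      simp only [State.pt]
      rw [f₂.rarr 6 (by rw [rectProg_ra]; decide), f₂.rarr 7 (by rw [rectProg_ra]; decide)]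
    refine Wp.step (R := fun s' => s'.wvar 40 = max (F (p + 2 * d - 1)) (G p) ∧
      s'.wvar 41 = G (p + d) ∧ s'.wvar 42 = p + d ∧ s'.wvar 43 = p + 2 * d ∧
      s'.rarr = s₂.rarr) ?_ (fun s₃ h₃ f₃ => ?_) le_rfl
    · refine Wp.flat ?_ (by decide)
      simp [Prog.Vc, WExp.val, c7, c9, c28, c29]
      omega
    obtain ⟨d1, d2, d3, d4, d5⟩ := h₃
    have pt3 : ∀ a b, s₃.pt a b = s₂.pt a b := fun a b => by
      ext1 i
      simp [State.pt, d5]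
    have w26' : s₃.wvar 26 = s₂.wvar 26 := f₃.wvar 26 (by decide)
    refine Wp.step (rectProg_wp (k := k) (M := S) (m := m₂) (m' := d) hσ (by omega) (by omega)
      (by omega) hS.le (by omega) (by omega) (by omega)) (fun s₄ h₄ f₄ => ?_) le_rfl
    obtain ⟨e1, e2, e3, e4, e5⟩ := h₄
    rw [d1, d2, d3, d4, pt3, pt3, c4, c6] at e4 e5
    rw [pt3] at e3
    rw [w26'] at e1 e2 e3 e4
    have c28' : s₄.wvar 28 = d := by
      rw [f₄.wvar 28 (by rw [rectProg_wv]; decide), f₃.wvar 28 (by decide), c28]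
    have c29' : s₄.wvar 29 = p := by
      rw [f₄.wvar 29 (by rw [rectProg_wv]; decide), f₃.wvar 29 (by decide), c29]
    refine Wp.flat ?_ (by decide)
    simp only [Prog.Vc, WExp.val, c28', c29', State.setW_pt, State.setW_wvar, Function.update_self,
      ne_eq, Nat.reduceEqDiff, not_false_eq_true, Function.update_of_ne]
    refine ⟨by omega, trivial, by omega, Generated.trans (N₁ := s₂.wvar 26) (T₁ := s₂.pt 16 17)
      ⟨b1, b3, fun x hx hx' => ?_⟩ ⟨e1, e3, fun x hx hx' => ?_⟩, fun j i hj hj' hf hnf => ?_,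
      fun j i hj hj' hf hnf => ?_⟩
    · obtain ⟨i, j, h1, h2, h3, h4, h5⟩ := b4 x hx hx'
      refine ⟨i, j, ⟨?_, ?_⟩, h5⟩
      · have := hFG.F_mono j (p + d - 1) (by omega) (by omega)
        omega
      · have := hFG.G_mono p j (by omega) (by omega)
        omega
    · obtain ⟨i, j, h1, h2, h3, h4, h5⟩ := e4 x hx hx'
      refine ⟨i, j, ⟨?_, ?_⟩, h5⟩
      · have := hFG.F_mono j (p + 2 * d - 1) (by omega) (by omega)
        omega
      · have := hFG.G_mono (p + d) j (by omega) (by omega)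
        omega
    · refine Covered.mono (N := s₂.wvar 26) (T := s₂.pt 16 17) (fun u => ?_) e1 e3
      simp only [FullBlock] at hf hnf
      exact b5 u i j hf.1 (by omega) hj hj'
    · intro u
      simp only [FullBlock] at hf hnf
      rw [show p + d + d = p + 2 * d by ring] at hf hj'
      exact e5 u i j (by omega) hf.2 hj hj'
  · have t1 : (m₁ + d + 3) * (k + 1) ≤ (m + d + 3) * (k + 1) := Nat.mul_le_mul_right _ (by omega)
    have t2 : (m₂ + d + 3) * (k + 1) ≤ (m' + d + 3) * (k + 1) := Nat.mul_le_mul_right _ (by omega)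
    have e : 1000 * (m + m' + 2 * d + 7) * (k + 1) = 1000 * ((m + d + 3) * (k + 1)) +
      1000 * ((m' + d + 3) * (k + 1)) + 1000 * (k + 1) := by ring
    rw [e, mul_assoc, mul_assoc]
    omega

/-- All pairs outside the full blocks of length `d` are covered. -/
def CoveredBelow (σ : ℝ) (A C : ℕ → ℝ × ℝ) (F G : ℕ → ℕ) (T : ℕ → ℝ × ℝ) (N d R : ℕ) : Prop :=
  ∀ b, d ∣ b → b + d ≤ R → ∀ j i, b ≤ j → j < b + d → Feas F G i j → ¬ FullBlock F G b d i →
    Covered σ T N (A i + C j)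

theorem CoveredBelow.mono {σ : ℝ} {A C : ℕ → ℝ × ℝ} {F G : ℕ → ℕ} {T T' : ℕ → ℝ × ℝ}
    {N N' d R : ℕ} (h : CoveredBelow σ A C F G T N d R) (hN : N ≤ N')
    (hT : ∀ x, x < N → T' x = T x) : CoveredBelow σ A C F G T' N' d R :=
  fun b h1 h2 j i h3 h4 h5 h6 => (h b h1 h2 j i h3 h4 h5 h6).mono hN hT

/-- The part of the memory that the search for candidates does not change. -/
structure CandFrame (s : State) (F G : ℕ → ℕ) (A C : ℕ → ℝ × ℝ) (S : ℕ) : Prop where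
  F_eq : s.warr 7 = F
  G_eq : s.warr 9 = G
  A_eq : s.pt 4 5 = A
  C_eq : s.pt 6 7 = C
  S_eq : s.wvar 27 = S

theorem CandFrame.frame {s s' : State} {c : Prog} {F G : ℕ → ℕ} {A C : ℕ → ℝ × ℝ} {S : ℕ}
    (h : CandFrame s F G A C S) (f : Frame c s s') (h7 : 7 ∉ c.wa) (h9 : 9 ∉ c.wa) (h4 : 4 ∉ c.ra)
    (h5 : 5 ∉ c.ra) (h6 : 6 ∉ c.ra) (h7' : 7 ∉ c.ra) (h27 : 27 ∉ c.wv) :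
    CandFrame s' F G A C S where
  F_eq := by rw [f.warr 7 h7, h.F_eq]
  G_eq := by rw [f.warr 9 h9, h.G_eq]
  A_eq := by
    rw [← h.A_eq]
    ext1 i
    simp only [State.pt]
    rw [f.rarr 4 h4, f.rarr 5 h5]
  C_eq := by
    rw [← h.C_eq]
    ext1 i
    simp only [State.pt]
    rw [f.rarr 6 h6, f.rarr 7 h7']
  S_eq := by rw [f.wvar 27 h27, h.S_eq]

/-- A pair whose column is full for its block but not for the double block lies in one of the new
rectangles. If the column was not even full for the block, the pair had been covered at an earlier
level. -/
theorem levelLoop_wp {B k r S M d N : ℕ} {s : State} {σ : ℤ} {F G : ℕ → ℕ} {A C : ℕ → ℝ × ℝ}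
    (hσ : (σ : ℝ) * σ = 1) (hc : CandFrame s F G A C S) (hFG : Staircase F G S M)
    (hS : S = 2 ^ k) (hM : M ≤ S) (hd : d = 2 ^ r) (hr : r < k) (hs : s.wvar 28 = d)
    (hp : s.wvar 29 = 0) (hN : s.wvar 26 = N) (hB : N + 9 * S + 4 ≤ B)
    (hcov : CoveredBelow σ A C F G (s.pt 16 17) N d S) :
    Wp B (.loop (.wlt (.var 29) (.var 27)) (pairProg σ)) (7000 * S * (k + 1) + 3)
      (fun s' => s'.wvar 26 ≤ N + 3 * S ∧
        Generated A C F G (s.pt 16 17) (s'.pt 16 17) N (s'.wvar 26) ∧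
        CoveredBelow σ A C F G (s'.pt 16 17) (s'.wvar 26) (2 * d) S ∧
        CandFrame s' F G A C S ∧ s'.wvar 28 = d) s := by
  have hd0 : 0 < d := by rw [hd]; positivity
  have hdS : 2 * d ∣ S := by
    rw [hS, hd, ← pow_succ']
    exact pow_dvd_pow _ hr
  refine (Wp.loop
    (fun s' => CandFrame s' F G A C S ∧ s'.wvar 28 = d ∧ 2 * d ∣ s'.wvar 29 ∧ s'.wvar 29 ≤ S ∧
      s'.wvar 26 + (M - F (s'.wvar 29)) + (M - G (s'.wvar 29)) + (S - s'.wvar 29) ≤ N + 3 * S ∧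
      Generated A C F G (s.pt 16 17) (s'.pt 16 17) N (s'.wvar 26) ∧
      CoveredBelow σ A C F G (s'.pt 16 17) (s'.wvar 26) (2 * d) (s'.wvar 29) ∧
      CoveredBelow σ A C F G (s'.pt 16 17) (s'.wvar 26) d S)
    -- The rectangles of a double block cost in proportion to the growth of `F`, the growth of `G`,
    -- and `2 * d + 7`. The factor `5` lets the rows pay for the last part and for the loop test, as
    -- `2 * d + 8 ≤ 5 * (2 * d)`.
    (fun s' => 1000 * ((M - F (s'.wvar 29)) + (M - G (s'.wvar 29)) + 5 * (S - s'.wvar 29)) *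
      (k + 1)) (7000 * S * (k + 1)) ?_ ?_ ?_).mono le_rfl ?_
  · rw [hp, hN]
    refine ⟨hc, hs, dvd_zero _, Nat.zero_le _, by omega, .refl, ?_, hcov⟩
    intro b _ hb
    omega
  · have : M - F (s.wvar 29) + (M - G (s.wvar 29)) + 5 * (S - s.wvar 29) ≤ 7 * S := by omega
    calc _ ≤ 1000 * (7 * S) * (k + 1) :=
          Nat.mul_le_mul_right _ (Nat.mul_le_mul_left _ this)
      _ = 7000 * S * (k + 1) := by ring
  · rintro s₁ ⟨a1, a2, a3, a4, a5, a6, a7, a8⟩ hb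
    simp only [Test.Holds, WExp.val, a1.S_eq] at hb
    obtain ⟨p, hp⟩ : ∃ p, p = s₁.wvar 29 := ⟨_, rfl⟩
    rw [← hp] at a3 a4 a5 a7 hb ⊢
    have hpS : p + 2 * d ≤ S := MergeInv.dvd_gap a3 hdS hb
    have F1 := hFG.F_mono p (p + 2 * d) (by omega) hpS
    have G1 := hFG.G_mono p (p + 2 * d) (by omega) hpS
    have F2 := hFG.F_le (p + 2 * d) hpS
    have G2 := hFG.G_le (p + 2 * d) hpS
    refine ⟨1000 * (F (p + 2 * d) - F p + (G (p + 2 * d) - G p) + 2 * d + 7) * (k + 1),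
      (pairProg_wp (s := s₁) (m := F (p + 2 * d) - F p) (m' := G (p + 2 * d) - G p) hσ a1.F_eq
        a1.G_eq a1.A_eq a1.C_eq rfl hFG hS hM a2 hp.symm hd0 hpS (by omega) (by omega)
        (by omega)).framed.imp ?_⟩
    rintro s' ⟨⟨b1, b2, b3, b4, b5⟩, f⟩
    refine ⟨⟨a1.frame f ?_ ?_ ?_ ?_ ?_ ?_ ?_, ?_, ?_, ?_, ?_, a6.trans b3, ?_,
      a8.mono b3.le b3.old⟩, ?_⟩
    · rw [pairProg_wa]; decide
    · rw [pairProg_wa]; decide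
    · rw [pairProg_ra]; decide
    · rw [pairProg_ra]; decide
    · rw [pairProg_ra]; decide
    · rw [pairProg_ra]; decide
    · rw [pairProg_wv]; decide
    · rw [f.wvar 28 (by rw [pairProg_wv]; decide), a2]
    · rw [b1]
      exact a3.add dvd_rfl
    · rw [b1]
      exact hpS
    · rw [b1]
      omega
    · rw [b1]
      intro b hb1 hb2 j i hj hj' hf hnf
      by_cases hbp : b + 2 * d ≤ p
      · exact (a7 b hb1 hbp j i hj hj' hf hnf).mono b3.le b3.old
      · obtain rfl : b = p := by
          rcases lt_trichotomy b p with hlt | hlt | hlt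
          · exact absurd (MergeInv.dvd_gap hb1 a3 hlt) hbp
          · exact hlt
          · omega
        have hdp : d ∣ b := (Dvd.intro_left 2 rfl).trans hb1
        by_cases hjd : j < b + d
        · by_cases hfull : FullBlock F G b d i
          · exact b4 j i hj hjd hfull hnf
          · exact (a8 b hdp (by omega) j i hj hjd hf hfull).mono b3.le b3.old
        · by_cases hfull : FullBlock F G (b + d) d i
          · exact b5 j i (by omega) (by omega) hfull hnf
          · exact (a8 (b + d) (hdp.add dvd_rfl) (by omega) j i (by omega) (by omega) hf
              hfull).mono b3.le b3.old
    · rw [b1]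
      have hcost : (Test.wlt (.var 29) (.var 27)).cost = 3 := rfl
      rw [hcost]
      have key : M - F (p + 2 * d) + (M - G (p + 2 * d)) + 5 * (S - (p + 2 * d)) +
          (F (p + 2 * d) - F p + (G (p + 2 * d) - G p) + 2 * d + 7) + 1 ≤
          M - F p + (M - G p) + 5 * (S - p) := by omega
      generalize M - F (p + 2 * d) + (M - G (p + 2 * d)) + 5 * (S - (p + 2 * d)) = X at key ⊢
      generalize F (p + 2 * d) - F p + (G (p + 2 * d) - G p) + 2 * d + 7 = Y at key ⊢
      generalize M - F p + (M - G p) + 5 * (S - p) = Z at key ⊢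
      nlinarith
  · rintro s' ⟨⟨a1, a2, a3, a4, a5, a6, a7, a8⟩, hb⟩
    simp only [Test.Holds, WExp.val, a1.S_eq] at hb
    have e : s'.wvar 29 = S := by omega
    rw [e] at a7
    exact ⟨by omega, a6, a7, a1, a2⟩

/-- There are `k` levels with at most `3 * S` new points each. In a block of one row every feasible
pair lies in a full column; in the block of all rows none does. So each pair leaves the full columns
at some level and is covered there. -/
theorem candidates_wp {B k S M N : ℕ} {s : State} {σ : ℤ} {F G : ℕ → ℕ} {A C : ℕ → ℝ × ℝ}
    (hσ : (σ : ℝ) * σ = 1) (hc : CandFrame s F G A C S) (hFG : Staircase F G S M)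
    (hS : S = 2 ^ k) (hM : M ≤ S) (hN : s.wvar 26 = N) (hB : N + 3 * k * S + 9 * S + 4 ≤ B) :
    Wp B (candidates σ) (k * (7000 * S * (k + 1) + 20) + 10)
      (fun s' => s'.wvar 26 ≤ N + 3 * k * S ∧
        Generated A C F G (s.pt 16 17) (s'.pt 16 17) N (s'.wvar 26) ∧
        (∀ i j, j < S → Feas F G i j → Covered σ (s'.pt 16 17) (s'.wvar 26) (A i + C j)) ∧
        CandFrame s' F G A C S) s := by
  have hS0 : 0 < S := by rw [hS]; positivity
  refine Wp.step (T₁ := 2) (T₂ := k * ((7000 * S * (k + 1) + 15) + 3) + 3)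
    (R := fun s' => s' = s.setW 28 1)
    (Wp.flat ⟨by simp only [WExp.val]; omega, rfl⟩ (by decide)) (fun s₁ hs₁ f₁ => ?_) ?_
  · refine (Wp.loop_const
      (fun s' => CandFrame s' F G A C S ∧ (∃ r, r ≤ k ∧ s'.wvar 28 = 2 ^ r ∧
        s'.wvar 26 ≤ N + 3 * r * S) ∧
        Generated A C F G (s.pt 16 17) (s'.pt 16 17) N (s'.wvar 26) ∧
        CoveredBelow σ A C F G (s'.pt 16 17) (s'.wvar 26) (s'.wvar 28) S)
      (fun s' => k - Nat.log 2 (s'.wvar 28)) (7000 * S * (k + 1) + 15) k ?_ ?_ ?_).imp ?_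
    · refine ⟨hc.frame f₁ (by decide) (by decide) (by decide) (by decide) (by decide) (by decide)
        (by decide), ⟨0, Nat.zero_le _, ?_, ?_⟩, ?_, ?_⟩
      · simp [hs₁]
      · simp [hs₁, hN]
      · have : s₁.wvar 26 = N := by simp [hs₁, hN]
        rw [this]
        have : s₁.pt 16 17 = s.pt 16 17 := by simp [hs₁]
        rw [this]
        exact .refl
      · have : s₁.wvar 28 = 1 := by simp [hs₁]
        rw [this]
        intro b _ hb j i hj hj' hf hnf
        obtain rfl : b = j := by omega
        exact absurd hf hnf
    · omega
    · rintro s₂ ⟨a1, ⟨r, hr, a2, a3⟩, a4, a5⟩ hb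
      simp only [Test.Holds, WExp.val, a1.S_eq, a2] at hb
      have hrk : r < k := by
        by_contra hcon
        have : (2 : ℕ) ^ k ≤ 2 ^ r := Nat.pow_le_pow_right (by norm_num) (by omega)
        omega
      have hrS : 3 * (r + 1) * S ≤ 3 * k * S :=
        Nat.mul_le_mul_right _ (Nat.mul_le_mul_left _ (by omega))
      have hrS' : 3 * (r + 1) * S = 3 * r * S + 3 * S := by ring
      refine Wp.step (T₁ := 2) (T₂ := (7000 * S * (k + 1) + 3) + 10)
        (R := fun s' => s' = s₂.setW 29 0)
        (Wp.flat ⟨by simp only [WExp.val]; omega, rfl⟩ (by decide)) (fun s₃ hs₃ f₃ => ?_) (by omega)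
      have w28 : s₃.wvar 28 = 2 ^ r := by rw [f₃.wvar 28 (by decide), a2]
      have w26 : s₃.wvar 26 = s₂.wvar 26 := by rw [f₃.wvar 26 (by decide)]
      have p16 : s₃.pt 16 17 = s₂.pt 16 17 := by simp [hs₃]
      refine Wp.step (levelLoop_wp hσ (a1.frame f₃ (by decide) (by decide) (by decide) (by decide)
        (by decide) (by decide) (by decide)) hFG hS hM rfl hrk w28 (by simp [hs₃]) w26 (by omega)
        (by rw [p16, ← a2]; exact a5)) (fun s₄ h₄ f₄ => ?_) le_rfl
      obtain ⟨b1, b2, b3, b4, b5⟩ := h₄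
      rw [p16] at b2
      have h2 : 2 * 2 ^ r ≤ S := by
        rw [hS, ← pow_succ']
        exact Nat.pow_le_pow_right (by norm_num) hrk
      refine Wp.flat ?_ (by decide)
      simp only [Prog.Vc, WExp.val, b5]
      refine ⟨by omega, ⟨⟨b4.F_eq, b4.G_eq, b4.A_eq, b4.C_eq, ?_⟩, ⟨r + 1, hrk, ?_, ?_⟩, ?_, ?_⟩, ?_⟩
      · simp [b4.S_eq]
      · simp [pow_succ, mul_comm]
      · simp
        omega
      · simpa using a4.trans b2
      · simpa using b3
      · simp only [State.setW_wvar, Function.update_self, a2]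
        rw [show 2 * 2 ^ r = 2 ^ (r + 1) by ring, Nat.log_pow (by norm_num),
          Nat.log_pow (by norm_num)]
        omega
    · rintro s' ⟨⟨a1, ⟨r, hr, a2, a3⟩, a4, a5⟩, hb⟩
      simp only [Test.Holds, WExp.val, a1.S_eq, a2] at hb
      have hrk : r = k := by
        by_contra hcon
        have : (2 : ℕ) ^ (r + 1) ≤ 2 ^ k := Nat.pow_le_pow_right (by norm_num) (by omega)
        rw [pow_succ] at this
        have : 0 < 2 ^ r := by positivity
        omega
      subst hrk
      refine ⟨a3, a4, fun i j hj hf => ?_, a1⟩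
      rw [a2, ← hS] at a5
      -- A column full for all rows would satisfy `M ≤ F (S - 1) ≤ i < G 0 ≤ M`.
      refine a5 0 (dvd_zero _) (by omega) j i (Nat.zero_le _) (by omega) hf fun hfull => ?_
      simp only [FullBlock, zero_add] at hfull
      have := hFG.F_last
      have := hFG.G_le 0 (Nat.zero_le _)
      omega
  · have : k * (7000 * S * (k + 1) + 15 + 3) ≤ k * (7000 * S * (k + 1) + 20) :=
      Nat.mul_le_mul_left _ (by omega)
    omega

end RealRAM

/-! ### The polygon of two chains -/

/-- The first vector is lexicographically positive. -/
def LexPos (e : ℝ × ℝ) : Prop := 0 < e.1 ∨ e.1 = 0 ∧ 0 < e.2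

theorem lexPos_sub {p q : ℝ × ℝ} (h : toLex p < toLex q) : LexPos (q - p) := toLex_sub_pos h

/-- The lexicographically positive vectors form a half-plane, on which being clockwise is
transitive. The main case is the identity `f.1 * cross e g = e.1 * cross f g + g.1 * cross e f`. An
upward vertical vector is never clockwise from another vector of the half-plane, which excludes the
cases of vertical `f` or `g`. -/
theorem cross_neg_trans {e f g : ℝ × ℝ} (he : LexPos e) (hf : LexPos f) (hg : LexPos g)
    (h1 : cross e f < 0) (h2 : cross f g < 0) : cross e g < 0 := by
  simp only [LexPos, cross] at *
  have he1 : 0 ≤ e.1 := by rcases he with he | he <;> linarith [he]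
  have hg1 : 0 ≤ g.1 := by rcases hg with hg | hg <;> linarith [hg]
  rcases hf with hf | ⟨hf, hf2⟩
  · rcases hg1.lt_or_eq with hg' | hg'
    · have : f.1 * (e.1 * g.2 - e.2 * g.1) < 0 := by
        have : f.1 * (e.1 * g.2 - e.2 * g.1) =
          e.1 * (f.1 * g.2 - f.2 * g.1) + g.1 * (e.1 * f.2 - e.2 * f.1) := by ring
        rw [this]
        nlinarith
      by_contra hc
      push Not at hc
      nlinarith
    · rw [← hg'] at h2
      have hg2 : 0 < g.2 := by
        rcases hg with hg | hg
        · linarith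
        · exact hg.2
      nlinarith
  · rw [hf] at h1
    nlinarith

/-- The orientation of a triple of points. -/
def orient (p q r : ℝ × ℝ) : ℝ := cross (q - p) (r - p)

theorem orient_rotate (p q r : ℝ × ℝ) : orient p q r = orient q r p := by
  simp only [orient, cross, Prod.fst_sub, Prod.snd_sub]
  ring

theorem orient_swap (p q r : ℝ × ℝ) : orient p q r = - orient r q p := by
  simp only [orient, cross, Prod.fst_sub, Prod.snd_sub]
  ring

theorem orient_neg (p q r : ℝ × ℝ) : orient (-p) (-q) (-r) = orient p q r := by
  simp only [orient, cross, Prod.fst_sub, Prod.snd_sub, Prod.fst_neg, Prod.snd_neg]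
  ring

/-- Seen from a lexicographically smaller point, the other points lie in a half-plane, where
clockwise order is transitive. `orient_trans_right` is the same with a larger point as the pivot. -/
theorem orient_trans_left {p q r z : ℝ × ℝ} (hq : toLex p < toLex q) (hr : toLex p < toLex r)
    (hz : toLex p < toLex z) (h1 : orient p q r < 0) (h2 : orient p r z < 0) :
    orient p q z < 0 :=
  cross_neg_trans (lexPos_sub hq) (lexPos_sub hr) (lexPos_sub hz) h1 h2

theorem orient_trans_right {o p r z : ℝ × ℝ} (ho : toLex o < toLex r) (hp : toLex p < toLex r)
    (hz : toLex z < toLex r) (h1 : orient o p r < 0) (h2 : orient o r z < 0) :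
    orient p r z < 0 := by
  have := cross_neg_trans (lexPos_sub hz) (lexPos_sub ho) (lexPos_sub hp)
    (by simp only [orient, cross, Prod.fst_sub, Prod.snd_sub] at *; linarith)
    (by simp only [orient, cross, Prod.fst_sub, Prod.snd_sub] at *; linarith)
  simp only [orient, cross, Prod.fst_sub, Prod.snd_sub] at *
  linarith

namespace UpperChain

variable {S S' : Set (ℝ × ℝ)} {a b : ℕ} {v w : ℕ → ℝ × ℝ}

theorem strictMono (h : UpperChain S a v) {i j : ℕ} (hij : i < j) (hj : j < a) :
    toLex (v i) < toLex (v j) := by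
  induction j, hij using Nat.le_induction with
  | base => exact h.lex i hj
  | succ j hij ih => exact (ih (by omega)).trans (h.lex j hj)

/-- The chord from `v i` is a sum of edges, and by transitivity each of them is counterclockwise
from the next edge. -/
theorem cross_edge_neg (h : UpperChain S a v) {i j : ℕ} (hij : i < j) (hj : j + 1 < a) :
    cross (v j - v i) (v (j + 1) - v j) < 0 := by
  induction j, hij using Nat.le_induction with
  | base =>
    have := h.turn i hj
    simp only [cross, Prod.fst_sub, Prod.snd_sub, Nat.succ_eq_add_one, add_assoc,
      one_add_one_eq_two] at *
    linarith
  | succ j hij ih =>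
    have h1 := ih (by omega)
    have h2 : cross (v (j + 1) - v j) (v (j + 1 + 1) - v (j + 1)) < 0 := by
      have := h.turn j hj
      simp only [cross, Prod.fst_sub, Prod.snd_sub, add_assoc, one_add_one_eq_two] at *
      linarith
    have h3 := cross_neg_trans (lexPos_sub (h.strictMono hij (by omega)))
      (lexPos_sub (h.lex j (by omega))) (lexPos_sub (h.lex (j + 1) hj)) h1 h2
    simp only [cross, Prod.fst_sub, Prod.snd_sub] at *
    linarith

/-- Local right turns become right turns of all triples: the second chord is again a sum of edges,
all clockwise from the first chord. -/
theorem orient_neg_of_lt (h : UpperChain S a v) {i j l : ℕ} (hij : i < j) (hjl : j < l)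
    (hl : l < a) : orient (v i) (v j) (v l) < 0 := by
  have key : cross (v j - v i) (v l - v j) < 0 := by
    induction l, hjl using Nat.le_induction with
    | base => exact h.cross_edge_neg hij hl
    | succ l hjl ih =>
      have h1 := ih (by omega)
      have h2 := cross_neg_trans (lexPos_sub (h.strictMono hij (by omega)))
        (lexPos_sub (h.strictMono hjl (by omega))) (lexPos_sub (h.lex l hl)) h1
        (h.cross_edge_neg hjl hl)
      simp only [cross, Prod.fst_sub, Prod.snd_sub] at *
      linarith
  simp only [orient, cross, Prod.fst_sub, Prod.snd_sub] at *
  linarith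

/-- A point strictly below the chord of a chain is strictly below all its secants. -/
theorem orient_neg_of_below (h : UpperChain S (a + 1) v) {z : ℝ × ℝ} (h0 : toLex (v 0) < toLex z)
    (ha : toLex z < toLex (v a)) (hz : orient (v 0) (v a) z < 0) {i j : ℕ} (hji : j < i)
    (hi : i ≤ a) : orient (v j) (v i) z < 0 := by
  have left : ∀ i, 0 < i → i ≤ a → orient (v 0) (v i) z < 0 := by
    intro i hi0 hi
    rcases hi.eq_or_lt with rfl | hi
    · exact hz
    · exact orient_trans_left (h.strictMono hi0 (by omega))
        (h.strictMono (hi0.trans hi) (by omega)) h0 (h.orient_neg_of_lt hi0 hi (by omega)) hz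
  rcases Nat.eq_zero_or_pos j with rfl | hj
  · exact left i hji hi
  -- A point left of `v i` is compared with `v i` as the pivot. Otherwise the pivot is `v j`, and
  -- the comparison goes through the last point `v a`.
  · by_cases hzi : toLex z < toLex (v i)
    · exact orient_trans_right (h.strictMono (hj.trans hji) (by omega))
        (h.strictMono hji (by omega)) hzi (h.orient_neg_of_lt hj hji (by omega))
        (left i (hj.trans hji) hi)
    · have hia : i < a := by
        rcases hi.eq_or_lt with rfl | hi
        · exact absurd ha hzi
        · exact hi
      have hvz : toLex (v j) < toLex z :=
        (h.strictMono hji (by omega)).trans_le (not_lt.1 hzi)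
      have hja : orient (v j) (v a) z < 0 :=
        orient_trans_right (h.strictMono (hj.trans (hji.trans hia)) (by omega))
          (h.strictMono (hji.trans hia) (by omega)) ha
          (h.orient_neg_of_lt hj (hji.trans hia) (by omega)) hz
      exact orient_trans_left (h.strictMono hji (by omega))
        (h.strictMono (hji.trans hia) (by omega)) hvz
        (h.orient_neg_of_lt hji hia (by omega)) hja

end UpperChain

/-- A point outside the hull is separated by a functional. If its second coefficient is nonzero, it
can be scaled to `(u, 1)` or `-(u, 1)`, contradicting domination. A functional without second
coefficient is replaced by a steep tilt of it. -/
theorem subset_convexHull_of_dirVal {T Z : Set (ℝ × ℝ)} (hT : T.Finite)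
    (h1 : ∀ u, ∀ p ∈ Z, ∃ t ∈ T, dirVal u p ≤ dirVal u t)
    (h2 : ∀ u, ∀ p ∈ Z, ∃ t ∈ T, dirVal u (-p) ≤ dirVal u (-t)) : Z ⊆ convexHull ℝ T := by
  intro p hp
  by_contra hc
  obtain ⟨f, c, hf, hfp⟩ := geometric_hahn_banach_closed_point (convex_convexHull ℝ T)
    (hT.isClosed_convexHull ℝ) hc
  have hf' : ∀ q : ℝ × ℝ, f q = f (1, 0) * q.1 + f (0, 1) * q.2 := by
    intro q
    have : q = q.1 • ((1, 0) : ℝ × ℝ) + q.2 • ((0, 1) : ℝ × ℝ) := by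
      ext <;> simp
    conv_lhs => rw [this, map_add, map_smul, map_smul]
    simp only [smul_eq_mul]
    ring
  have hft : ∀ t ∈ T, f t < f p := fun t ht => (hf t (subset_convexHull ℝ T ht)).trans hfp
  simp only [hf' p] at hft
  set α := f (1, 0)
  set β := f (0, 1)
  rcases lt_trichotomy β 0 with hβ | hβ | hβ
  · obtain ⟨t, ht, hle⟩ := h2 (α / β) p hp
    have := hft t ht
    rw [hf' t] at this
    simp only [dirVal, Prod.fst_neg, Prod.snd_neg] at hle
    have := mul_le_mul_of_nonneg_left hle (neg_nonneg.2 hβ.le)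
    have e : ∀ q : ℝ × ℝ, -β * (-q.2 + α / β * -q.1) = α * q.1 + β * q.2 := fun q => by
      have := hβ.ne
      field_simp
      ring
    rw [e, e] at this
    linarith
  -- For large `x` the functional `(x * α, 1)` still separates: the horizontal gaps are positive,
  -- and finiteness of `T` gives one `x` for all of them.
  · have : ∀ᶠ x : ℝ in Filter.atTop, ∀ t ∈ T, t.2 - p.2 < x * (α * (p.1 - t.1)) := by
      rw [Filter.eventually_all_finite hT]
      intro t ht
      have := hft t ht
      rw [hf' t, hβ] at this
      exact (Filter.tendsto_id.atTop_mul_const (by linarith : 0 < α * (p.1 - t.1))).eventually_gt_atTop _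
    obtain ⟨x, hx⟩ := this.exists
    obtain ⟨t, ht, hle⟩ := h1 (x * α) p hp
    have := hx t ht
    simp only [dirVal] at hle
    linarith
  · obtain ⟨t, ht, hle⟩ := h1 (α / β) p hp
    have := hft t ht
    rw [hf' t] at this
    simp only [dirVal] at hle
    have := mul_le_mul_of_nonneg_left hle hβ.le
    have e : ∀ q : ℝ × ℝ, β * (q.2 + α / β * q.1) = α * q.1 + β * q.2 := fun q => by
      have := hβ.ne'
      field_simp
      ring
    rw [e, e] at this
    linarith

/-- The points that equal `x` or have a smaller value form a convex set. It contains the hull, so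
`f` attains its maximum over the hull only at `x`. -/
theorem mem_extremePoints_of_forall_lt {Q : Set (ℝ × ℝ)} {x : ℝ × ℝ} (hx : x ∈ Q)
    (f : ℝ × ℝ →ₗ[ℝ] ℝ) (h : ∀ p ∈ Q, p ≠ x → f p < f x) :
    x ∈ (convexHull ℝ Q).extremePoints ℝ := by
  have hC : convexHull ℝ Q ⊆ {p | p = x ∨ f p < f x} := by
    refine convexHull_min (fun p hp => ?_) ?_
    · by_cases hpx : p = x
      · exact .inl hpx
      · exact .inr (h p hp hpx)
    · intro p hp q hq s t hs ht hst
      have key : ∀ r, (r = x ∨ f r < f x) → f r ≤ f x := by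
        rintro r (rfl | hr)
        · exact le_rfl
        · exact hr.le
      rcases hs.eq_or_lt with rfl | hs'
      · rw [zero_add] at hst
        subst hst
        simpa using hq
      rcases ht.eq_or_lt with rfl | ht'
      · rw [add_zero] at hst
        subst hst
        simpa using hp
      have hval : f (s • p + t • q) = s * f p + t * f q := by simp
      have hx' : f x = s * f x + t * f x := by rw [← add_mul, hst, one_mul]
      rcases hp with rfl | hp
      · rcases hq with rfl | hq
        · exact .inl (by rw [← add_smul, hst, one_smul])
        · right
          rw [hval]
          nlinarith
      · right
        rw [hval]
        have := key q hq
        nlinarith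
  refine ⟨subset_convexHull ℝ Q hx, fun p hp q hq hpq => ?_⟩
  obtain ⟨s, t, hs, ht, hst, he⟩ := hpq
  have hval : f x = s * f p + t * f q := by rw [← he]; simp
  have hx' : f x = s * f x + t * f x := by rw [← add_mul, hst, one_mul]
  have hq' : f q ≤ f x := by
    rcases hC hq with rfl | hq
    · exact le_rfl
    · exact hq.le
  rcases hC hp with hp | hp
  · exact hp
  · nlinarith

/-- The functional is normal to the chord between the cyclic neighbours `q p` and `q n` of `q j`:
its gain from `q l` to `q j` is the sum of the orientations of `(q p, q j, q l)` and `(q j, q n, q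
l)`. With fewer than three points there are no orientations, and two points have to be distinct by
assumption. -/
theorem exists_lt_of_ccw {k : ℕ} {q : ℕ → ℝ × ℝ}
    (ccw : ∀ i j l : ℕ, i < j → j < l → l < k → 0 < orient (q i) (q j) (q l))
    (h2 : k = 2 → q 0 ≠ q 1) {j : ℕ} (hj : j < k) :
    ∃ f : ℝ × ℝ →ₗ[ℝ] ℝ, ∀ l, l < k → l ≠ j → f (q l) < f (q j) := by
  have dot : ∀ d : ℝ × ℝ, ∃ f : ℝ × ℝ →ₗ[ℝ] ℝ, ∀ p, f p = d.1 * p.1 + d.2 * p.2 := fun d =>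
    ⟨d.1 • LinearMap.fst ℝ ℝ ℝ + d.2 • LinearMap.snd ℝ ℝ ℝ, fun p => by simp⟩
  rcases lt_or_ge k 3 with hk | hk
  · have : k = 1 ∨ k = 2 := by omega
    rcases this with rfl | rfl
    · exact ⟨0, fun l hl hlj => by omega⟩
    · have hne : q (1 - j) ≠ q j := by
        have := h2 rfl
        obtain rfl | rfl : j = 0 ∨ j = 1 := by omega
        · exact this.symm
        · exact this
      obtain ⟨f, hf⟩ := dot (q j - q (1 - j))
      refine ⟨f, fun l hl hlj => ?_⟩
      obtain rfl : l = 1 - j := by omega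
      rw [hf, hf]
      have : 0 < ((q j).1 - (q (1 - j)).1) ^ 2 + ((q j).2 - (q (1 - j)).2) ^ 2 := by
        by_contra hc
        apply hne
        have h1 : ((q j).1 - (q (1 - j)).1) ^ 2 = 0 := by nlinarith [sq_nonneg ((q j).1 - (q (1 - j)).1), sq_nonneg ((q j).2 - (q (1 - j)).2)]
        have h2 : ((q j).2 - (q (1 - j)).2) ^ 2 = 0 := by nlinarith [sq_nonneg ((q j).1 - (q (1 - j)).1), sq_nonneg ((q j).2 - (q (1 - j)).2)]
        ext
        · linarith [pow_eq_zero_iff (two_ne_zero) |>.1 h1]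
        · linarith [pow_eq_zero_iff (two_ne_zero) |>.1 h2]
      simp only [Prod.fst_sub, Prod.snd_sub]
      nlinarith
  · have main : ∀ p n, p < k → n < k →
        (∀ l, l < k → l ≠ j → l ≠ p → 0 < orient (q p) (q j) (q l)) →
        (∀ l, l < k → l ≠ j → l ≠ n → 0 < orient (q j) (q n) (q l)) → p ≠ n →
        ∃ f : ℝ × ℝ →ₗ[ℝ] ℝ, ∀ l, l < k → l ≠ j → f (q l) < f (q j) := by
      intro p n _ _ h1 h2 hpn
      obtain ⟨f, hf⟩ := dot ((q n - q p).2, -(q n - q p).1)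
      refine ⟨f, fun l hl hlj => ?_⟩
      rw [hf, hf]
      have e1 : 0 ≤ orient (q p) (q j) (q l) := by
        by_cases hlp : l = p
        · simp [hlp, orient, cross]
        · exact (h1 l hl hlj hlp).le
      have e2 : 0 ≤ orient (q j) (q n) (q l) := by
        by_cases hln : l = n
        · rw [hln]
          simp only [orient, cross]
          linarith
        · exact (h2 l hl hlj hln).le
      have : 0 < orient (q p) (q j) (q l) + orient (q j) (q n) (q l) := by
        by_cases hlp : l = p
        · have := h2 l hl hlj (by omega)
          linarith
        · have := h1 l hl hlj hlp
          linarith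
      simp only [orient, cross, Prod.fst_sub, Prod.snd_sub] at this ⊢
      linarith
    rcases Nat.eq_zero_or_pos j with rfl | hj0
    · refine main (k - 1) 1 (by omega) (by omega) (fun l hl h1 h2 => ?_) (fun l hl h1 h2 => ?_)
        (by omega)
      · rw [orient_rotate]
        exact ccw 0 l (k - 1) (by omega) (by omega) (by omega)
      · exact ccw 0 1 l (by omega) (by omega) hl
    · by_cases hjk : j = k - 1
      · refine main (j - 1) 0 (by omega) (by omega) (fun l hl h1 h2 => ?_) (fun l hl h1 h2 => ?_)
          (by omega)
        · rw [← orient_rotate]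
          exact ccw l (j - 1) j (by omega) (by omega) (by omega)
        · rw [orient_rotate]
          exact ccw 0 l j (by omega) (by omega) hj
      · refine main (j - 1) (j + 1) (by omega) (by omega) (fun l hl h1 h2 => ?_)
          (fun l hl h1 h2 => ?_) (by omega)
        · rcases lt_or_ge l (j - 1) with h3 | h3
          · rw [← orient_rotate]
            exact ccw l (j - 1) j h3 (by omega) hj
          · exact ccw (j - 1) j l (by omega) (by omega) hl
        · rcases lt_or_ge l j with h3 | h3
          · rw [← orient_rotate]
            exact ccw l j (j + 1) h3 (by omega) (by omega)
          · exact ccw j (j + 1) l (by omega) (by omega) hl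

theorem isVertexCycle_of_ccw {K : Set (ℝ × ℝ)} {k : ℕ} {q : ℕ → ℝ × ℝ}
    (hK : K = convexHull ℝ (q '' Set.Iio k))
    (ccw : ∀ i j l : ℕ, i < j → j < l → l < k → 0 < orient (q i) (q j) (q l))
    (h2 : k = 2 → q 0 ≠ q 1) : IsVertexCycle K k q := by
  have ne : ∀ i j, i < k → j < k → i ≠ j → q i ≠ q j := by
    intro i j hi hj hij he
    obtain ⟨f, hf⟩ := exists_lt_of_ccw ccw h2 hj
    have := hf i hi hij
    rw [he] at this
    exact lt_irrefl _ this
  refine ⟨fun i hi j hj he => ?_, ?_, ccw⟩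
  · by_contra hij
    exact ne i j hi hj hij he
  · subst hK
    refine Set.Subset.antisymm ?_ extremePoints_convexHull_subset
    rintro _ ⟨j, hj, rfl⟩
    obtain ⟨f, hf⟩ := exists_lt_of_ccw ccw h2 hj
    refine mem_extremePoints_of_forall_lt ⟨j, hj, rfl⟩ f ?_
    rintro _ ⟨l, hl, rfl⟩ hne
    exact hf l hl fun h => hne (by rw [h])

/-- The vertices of the polygon with upper chain `v 0, …, v a` and lower chain
`-w b, …, -w 0`. -/
theorem isVertexCycle_of_chains {S : Set (ℝ × ℝ)} {a b k : ℕ} {v w q : ℕ → ℝ × ℝ}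
    (hv : UpperChain S (a + 1) v) (hw : UpperChain ((fun p => -p) '' S) (b + 1) w)
    (hk : k = if a + b = 0 then 1 else a + b) (hq1 : ∀ i, i < a → q i = v (a - i))
    (hq2 : ∀ i, i < b → q (a + i) = -w (b - i)) (hq0 : a + b = 0 → q 0 = -w 0) :
    IsVertexCycle (convexHull ℝ S) k q := by
  have hmem : ∀ i, i ≤ b → -w i ∈ S := fun i hi => by
    obtain ⟨p, hp, he⟩ := hw.mem i (by omega)
    rw [← he]
    simpa using hp
  have neg_le : ∀ p r : ℝ × ℝ, toLex (-p) ≤ toLex r → toLex (-r) ≤ toLex p := by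
    intro p r h
    have := neg_le_neg h
    simpa [← toLex_neg] using this
  have neg_lt : ∀ p r : ℝ × ℝ, toLex p < toLex r → toLex (-r) < toLex (-p) := by
    intro p r h
    have := neg_lt_neg h
    simpa [← toLex_neg] using this
  -- Both chains run between the lexicographic extremes of `S`, so they share their ends. In `q` the
  -- right end is written with the upper chain and the left end with the lower one.
  have e0 : v 0 = -w b := by
    refine toLex.injective (le_antisymm (hv.first _ (hmem b le_rfl)) ?_)
    exact neg_le _ _ (hw.last _ ⟨v 0, hv.mem 0 (by omega), rfl⟩)
  have ea : v a = -w 0 := by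
    refine toLex.injective (le_antisymm ?_ (hv.last _ (hmem 0 (by omega))))
    have := hw.first _ ⟨v a, hv.mem a (by omega), rfl⟩
    have := neg_le_neg this
    simpa [← toLex_neg] using this
  -- Either chain degenerates only if the two extremes of `S` coincide.
  have hab : a = 0 ↔ b = 0 := by
    constructor
    · rintro rfl
      by_contra hb
      have := hw.strictMono (i := 0) (j := b) (by omega) (by omega)
      rw [ea] at e0
      rw [neg_injective e0] at this
      exact lt_irrefl _ this
    · rintro rfl
      by_contra ha
      have := hv.strictMono (i := 0) (j := a) (by omega) (by omega)
      rw [ea, e0] at this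
      exact lt_irrefl _ this
  rcases Nat.eq_zero_or_pos a with rfl | ha
  · obtain rfl : b = 0 := hab.1 rfl
    simp only [zero_add, if_true] at hk
    subst hk
    refine isVertexCycle_of_ccw ?_ (fun i j l h1 h2 h3 => by omega) (by omega)
    refine Set.Subset.antisymm (convexHull_min ?_ (convex_convexHull ℝ _))
      (convexHull_mono ?_)
    · intro p hp
      apply subset_convexHull
      refine ⟨0, by simp, ?_⟩
      rw [hq0 rfl, ← ea]
      exact toLex.injective (le_antisymm (hv.first p hp) (hv.last p hp))
    · rintro _ ⟨i, hi, rfl⟩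
      obtain rfl : i = 0 := by simpa using hi
      rw [hq0 rfl]
      exact hmem 0 le_rfl
  · have hb : 0 < b := by
      rcases Nat.eq_zero_or_pos b with hb | hb
      · exact absurd (hab.2 hb) (by omega)
      · exact hb
    rw [if_neg (by omega)] at hk
    subst hk
    -- The inner points of the lower chain lie strictly below the common chord, and those of the
    -- upper chain strictly above it. With `orient_neg_of_below` this settles triples drawn from
    -- both chains.
    have chord_w : ∀ c, 0 < c → c < b → toLex (v 0) < toLex (-w c) ∧
        toLex (-w c) < toLex (v a) ∧ orient (v 0) (v a) (-w c) < 0 := by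
      intro c hc hcb
      rw [e0, ea]
      refine ⟨neg_lt _ _ (hw.strictMono hcb (by omega)), neg_lt _ _ (hw.strictMono hc (by omega)),
        ?_⟩
      rw [orient_rotate, orient_neg]
      exact hw.orient_neg_of_lt hc hcb (by omega)
    have chord_v : ∀ c, 0 < c → c < a → toLex (w 0) < toLex (-v c) ∧
        toLex (-v c) < toLex (w b) ∧ orient (w 0) (w b) (-v c) < 0 := by
      intro c hc hca
      have e0' : w b = -v 0 := by rw [e0, neg_neg]
      have ea' : w 0 = -v a := by rw [ea, neg_neg]
      rw [e0', ea']
      refine ⟨neg_lt _ _ (hv.strictMono hca (by omega)), neg_lt _ _ (hv.strictMono hc (by omega)),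
        ?_⟩
      rw [orient_rotate, orient_neg]
      exact hv.orient_neg_of_lt hc hca (by omega)
    have Q2 : ∀ i, a ≤ i → i < a + b → q i = -w (b - (i - a)) := fun i h1 h2 => by
      have := hq2 (i - a) (by omega)
      rwa [show a + (i - a) = i by omega] at this
    refine isVertexCycle_of_ccw ?_ ?_ ?_
    · refine Set.Subset.antisymm (convexHull_min ?_ (convex_convexHull ℝ _))
        (convexHull_mono ?_)
      · have hvq : ∀ i, i ≤ a → ∃ x, x < a + b ∧ q x = v i := by
          intro i hi
          rcases Nat.eq_zero_or_pos i with rfl | hi0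
          · exact ⟨a, by omega, by rw [Q2 a le_rfl (by omega), e0]; simp⟩
          · exact ⟨a - i, by omega, by rw [hq1 _ (by omega)]; congr 1; omega⟩
        have hwq : ∀ i, i ≤ b → ∃ x, x < a + b ∧ q x = -w i := by
          intro i hi
          rcases Nat.eq_zero_or_pos i with rfl | hi0
          · exact ⟨0, by omega, by rw [hq1 0 ha, ← ea]; simp⟩
          · refine ⟨a + (b - i), by omega, ?_⟩
            rw [hq2 _ (by omega)]
            congr 2
            omega
        refine subset_convexHull_of_dirVal ((Set.finite_Iio _).image _) (fun u p hp => ?_)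
          (fun u p hp => ?_)
        · obtain ⟨i, hi, hle⟩ := hv.dom u p hp
          obtain ⟨x, hx, hxv⟩ := hvq i (by omega)
          exact ⟨_, ⟨x, hx, rfl⟩, by rwa [hxv]⟩
        · obtain ⟨i, hi, hle⟩ := hw.dom u (-p) ⟨p, hp, rfl⟩
          obtain ⟨x, hx, hxv⟩ := hwq i (by omega)
          exact ⟨_, ⟨x, hx, rfl⟩, by rwa [hxv, neg_neg]⟩
      · rintro _ ⟨i, hi, rfl⟩
        have hi : i < a + b := hi
        rcases lt_or_ge i a with h1 | h1
        · rw [hq1 i h1]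
          exact hv.mem _ (by omega)
        · rw [Q2 i h1 hi]
          exact hmem _ (by omega)
    · intro i j l hij hjl hl
      rcases lt_or_ge l a with h1 | h1
      · rw [hq1 i (by omega), hq1 j (by omega), hq1 l h1, orient_swap, neg_pos]
        exact hv.orient_neg_of_lt (by omega) (by omega) (by omega)
      rcases lt_or_ge j a with h2 | h2
      · rw [hq1 i (by omega), hq1 j h2, Q2 l h1 hl]
        rcases h1.eq_or_lt with h3 | h3
        · rw [← h3, Nat.sub_self, Nat.sub_zero, ← e0, orient_swap, neg_pos]
          exact hv.orient_neg_of_lt (by omega) (by omega) (by omega)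
        · obtain ⟨c1, c2, c3⟩ := chord_w (b - (l - a)) (by omega) (by omega)
          have := hv.orient_neg_of_below c1 c2 c3 (i := a - i) (j := a - j) (by omega) (by omega)
          simp only [orient, cross, Prod.fst_sub, Prod.snd_sub] at this ⊢
          linarith
      rcases lt_or_ge i a with h3 | h3
      · rw [hq1 i h3, Q2 j h2 (by omega), Q2 l h1 hl]
        rcases Nat.eq_zero_or_pos i with h4 | h4
        · rw [h4, Nat.sub_zero, ea, orient_neg]
          have := hw.orient_neg_of_lt (i := 0) (j := b - (l - a)) (l := b - (j - a)) (by omega)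
            (by omega) (by omega)
          simp only [orient, cross, Prod.fst_sub, Prod.snd_sub] at this ⊢
          linarith
        · obtain ⟨c1, c2, c3⟩ := chord_v (a - i) (by omega) (by omega)
          have := hw.orient_neg_of_below c1 c2 c3 (i := b - (j - a)) (j := b - (l - a)) (by omega)
            (by omega)
          simp only [orient, cross, Prod.fst_sub, Prod.snd_sub, Prod.fst_neg, Prod.snd_neg]
            at this ⊢
          linarith
      · rw [Q2 i h3 (by omega), Q2 j h2 (by omega), Q2 l h1 hl, orient_neg, orient_swap, neg_pos]
        exact hw.orient_neg_of_lt (by omega) (by omega) (by omega)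
    · intro hab2
      obtain rfl : a = 1 := by omega
      obtain rfl : b = 1 := by omega
      rw [hq1 0 (by omega), Q2 1 le_rfl (by omega)]
      simp only [Nat.sub_zero, Nat.sub_self]
      rw [← e0]
      intro he
      have := hv.lex 0 (by omega)
      rw [zero_add, he] at this
      exact lt_irrefl _ this

/-! ### The output -/

namespace RealRAM

/-- Copy the points `c, …, 1` of the arrays `12` and `13`, multiplied by `τ`, to the output from
position `46` on, where `c` is the value of word variable `45`. -/
def revCopy (τ : ℤ) : Prog :=
  .setW 33 (.const 0) ;;
  .loop (.wlt (.var 33) (.var 45))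
    (.putR 2 (.add (.var 46) (.var 33)) (.mul (.const τ) (.get 12 (.sub (.var 45) (.var 33)))) ;;
      .putR 3 (.add (.var 46) (.var 33)) (.mul (.const τ) (.get 13 (.sub (.var 45) (.var 33)))) ;;
      .inc 33)

theorem revCopy_wp {B c o : ℕ} {s : State} {τ : ℤ} (hc : s.wvar 45 = c) (ho : s.wvar 46 = o)
    (hB : o + c + 2 ≤ B) :
    Wp B (revCopy τ) (40 * c + 10)
      (fun s' => (∀ x, x < c → s'.pt 2 3 (o + x) = (τ : ℝ) • s.pt 12 13 (c - x)) ∧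
        ∀ x, x < o → s'.pt 2 3 x = s.pt 2 3 x) s := by
  refine Wp.step (T₁ := 2) (T₂ := c * 40 + 3)
    (R := fun s' => s' = s.setW 33 0)
    (Wp.flat ⟨by simp only [WExp.val]; omega, rfl⟩ (by decide)) (fun s₁ hs₁ _ => ?_) (by omega)
  refine (Wp.loop_flat
    (fun s' => s'.wvar 45 = c ∧ s'.wvar 46 = o ∧ s'.rarr 12 = s.rarr 12 ∧
      s'.rarr 13 = s.rarr 13 ∧ s'.wvar 33 ≤ c ∧
      (∀ x, x < s'.wvar 33 → s'.pt 2 3 (o + x) = (τ : ℝ) • s.pt 12 13 (c - x)) ∧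
      ∀ x, x < o → s'.pt 2 3 x = s.pt 2 3 x)
    (fun s' => c - s'.wvar 33) c ?_ ?_ ?_).mono ?_ ?_
  · subst hs₁
    simp [hc, ho]
  · omega
  · rintro s' ⟨a1, a2, a3, a4, a5, a6, a7⟩ hb
    simp only [Test.Holds, WExp.val, a1] at hb
    simp only [Prog.Vc, Prog.inc, WExp.val, RExp.val]
    simp [a1, a2, a3, a4]
    refine ⟨by omega, by omega, ⟨by omega, fun x hx => ?_, fun x hx => ?_⟩, by omega⟩
    · by_cases hxe : x = s'.wvar 33
      · subst hxe
        simp [State.pt]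
      · have := a6 x (by omega)
        simpa [State.pt, hxe] using this
    · have := a7 x hx
      have hne : x ≠ o + s'.wvar 33 := by omega
      simpa [State.pt, hne] using this
  · simp [Prog.flatCost, Test.cost, WExp.cost, RExp.cost, Prog.inc]
    omega
  · rintro s' ⟨⟨a1, a2, a3, a4, a5, a6, a7⟩, hb⟩
    simp only [Test.Holds, WExp.val, a1] at hb
    have : s'.wvar 33 = c := by omega
    exact ⟨this ▸ a6, a7⟩

/-- Output the convex hull of the first `26` (value of a word variable) points of the arrays `16`
and `17`. -/
def outProg : Prog :=
  (.setW 23 (.const 0) ;; .setW 24 (.var 26)) ;; hullOf 16 17 1 ;;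
  (.setW 45 (.sub (.var 21) (.const 1)) ;; .setW 46 (.const 0)) ;; revCopy 1 ;;
  .setW 46 (.var 45) ;; hullOf 16 17 (-1) ;; .setW 45 (.sub (.var 21) (.const 1)) ;;
  revCopy (-1) ;;
  .cond (.weq (.add (.var 46) (.var 45)) (.const 0))
    (.putR 2 (.const 0) (.mul (.const (-1)) (.get 12 (.const 0))) ;;
      .putR 3 (.const 0) (.mul (.const (-1)) (.get 13 (.const 0))) ;; .setW 2 (.const 1))
    (.setW 2 (.add (.var 46) (.var 45)))

/-- Each chain is written backwards without its first point, so common ends appear once. If both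
chains are single points, nothing is written this way, and the final conditional writes the point.
-/
theorem outProg_wp {B N k : ℕ} {s : State} (hN : s.wvar 26 = N) (hN0 : 0 < N) (hk : N ≤ 2 ^ k)
    (hB : 2 * N + 4 ≤ B) :
    Wp B outProg (2000 * (N + 1) * (k + 1))
      (fun s' => s'.wvar 2 ≤ 2 * N ∧
        IsVertexCycle (convexHull ℝ (s.pt 16 17 '' Set.Iio N)) (s'.wvar 2) (s'.pt 2 3)) s := by
  have hk1 : (N + 1) ≤ (N + 1) * (k + 1) := Nat.le_mul_of_pos_right _ (by omega)
  refine Wp.step (T₁ := 10) (T₂ := 700 * (N + 1) * (k + 1) + (10 + ((40 * N + 10) + (10 +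
    (700 * (N + 1) * (k + 1) + (10 + ((40 * N + 10) + 50))))))) (R := fun s' => s'.wvar 23 = 0 ∧ s'.wvar 24 = N ∧
      s'.rarr = s.rarr) ?_ (fun s₁ h₁ f₁ => ?_) ?_
  · refine Wp.flat ?_ (by decide)
    simp [Prog.Vc, WExp.val, hN]
    omega
  · obtain ⟨a1, a2, a3⟩ := h₁
    refine Wp.step (hullOf_wp (m := N) (k := k) (by decide) (by decide) (by decide) (by decide)
      (by omega) (by omega) (by omega) hk) (fun s₂ h₂ f₂ => ?_) le_rfl
    obtain ⟨b1, b2⟩ := h₂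
    have w23 : s₂.wvar 23 = 0 := by rw [f₂.wvar 23 (by rw [hullOf_wv]; decide), a1]
    have w24 : s₂.wvar 24 = N := by rw [f₂.wvar 24 (by rw [hullOf_wv]; decide), a2]
    have r2 : s₂.pt 16 17 = s.pt 16 17 := by
      ext1 i
      simp only [State.pt]
      rw [f₂.rarr 16 (by rw [hullOf_ra]; decide), f₂.rarr 17 (by rw [hullOf_ra]; decide), a3]
    have r1 : s₁.pt 16 17 = s.pt 16 17 := by
      ext1 i
      simp [State.pt, a3]
    have img : (fun i => ((1 : ℤ) : ℝ) • s.pt 16 17 i) '' Set.Ico 0 N =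
        s.pt 16 17 '' Set.Iio N := by
      ext p
      simp
    rw [a1, a2, r1, img] at b2
    rw [a1, a2] at b1
    obtain ⟨a, ha⟩ : ∃ a, s₂.wvar 21 = a + 1 := ⟨s₂.wvar 21 - 1, by have := b2.pos; omega⟩
    rw [ha] at b2
    refine Wp.step (R := fun s' => s'.wvar 45 = a ∧ s'.wvar 46 = 0 ∧ s'.rarr = s₂.rarr) ?_
      (fun s₃ h₃ f₃ => ?_) le_rfl
    · refine Wp.flat ?_ (by decide)
      simp [Prog.Vc, WExp.val, ha]
      omega
    obtain ⟨c1, c2, c3⟩ := h₃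
    refine Wp.step ((revCopy_wp c1 c2 (by omega)).mono (T' := 40 * N + 10) (by omega)
      fun _ h => h) (fun s₄ h₄ f₄ => ?_) le_rfl
    obtain ⟨d1, -⟩ := h₄
    have c45 : s₄.wvar 45 = a := by rw [f₄.wvar 45 (by decide), c1]
    refine Wp.step (R := fun s' => s'.wvar 46 = a ∧ s'.rarr = s₄.rarr) ?_
      (fun s₅ h₅ f₅ => ?_) le_rfl
    · refine Wp.flat ?_ (by decide)
      simp [Prog.Vc, WExp.val, c45]
      omega
    obtain ⟨e1, e2⟩ := h₅
    have x23 : s₅.wvar 23 = 0 := by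
      rw [f₅.wvar 23 (by decide), f₄.wvar 23 (by decide), f₃.wvar 23 (by decide), w23]
    have x24 : s₅.wvar 24 = N := by
      rw [f₅.wvar 24 (by decide), f₄.wvar 24 (by decide), f₃.wvar 24 (by decide), w24]
    have r5 : s₅.pt 16 17 = s.pt 16 17 := by
      rw [← r2]
      ext1 i
      simp only [State.pt]
      rw [e2, f₄.rarr 16 (by decide), f₄.rarr 17 (by decide), c3]
    refine Wp.step (hullOf_wp (m := N) (k := k) (by decide) (by decide) (by decide) (by decide)
      (by omega) (by omega) (by omega) hk) (fun s₆ h₆ f₆ => ?_) le_rfl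
    obtain ⟨g1, g2⟩ := h₆
    have img' : (fun i => ((-1 : ℤ) : ℝ) • s.pt 16 17 i) '' Set.Ico 0 N =
        (fun p => -p) '' (s.pt 16 17 '' Set.Iio N) := by
      rw [Set.image_image]
      ext p
      simp
    rw [x23, x24, r5, img'] at g2
    rw [x23, x24] at g1
    obtain ⟨b, hb⟩ : ∃ b, s₆.wvar 21 = b + 1 := ⟨s₆.wvar 21 - 1, by have := g2.pos; omega⟩
    rw [hb] at g2
    have y46 : s₆.wvar 46 = a := by rw [f₆.wvar 46 (by rw [hullOf_wv]; decide), e1]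
    refine Wp.step (R := fun s' => s'.wvar 45 = b ∧ s'.rarr = s₆.rarr) ?_
      (fun s₇ h₇ f₇ => ?_) le_rfl
    · refine Wp.flat ?_ (by decide)
      simp [Prog.Vc, WExp.val, hb]
      omega
    obtain ⟨i1, i2⟩ := h₇
    have z46 : s₇.wvar 46 = a := by rw [f₇.wvar 46 (by decide), y46]
    refine Wp.step ((revCopy_wp i1 z46 (by omega)).mono (T' := 40 * N + 10) (by omega)
      fun _ h => h) (fun s₈ h₈ f₈ => ?_) le_rfl
    obtain ⟨j1, j2⟩ := h₈
    have u45 : s₈.wvar 45 = b := by rw [f₈.wvar 45 (by decide), i1]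
    have u46 : s₈.wvar 46 = a := by rw [f₈.wvar 46 (by decide), z46]
    have p12 : s₈.pt 12 13 = s₆.pt 12 13 := by
      ext1 i
      simp only [State.pt]
      rw [f₈.rarr 12 (by decide), f₈.rarr 13 (by decide), i2]
    have q1 : ∀ i, i < a → s₈.pt 2 3 i = s₂.pt 12 13 (a - i) := by
      intro i hi
      rw [j2 i hi]
      have h := d1 i hi
      rw [zero_add, Int.cast_one, one_smul] at h
      have h3 : s₃.pt 12 13 = s₂.pt 12 13 := by
        ext1 i
        simp [State.pt, c3]
      rw [← h3, ← h]
      simp only [State.pt]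
      rw [i2, f₆.rarr 2 (by rw [hullOf_ra]; decide), f₆.rarr 3 (by rw [hullOf_ra]; decide), e2]
    have q2 : ∀ i, i < b → s₈.pt 2 3 (a + i) = -s₆.pt 12 13 (b - i) := by
      intro i hi
      rw [j1 i hi]
      simp [State.pt, i2]
    refine Wp.flat ?_ (by decide)
    simp only [Prog.Vc, Test.Holds, WExp.val, RExp.val, u45, u46]
    refine ⟨fun hc => ⟨by omega, by omega, by omega, ?_, ?_⟩, fun hc => ⟨by omega, ?_, ?_⟩⟩
    · simp
      omega
    · refine isVertexCycle_of_chains b2 g2 ?_ (fun i hi => by omega) (fun i hi => by omega)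
        fun _ => ?_
      · simp [hc]
      · rw [← p12]
        simp [State.pt]
    · simp
      omega
    · refine isVertexCycle_of_chains b2 g2 ?_ q1 q2 fun h => absurd h hc
      rw [if_neg hc]
      simp
  · have e : ∀ x, x * (N + 1) * (k + 1) = x * ((N + 1) * (k + 1)) := fun x => by ring
    rw [e, e]
    omega

end RealRAM

/-! ### The partition into two chains -/

section Chains

variable {P : Type u} [PartialOrder P]

/-- A labelling of the elements of `P` by `0, …, n - 1`. -/
structure Labelling (n : ℕ) (p : ℕ → P) : Prop where
  inj : ∀ x y, x < n → y < n → p x = p y → x = y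
  surj : ∀ a, ∃ x, x < n ∧ p x = a

/-- The covering relation on the labels. -/
def LabelCov (n : ℕ) (p : ℕ → P) (x y : ℕ) : Prop := x < n ∧ y < n ∧ p x ⋖ p y

/-- Among any three elements of `P`, two are comparable. -/
def NoThreeAntichain (P : Type u) [PartialOrder P] : Prop :=
  ∀ a b c : P, ¬ a ≤ b → ¬ b ≤ a → ¬ a ≤ c → ¬ c ≤ a → ¬ b ≤ c → ¬ c ≤ b → False

/-- The labels in the lower set `L` are partitioned into the chains `A 0 < A 1 < …` and
`B 0 < B 1 < …`, and `α x`, `β x` count their elements below a label `x` of `L`. -/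
structure Chains (n : ℕ) (p : ℕ → P) (L : ℕ → Prop) (na nb : ℕ) (A B α β : ℕ → ℕ) : Prop where
  mem : ∀ x, L x ↔ (∃ i, i < na ∧ A i = x) ∨ ∃ i, i < nb ∧ B i = x
  lt : ∀ x, L x → x < n
  lower : ∀ x y, L x → y < n → p y ≤ p x → L y
  A_lt : ∀ i j, i < j → j < na → p (A i) < p (A j)
  B_lt : ∀ i j, i < j → j < nb → p (B i) < p (B j)
  ne : ∀ i j, i < na → j < nb → A i ≠ B j
  α_le : ∀ x, x < n → α x ≤ na
  β_le : ∀ x, x < n → β x ≤ nb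
  α_iff : ∀ x, L x → ∀ i, i < na → (i < α x ↔ p (A i) ≤ p x)
  β_iff : ∀ x, L x → ∀ i, i < nb → (i < β x ↔ p (B i) ≤ p x)

/-- The information on the labels outside `L` that has been released along the covering pairs in
`E`. -/
structure Pending (n : ℕ) (p : ℕ → P) (L : ℕ → Prop) (E : ℕ → ℕ → Prop) (na nb : ℕ)
    (A B α β : ℕ → ℕ) : Prop where
  E_cov : ∀ x y, E x y → LabelCov n p x y ∧ L x
  placed : ∀ x y, L y → LabelCov n p x y → E x y
  α_iff : ∀ y, y < n → ¬ L y → ∀ i, i < na → (i < α y ↔ ∃ x, E x y ∧ p (A i) ≤ p x)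
  β_iff : ∀ y, y < n → ¬ L y → ∀ i, i < nb → (i < β y ↔ ∃ x, E x y ∧ p (B i) ≤ p x)

variable {n : ℕ} {p : ℕ → P} {L : ℕ → Prop} {E : ℕ → ℕ → Prop} {na nb : ℕ} {A B α β : ℕ → ℕ}

theorem Chains.swap (h : Chains n p L na nb A B α β) : Chains n p L nb na B A β α :=
  ⟨fun x => (h.mem x).trans or_comm, h.lt, h.lower, h.B_lt, h.A_lt,
    fun i j hi hj => (h.ne j i hj hi).symm, h.β_le, h.α_le, h.β_iff, h.α_iff⟩

theorem Pending.swap (h : Pending n p L E na nb A B α β) : Pending n p L E nb na B A β α :=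
  ⟨h.E_cov, h.placed, h.β_iff, h.α_iff⟩

/-- By finiteness, whatever is strictly below `y` is below some lower cover of `y`. Hence the counts
`α` and `β` can be propagated along covering pairs alone. -/
theorem exists_labelCov [Fintype P] (hp : Labelling n p) {x y : ℕ} (hy : y < n)
    (h : p x < p y) : ∃ z, LabelCov n p z y ∧ p x ≤ p z := by
  classical
  obtain ⟨a, ha, ha'⟩ := exists_le_covBy_of_lt h
  obtain ⟨z, hz, rfl⟩ := hp.surj a
  exact ⟨z, ⟨hz, hy, ha'⟩, ha⟩

/-- The released lower covers determine everything strictly below `x`; once all are released, the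
running maximum `α x` is the true count. -/
theorem Chains.lt_iff [Fintype P] (hp : Labelling n p) (_ : Chains n p L na nb A B α β)
    (h' : Pending n p L E na nb A B α β) {x : ℕ} (hx : x < n) (hL : ¬ L x)
    (hE : ∀ z, LabelCov n p z x → E z x) {i : ℕ} (hi : i < na) : i < α x ↔ p (A i) < p x := by
  rw [h'.α_iff x hx hL i hi]
  constructor
  · rintro ⟨z, hz, hle⟩
    exact hle.trans_lt (h'.E_cov _ _ hz).1.2.2.lt
  · intro hlt
    obtain ⟨z, hz, hle⟩ := exists_labelCov hp hx hlt
    exact ⟨z, hE z hz, hle⟩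

theorem Chains.lower_of_lt [Fintype P] (hp : Labelling n p) (h : Chains n p L na nb A B α β)
    (h' : Pending n p L E na nb A B α β) {x : ℕ} (hx : x < n)
    (hE : ∀ z, LabelCov n p z x → E z x) {y : ℕ} (hy : y < n) (hlt : p y < p x) : L y := by
  obtain ⟨z, hz, hle⟩ := exists_labelCov hp hx hlt
  exact h.lower z y (h'.E_cov _ _ (hE z hz)).2 hy hle

/-- Append a label to the first chain. -/
theorem Chains.place [Fintype P] (hp : Labelling n p) (h : Chains n p L na nb A B α β)
    (h' : Pending n p L E na nb A B α β) {x : ℕ} (hx : x < n) (hL : ¬ L x)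
    (hE : ∀ z, LabelCov n p z x → E z x) (hα : α x = na) :
    Chains n p (fun y => L y ∨ y = x) (na + 1) nb (Function.update A na x) B
        (Function.update α x (na + 1)) β ∧
      Pending n p (fun y => L y ∨ y = x) E (na + 1) nb (Function.update A na x) B
        (Function.update α x (na + 1)) β := by
  have hA : ∀ i, i < na → Function.update A na x i = A i := fun i hi =>
    Function.update_of_ne (by omega) _ _
  have LA : ∀ i, i < na → L (A i) := fun i hi => (h.mem _).2 (.inl ⟨i, hi, rfl⟩)
  have LB : ∀ i, i < nb → L (B i) := fun i hi => (h.mem _).2 (.inr ⟨i, hi, rfl⟩)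
  have lt_x : ∀ i, i < na → p (A i) < p x := fun i hi =>
    (h.lt_iff hp h' hx hL hE hi).1 (by omega)
  have not_le : ∀ y, L y → ¬ p x ≤ p y := fun y hy hle => hL (h.lower y x hy hx hle)
  constructor
  · refine ⟨fun y => ?_, ?_, ?_, ?_, h.B_lt, ?_, ?_, h.β_le, ?_, ?_⟩
    · rw [h.mem y]
      constructor
      · rintro ((⟨i, hi, rfl⟩ | hB) | rfl)
        · exact .inl ⟨i, by omega, hA i hi⟩
        · exact .inr hB
        · exact .inl ⟨na, by omega, Function.update_self ..⟩
      · rintro (⟨i, hi, rfl⟩ | hB)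
        · rcases Nat.lt_succ_iff_lt_or_eq.1 hi with hi | rfl
          · exact .inl (.inl ⟨i, hi, (hA i hi).symm⟩)
          · exact .inr (Function.update_self ..)
        · exact .inl (.inr hB)
    · rintro y (hy | rfl)
      · exact h.lt y hy
      · exact hx
    · rintro y z (hy | rfl) hz hle
      · exact .inl (h.lower y z hy hz hle)
      · rcases hle.lt_or_eq with hlt | he
        · exact .inl (h.lower_of_lt hp h' hx hE hz hlt)
        · exact .inr (hp.inj _ _ hz hx he)
    · intro i j hij hj
      rcases Nat.lt_succ_iff_lt_or_eq.1 hj with hj | rfl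
      · rw [hA i (by omega), hA j hj]
        exact h.A_lt i j hij hj
      · rw [hA i hij, Function.update_self]
        exact lt_x i hij
    · intro i j hi hj
      rcases Nat.lt_succ_iff_lt_or_eq.1 hi with hi | rfl
      · rw [hA i hi]
        exact h.ne i j hi hj
      · rw [Function.update_self]
        rintro rfl
        exact hL (LB j hj)
    · intro y hy
      by_cases hyx : y = x
      · rw [hyx, Function.update_self]
      · rw [Function.update_of_ne hyx]
        exact (h.α_le y hy).trans (Nat.le_succ _)
    · intro y hy i hi
      by_cases hyx : y = x
      · subst hyx
        rw [Function.update_self]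
        refine iff_of_true hi ?_
        rcases Nat.lt_succ_iff_lt_or_eq.1 hi with hi | rfl
        · rw [hA i hi]
          exact (lt_x i hi).le
        · rw [Function.update_self]
      · have hy : L y := hy.resolve_right hyx
        rw [Function.update_of_ne hyx]
        rcases Nat.lt_succ_iff_lt_or_eq.1 hi with hi | rfl
        · rw [hA i hi]
          exact h.α_iff y hy i hi
        · rw [Function.update_self]
          exact iff_of_false (by have := h.α_le y (h.lt y hy); omega) (not_le y hy)
    · intro y hy i hi
      rcases hy with hy | rfl
      · exact h.β_iff y hy i hi
      · rw [h.swap.lt_iff hp h'.swap hx hL hE hi]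
        refine ⟨le_of_lt, fun hle => hle.lt_of_ne fun he => hL ?_⟩
        rw [← hp.inj _ _ (h.lt _ (LB i hi)) hx he]
        exact LB i hi
  · refine ⟨fun y z hyz => ⟨(h'.E_cov y z hyz).1, .inl (h'.E_cov y z hyz).2⟩, ?_, ?_, ?_⟩
    · rintro y z (hz | rfl) hyz
      · exact h'.placed y z hz hyz
      · exact hE y hyz
    · intro y hy hyL i hi
      rw [not_or] at hyL
      rw [Function.update_of_ne hyL.2]
      rcases Nat.lt_succ_iff_lt_or_eq.1 hi with hi | rfl
      · rw [hA i hi]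
        exact h'.α_iff y hy hyL.1 i hi
      · rw [Function.update_self]
        refine iff_of_false (by have := h.α_le y hy; omega) ?_
        rintro ⟨z, hz, hle⟩
        exact not_le z (h'.E_cov z y hz).2 hle
    · intro y hy hyL i hi
      rw [not_or] at hyL
      exact h'.β_iff y hy hyL.1 i hi

/-- Release a covering pair. -/
theorem Chains.relax (h : Chains n p L na nb A B α β)
    (h' : Pending n p L E na nb A B α β) {x u : ℕ} (hx : L x) (hu : ¬ L u)
    (hc : LabelCov n p x u) :
    Chains n p L na nb A B (Function.update α u (max (α u) (α x)))
        (Function.update β u (max (β u) (β x))) ∧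
      Pending n p L (fun y z => E y z ∨ y = x ∧ z = u) na nb A B
        (Function.update α u (max (α u) (α x))) (Function.update β u (max (β u) (β x))) := by
  constructor
  · refine ⟨h.mem, h.lt, h.lower, h.A_lt, h.B_lt, h.ne, fun y hy => ?_, fun y hy => ?_,
      fun y hy => ?_, fun y hy => ?_⟩
    · by_cases hyu : y = u
      · rw [hyu, Function.update_self]
        exact max_le (h.α_le u hc.2.1) (h.α_le x hc.1)
      · rw [Function.update_of_ne hyu]
        exact h.α_le y hy
    · by_cases hyu : y = u
      · rw [hyu, Function.update_self]
        exact max_le (h.β_le u hc.2.1) (h.β_le x hc.1)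
      · rw [Function.update_of_ne hyu]
        exact h.β_le y hy
    · rw [Function.update_of_ne (by rintro rfl; exact hu hy)]
      exact h.α_iff y hy
    · rw [Function.update_of_ne (by rintro rfl; exact hu hy)]
      exact h.β_iff y hy
  · refine ⟨?_, fun y z hz hyz => .inl (h'.placed y z hz hyz), fun y hy hyL i hi => ?_,
      fun y hy hyL i hi => ?_⟩
    · rintro y z (hyz | ⟨rfl, rfl⟩)
      · exact h'.E_cov y z hyz
      · exact ⟨hc, hx⟩
    · by_cases hyu : y = u
      · subst hyu
        rw [Function.update_self, lt_max_iff, h'.α_iff y hy hyL i hi, h.α_iff x hx i hi]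
        constructor
        · rintro (⟨z, hz, hle⟩ | hle)
          · exact ⟨z, .inl hz, hle⟩
          · exact ⟨x, .inr ⟨rfl, rfl⟩, hle⟩
        · rintro ⟨z, hz | ⟨rfl, -⟩, hle⟩
          · exact .inl ⟨z, hz, hle⟩
          · exact .inr hle
      · rw [Function.update_of_ne hyu, h'.α_iff y hy hyL i hi]
        simp [hyu]
    · by_cases hyu : y = u
      · subst hyu
        rw [Function.update_self, lt_max_iff, h'.β_iff y hy hyL i hi, h.β_iff x hx i hi]
        constructor
        · rintro (⟨z, hz, hle⟩ | hle)
          · exact ⟨z, .inl hz, hle⟩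
          · exact ⟨x, .inr ⟨rfl, rfl⟩, hle⟩
        · rintro ⟨z, hz | ⟨rfl, -⟩, hle⟩
          · exact .inl ⟨z, hz, hle⟩
          · exact .inr hle
      · rw [Function.update_of_ne hyu, h'.β_iff y hy hyL i hi]
        simp [hyu]

/-- `Q 0, …, Q (t - 1)` lists the labels all of whose lower covers have been released, and `rem`
counts the lower covers that have not. -/
structure Queue (n : ℕ) (p : ℕ → P) (E : ℕ → ℕ → Prop) (Q rem : ℕ → ℕ) (t : ℕ) : Prop where
  lt : ∀ i, i < t → Q i < n
  inj : ∀ i j, i < t → j < t → Q i = Q j → i = j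
  mem : ∀ y, y < n → ((∃ i, i < t ∧ Q i = y) ↔ ∀ x, LabelCov n p x y → E x y)
  rem_eq : ∀ y, y < n → rem y = {x | LabelCov n p x y ∧ ¬ E x y}.ncard

theorem Queue.t_le {Q rem : ℕ → ℕ} {t : ℕ} (h : Queue n p E Q rem t) : t ≤ n := by
  have := Finset.card_le_card_of_injOn (s := Finset.range t) (t := Finset.range n) Q
    (fun i hi => by simpa using h.lt i (by simpa using hi))
    (fun i hi j hj he => h.inj i j (by simpa using hi) (by simpa using hj) he)
  simpa using this

theorem labelCov_finite (y : ℕ) : {x | LabelCov n p x y ∧ ¬ E x y}.Finite :=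
  (Set.finite_Iio n).subset fun _ hx => hx.1.1

theorem Queue.relax_rem {Q rem : ℕ → ℕ} {t x u : ℕ} (h : Queue n p E Q rem t)
    (hc : LabelCov n p x u) (hE : ¬ E x u) :
    (∀ y, y < n → Function.update rem u (rem u - 1) y =
        {z | LabelCov n p z y ∧ ¬ (E z y ∨ z = x ∧ y = u)}.ncard) ∧
      (Function.update rem u (rem u - 1) u = 0 ↔
        ∀ z, LabelCov n p z u → E z u ∨ z = x ∧ u = u) := by
  have hset : {z | LabelCov n p z u ∧ ¬ (E z u ∨ z = x ∧ u = u)} =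
      {z | LabelCov n p z u ∧ ¬ E z u} \ {x} := by
    ext z
    simp only [Set.mem_ofPred_eq, Set.mem_sdiff, Set.mem_singleton_iff]
    tauto
  have hval : Function.update rem u (rem u - 1) u =
      {z | LabelCov n p z u ∧ ¬ (E z u ∨ z = x ∧ u = u)}.ncard := by
    rw [Function.update_self, h.rem_eq u hc.2.1, hset,
      Set.ncard_sdiff_singleton_of_mem (show x ∈ {z | LabelCov n p z u ∧ ¬ E z u} from ⟨hc, hE⟩)]
  refine ⟨fun y hy => ?_, ?_⟩
  · by_cases hyu : y = u
    · subst hyu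
      exact hval
    · rw [Function.update_of_ne hyu, h.rem_eq y hy]
      simp [hyu]
  · rw [hval, Set.ncard_eq_zero (hset ▸ (labelCov_finite u).subset Set.sdiff_subset)]
    rw [Set.eq_empty_iff_forall_notMem]
    simp only [Set.mem_ofPred_eq, not_and, not_not]

/-- The label `u` is new in the queue, since a queued label has all its lower covers released and
the pair `(x, u)` was not. -/
theorem Queue.relax_push {Q rem : ℕ → ℕ} {t x u : ℕ} (h : Queue n p E Q rem t)
    (hc : LabelCov n p x u) (hE : ¬ E x u) (h0 : Function.update rem u (rem u - 1) u = 0) :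
    Queue n p (fun y z => E y z ∨ y = x ∧ z = u) (Function.update Q t u)
      (Function.update rem u (rem u - 1)) (t + 1) := by
  obtain ⟨h1, h2⟩ := h.relax_rem hc hE
  have hQ : ∀ i, i < t → Function.update Q t u i = Q i := fun i hi =>
    Function.update_of_ne (by omega) _ _
  have hnot : ∀ i, i < t → Q i ≠ u := fun i hi he => hE ((h.mem u hc.2.1).1 ⟨i, hi, he⟩ x hc)
  refine ⟨fun i hi => ?_, fun i j hi hj he => ?_, fun y hy => ?_, h1⟩
  · rcases Nat.lt_succ_iff_lt_or_eq.1 hi with hi | rfl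
    · rw [hQ i hi]
      exact h.lt i hi
    · rw [Function.update_self]
      exact hc.2.1
  · rcases Nat.lt_succ_iff_lt_or_eq.1 hi with hi | rfl
    · rcases Nat.lt_succ_iff_lt_or_eq.1 hj with hj | rfl
      · rw [hQ i hi, hQ j hj] at he
        exact h.inj i j hi hj he
      · rw [hQ i hi, Function.update_self] at he
        exact absurd he (hnot i hi)
    · rcases Nat.lt_succ_iff_lt_or_eq.1 hj with hj | rfl
      · rw [hQ j hj, Function.update_self] at he
        exact absurd he.symm (hnot j hj)
      · rfl
  · by_cases hyu : y = u
    · subst hyu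
      exact iff_of_true ⟨t, by omega, Function.update_self ..⟩ (h2.1 h0)
    · simp only [hyu, and_false, or_false]
      rw [← h.mem y hy]
      constructor
      · rintro ⟨i, hi, he⟩
        rcases Nat.lt_succ_iff_lt_or_eq.1 hi with hi | rfl
        · exact ⟨i, hi, by rw [← he, hQ i hi]⟩
        · rw [Function.update_self] at he
          exact absurd he.symm hyu
      · rintro ⟨i, hi, he⟩
        exact ⟨i, by omega, by rw [hQ i hi, he]⟩

theorem Queue.relax_skip {Q rem : ℕ → ℕ} {t x u : ℕ} (h : Queue n p E Q rem t)
    (hc : LabelCov n p x u) (hE : ¬ E x u) (h0 : Function.update rem u (rem u - 1) u ≠ 0) :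
    Queue n p (fun y z => E y z ∨ y = x ∧ z = u) Q
      (Function.update rem u (rem u - 1)) t := by
  obtain ⟨h1, h2⟩ := h.relax_rem hc hE
  refine ⟨h.lt, h.inj, fun y hy => ?_, h1⟩
  by_cases hyu : y = u
  · subst hyu
    refine iff_of_false ?_ fun hall => h0 (h2.2 hall)
    rintro ⟨i, hi, he⟩
    exact hE ((h.mem y hy).1 ⟨i, hi, he⟩ x hc)
  · simp only [hyu, and_false, or_false]
    exact h.mem y hy

/-- The state between two levels: the labels `Q 0, …, Q (h - 1)` have been placed, and
`Q h, …, Q (t - 1)` are the minimal elements of the rest. -/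
structure LevelInv (n : ℕ) (p : ℕ → P) (na nb : ℕ) (A B α β Q rem : ℕ → ℕ) (h t : ℕ) : Prop where
  le : h ≤ t
  count : na + nb = h
  chains : Chains n p (fun x => ∃ i, i < h ∧ Q i = x) na nb A B α β
  pending : Pending n p (fun x => ∃ i, i < h ∧ Q i = x)
    (fun x y => LabelCov n p x y ∧ ∃ i, i < h ∧ Q i = x) na nb A B α β
  queue : Queue n p (fun x y => LabelCov n p x y ∧ ∃ i, i < h ∧ Q i = x) Q rem t
  tops : ∀ i, h ≤ i → i < t → h = 0 ∨ (0 < na ∧ p (A (na - 1)) < p (Q i)) ∨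
    (0 < nb ∧ p (B (nb - 1)) < p (Q i))

/-- A level has been placed: its labels are the last elements of the chains. -/
structure PlacedInv (n : ℕ) (p : ℕ → P) (na nb : ℕ) (A B α β Q rem : ℕ → ℕ) (h t : ℕ) :
    Prop where
  count : na + nb = t
  chains : Chains n p (fun x => ∃ i, i < t ∧ Q i = x) na nb A B α β
  pending : Pending n p (fun x => ∃ i, i < t ∧ Q i = x)
    (fun x y => LabelCov n p x y ∧ ∃ i, i < h ∧ Q i = x) na nb A B α β
  queue : Queue n p (fun x y => LabelCov n p x y ∧ ∃ i, i < h ∧ Q i = x) Q rem t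
  last : ∀ i, h ≤ i → i < t → (0 < na ∧ A (na - 1) = Q i) ∨ (0 < nb ∧ B (nb - 1) = Q i)

namespace LevelInv

variable {Q rem : ℕ → ℕ} {h t : ℕ}

theorem swap (hI : LevelInv n p na nb A B α β Q rem h t) :
    LevelInv n p nb na B A β α Q rem h t :=
  ⟨hI.le, by have := hI.count; omega, hI.chains.swap, hI.pending.swap, hI.queue,
    fun i h1 h2 => (hI.tops i h1 h2).imp id Or.symm⟩

theorem notMem (hI : LevelInv n p na nb A B α β Q rem h t) {i : ℕ} (h1 : h ≤ i) (h2 : i < t) :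
    ¬ ∃ j, j < h ∧ Q j = Q i := by
  rintro ⟨j, hj, he⟩
  have := hI.queue.inj j i (by omega) h2 he
  omega

theorem released (hI : LevelInv n p na nb A B α β Q rem h t) {i : ℕ} (h2 : i < t) :
    ∀ z, LabelCov n p z (Q i) → LabelCov n p z (Q i) ∧ ∃ j, j < h ∧ Q j = z :=
  (hI.queue.mem _ (hI.queue.lt i h2)).1 ⟨i, h2, rfl⟩

/-- For `Q i` to be above a whole chain it suffices that it is above the last element, and an empty
chain imposes nothing. The equality is the test by which the program recognizes that a label can be
appended. -/
theorem α_eq [Fintype P] (hp : Labelling n p) (hI : LevelInv n p na nb A B α β Q rem h t) {i : ℕ}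
    (h1 : h ≤ i) (h2 : i < t) (hlt : 0 < na → p (A (na - 1)) < p (Q i)) : α (Q i) = na := by
  rcases Nat.eq_zero_or_pos na with h0 | h0
  · have := hI.chains.α_le _ (hI.queue.lt i h2)
    omega
  · have := (hI.chains.lt_iff hp hI.pending (hI.queue.lt i h2) (hI.notMem h1 h2)
      (hI.released h2) (i := na - 1) (by omega)).2 (hlt h0)
    have := hI.chains.α_le _ (hI.queue.lt i h2)
    omega

/-- Everything strictly below a queued label has been placed, so an unplaced label is not below
another queued one. In particular the unplaced queued labels form an antichain, which bounds their
number by two. -/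
theorem not_le [Fintype P] (hp : Labelling n p) (hI : LevelInv n p na nb A B α β Q rem h t)
    {i j : ℕ} (h1 : h ≤ i) (h2 : i < t) (h3 : j < t) (hij : i ≠ j) : ¬ p (Q i) ≤ p (Q j) := by
  intro hle
  have hne : p (Q i) ≠ p (Q j) := fun he =>
    hij (hI.queue.inj i j h2 h3 (hp.inj _ _ (hI.queue.lt i h2) (hI.queue.lt j h3) he))
  exact hI.notMem h1 h2 (hI.chains.lower_of_lt hp hI.pending (hI.queue.lt j h3)
    (hI.released h3) (hI.queue.lt i h2) (hle.lt_of_ne hne))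

theorem size_le [Fintype P] (hp : Labelling n p) (hw : NoThreeAntichain P)
    (hI : LevelInv n p na nb A B α β Q rem h t) : t ≤ h + 2 := by
  by_contra hc
  refine hw (p (Q h)) (p (Q (h + 1))) (p (Q (h + 2))) ?_ ?_ ?_ ?_ ?_ ?_ <;>
    exact hI.not_le hp (by omega) (by omega) (by omega) (by omega)

theorem single [Fintype P] (hp : Labelling n p) (hI : LevelInv n p na nb A B α β Q rem h t)
    (ht : t = h + 1) : α (Q h) = na ∨ β (Q h) = nb := by
  rcases hI.tops h le_rfl (by omega) with h0 | h0 | h0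
  · have := hI.chains.α_le _ (hI.queue.lt h (by omega))
    have := hI.count
    omega
  · exact .inl (hI.α_eq hp le_rfl (by omega) fun _ => h0.2)
  · exact .inr (hI.swap.α_eq hp le_rfl (by omega) fun _ => h0.2)

/-- The last element of a chain lies below one of two incomparable minimal elements. -/
theorem top_lt [Fintype P] (hp : Labelling n p) (hw : NoThreeAntichain P)
    (hI : LevelInv n p na nb A B α β Q rem h t) (ht : t = h + 2) (ha : 0 < na) :
    p (A (na - 1)) < p (Q h) ∨ p (A (na - 1)) < p (Q (h + 1)) := by
  have hL := (hI.chains.mem (A (na - 1))).2 (.inl ⟨na - 1, by omega, rfl⟩)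
  have key : ∀ i, h ≤ i → i < t → ¬ p (Q i) ≤ p (A (na - 1)) := fun i h1 h2 hle =>
    hI.notMem h1 h2 (hI.chains.lower _ _ hL (hI.queue.lt i h2) hle)
  by_contra! hc
  have key' : ∀ i, h ≤ i → i < t → ¬ p (A (na - 1)) < p (Q i) →
      ¬ p (A (na - 1)) ≤ p (Q i) := fun i h1 h2 hn hle =>
    hn (lt_of_le_not_ge hle (key i h1 h2))
  exact hw (p (A (na - 1))) (p (Q h)) (p (Q (h + 1))) (key' h le_rfl (by omega) hc.1)
    (key h le_rfl (by omega)) (key' (h + 1) (by omega) (by omega) hc.2)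
    (key (h + 1) (by omega) (by omega)) (hI.not_le hp le_rfl (by omega) (by omega) (by omega))
    (hI.not_le hp (by omega) (by omega) (by omega) (by omega))

/-- Join a minimal element to a chain end if it is above it. Each of the two elements has a
neighbour by `tops`, and each chain end has one by `top_lt`. A bipartite graph on two and two
vertices without isolated vertices has a perfect matching. Empty chains accept any element. -/
theorem pair [Fintype P] (hp : Labelling n p) (hw : NoThreeAntichain P)
    (hI : LevelInv n p na nb A B α β Q rem h t) (ht : t = h + 2) :
    (α (Q h) = na ∧ β (Q (h + 1)) = nb) ∨ (β (Q h) = nb ∧ α (Q (h + 1)) = na) := by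
  have t0 := hI.tops h le_rfl (by omega)
  have t1 := hI.tops (h + 1) (by omega) (by omega)
  have a0 := hI.α_eq hp (i := h) le_rfl (by omega)
  have a1 := hI.α_eq hp (i := h + 1) (by omega) (by omega)
  have b0 := hI.swap.α_eq hp (i := h) le_rfl (by omega)
  have b1 := hI.swap.α_eq hp (i := h + 1) (by omega) (by omega)
  have c := hI.count
  have ta := hI.top_lt hp hw ht
  have tb := hI.swap.top_lt hp hw ht
  by_cases x0 : p (A (na - 1)) < p (Q h) <;> by_cases x1 : p (A (na - 1)) < p (Q (h + 1)) <;>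
    by_cases y0 : p (B (nb - 1)) < p (Q h) <;> by_cases y1 : p (B (nb - 1)) < p (Q (h + 1)) <;>
    simp only [x0, x1, y0, y1, forall_const, implies_true, or_false, false_or, or_true, and_false,
      and_true, or_self, imp_false, not_lt, Nat.le_zero] at * <;> omega

end LevelInv

end Chains

/-! ### Placing a level and releasing its covering pairs -/

section Levels

variable {P : Type u} [PartialOrder P] {n : ℕ} {p : ℕ → P} {na nb : ℕ}
  {A B α β Q rem : ℕ → ℕ} {h t l c : ℕ}

theorem PlacedInv.swap (hI : PlacedInv n p na nb A B α β Q rem h t) :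
    PlacedInv n p nb na B A β α Q rem h t :=
  ⟨by have := hI.count; omega, hI.chains.swap, hI.pending.swap, hI.queue,
    fun i h1 h2 => (hI.last i h1 h2).symm⟩

theorem LevelInv.place_one [Fintype P] (hp : Labelling n p)
    (hI : LevelInv n p na nb A B α β Q rem h t) (ht : t = h + 1) (hα : α (Q h) = na) :
    PlacedInv n p (na + 1) nb (Function.update A na (Q h)) B
      (Function.update α (Q h) (na + 1)) β Q rem h t := by
  subst ht
  have hL : (fun y => (∃ i, i < h ∧ Q i = y) ∨ y = Q h) = fun y => ∃ i, i < h + 1 ∧ Q i = y := by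
    funext y
    simp only [eq_iff_iff, Nat.lt_succ_iff_lt_or_eq, or_and_right, exists_or, exists_eq_left]
    exact or_congr Iff.rfl eq_comm
  obtain ⟨h1, h2⟩ := hI.chains.place hp hI.pending (hI.queue.lt h (by omega))
    (hI.notMem le_rfl (by omega)) (hI.released (by omega)) hα
  rw [hL] at h1 h2
  refine ⟨by have := hI.count; omega, h1, h2, hI.queue, fun i hi hi' => ?_⟩
  obtain rfl : i = h := by omega
  simp

theorem LevelInv.place_two [Fintype P] (hp : Labelling n p)
    (hI : LevelInv n p na nb A B α β Q rem h t) (ht : t = h + 2) {i j : ℕ} (hi : h ≤ i)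
    (hi' : i < t) (hj : h ≤ j) (hj' : j < t) (hij : i ≠ j) (hα : α (Q i) = na)
    (hβ : β (Q j) = nb) :
    PlacedInv n p (na + 1) (nb + 1) (Function.update A na (Q i)) (Function.update B nb (Q j))
      (Function.update α (Q i) (na + 1)) (Function.update β (Q j) (nb + 1)) Q rem h t := by
  have hL : (fun y => ((∃ i, i < h ∧ Q i = y) ∨ y = Q i) ∨ y = Q j) =
      fun y => ∃ i, i < t ∧ Q i = y := by
    funext y
    apply propext
    constructor
    · rintro ((⟨k, hk, rfl⟩ | rfl) | rfl)
      · exact ⟨k, by omega, rfl⟩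
      · exact ⟨i, by omega, rfl⟩
      · exact ⟨j, by omega, rfl⟩
    · rintro ⟨k, hk, rfl⟩
      by_cases h1 : k < h
      · exact .inl (.inl ⟨k, h1, rfl⟩)
      · by_cases h2 : k = i
        · exact .inl (.inr (by rw [h2]))
        · exact .inr (by rw [show k = j by omega])
  obtain ⟨h1, h2⟩ := hI.chains.place hp hI.pending (hI.queue.lt i hi')
    (hI.notMem hi hi') (hI.released hi') hα
  have hji : Q j ≠ Q i := fun he => hij (hI.queue.inj i j hi' hj' he.symm)
  obtain ⟨h3, h4⟩ := h1.swap.place hp h2.swap (hI.queue.lt j hj')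
    (by rintro (hm | hm); exacts [hI.notMem hj hj' hm, hji hm]) (hI.released hj') hβ
  rw [hL] at h3 h4
  refine ⟨by have := hI.count; omega, h3.swap, h4.swap, hI.queue, fun k hk hk' => ?_⟩
  by_cases h2 : k = i
  · exact .inl ⟨by omega, by simp [h2]⟩
  · exact .inr ⟨by omega, by simp [show k = j by omega]⟩

/-- `up 0 x, …, up (cnt x - 1) x` are the upper covers of `x`. -/
structure UpperCovers (n : ℕ) (p : ℕ → P) (cnt : ℕ → ℕ) (up : ℕ → ℕ → ℕ) : Prop where
  cov : ∀ x y, x < n → (LabelCov n p x y ↔ ∃ c, c < cnt x ∧ up c x = y)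
  inj : ∀ x c c', x < n → c < cnt x → c' < cnt x → up c x = up c' x → c = c'
  le_two : ∀ x, x < n → cnt x ≤ 2

/-- The covering pairs released when the labels `Q 0, …, Q (h - 1)` and the first `c` upper covers
of `Q h` have been treated. -/
def ReleasedPair (n : ℕ) (p : ℕ → P) (up : ℕ → ℕ → ℕ) (Q : ℕ → ℕ) (h c l : ℕ) (x y : ℕ) : Prop :=
  LabelCov n p x y ∧ ((∃ i, i < h ∧ Q i = x) ∨ h < l ∧ Q h = x ∧ ∃ d, d < c ∧ up d x = y)

/-- The state while the covering pairs above the level `Q h₀, …, Q (l - 1)` are released. -/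
structure ReleaseInv (n : ℕ) (p : ℕ → P) (up : ℕ → ℕ → ℕ) (na nb : ℕ) (A B α β Q rem : ℕ → ℕ)
    (h₀ h c l t : ℕ) : Prop where
  count : na + nb = l
  le : h₀ ≤ h
  le' : h ≤ l
  le'' : l ≤ t
  chains : Chains n p (fun x => ∃ i, i < l ∧ Q i = x) na nb A B α β
  pending : Pending n p (fun x => ∃ i, i < l ∧ Q i = x) (ReleasedPair n p up Q h c l)
    na nb A B α β
  queue : Queue n p (ReleasedPair n p up Q h c l) Q rem t
  last : ∀ i, h₀ ≤ i → i < l → (0 < na ∧ A (na - 1) = Q i) ∨ (0 < nb ∧ B (nb - 1) = Q i)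
  fresh : ∀ i, l ≤ i → i < t → ∃ j, h₀ ≤ j ∧ j < l ∧ LabelCov n p (Q j) (Q i)

variable {up : ℕ → ℕ → ℕ} {cnt : ℕ → ℕ} {h₀ : ℕ}

theorem PlacedInv.release (hI : PlacedInv n p na nb A B α β Q rem h t) (hh : h ≤ t) :
    ReleaseInv n p up na nb A B α β Q rem h h 0 t t := by
  have hE : (fun x y => LabelCov n p x y ∧ ∃ i, i < h ∧ Q i = x) =
      ReleasedPair n p up Q h 0 t := by
    funext x y
    simp [ReleasedPair]
  refine ⟨hI.count, le_rfl, hh, le_rfl, hI.chains, hE ▸ hI.pending, hE ▸ hI.queue, hI.last,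
    fun i h1 h2 => absurd h1 (by omega)⟩

theorem ReleaseInv.next (hu : UpperCovers n p cnt up)
    (hI : ReleaseInv n p up na nb A B α β Q rem h₀ h c l t) (hl : h < l) (hc : cnt (Q h) ≤ c) :
    ReleaseInv n p up na nb A B α β Q rem h₀ (h + 1) 0 l t := by
  have hQ := hI.queue.lt h (hl.trans_le hI.le'')
  have hE : ReleasedPair n p up Q h c l = ReleasedPair n p up Q (h + 1) 0 l := by
    funext x y
    apply propext
    refine and_congr_right fun hxy => ?_
    simp only [Nat.not_lt_zero, false_and, exists_false, and_false, or_false]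
    constructor
    · rintro (⟨i, hi, rfl⟩ | ⟨-, rfl, -⟩)
      · exact ⟨i, by omega, rfl⟩
      · exact ⟨h, by omega, rfl⟩
    · rintro ⟨i, hi, rfl⟩
      rcases Nat.lt_succ_iff_lt_or_eq.1 hi with hi | rfl
      · exact .inl ⟨i, hi, rfl⟩
      · obtain ⟨d, hd, hd'⟩ := (hu.cov _ _ hQ).1 hxy
        exact .inr ⟨hl, rfl, d, by omega, hd'⟩
  exact ⟨hI.count, hI.le.trans (Nat.le_succ _), hl, hI.le'', hI.chains, hE ▸ hI.pending,
    hE ▸ hI.queue, hI.last, hI.fresh⟩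

/-- A label that became minimal covers a label of the level just placed, and these labels are now
ends of chains; this restores `tops`. With `h = l` no label is partly treated, so the value of `c`
is irrelevant. -/
theorem ReleaseInv.level (hI : ReleaseInv n p up na nb A B α β Q rem h₀ l c l t) :
    LevelInv n p na nb A B α β Q rem l t := by
  have hE : ReleasedPair n p up Q l c l =
      fun x y => LabelCov n p x y ∧ ∃ i, i < l ∧ Q i = x := by
    funext x y
    simp [ReleasedPair]
  refine ⟨hI.le'', hI.count, hI.chains, hE ▸ hI.pending, hE ▸ hI.queue, fun i h1 h2 => .inr ?_⟩
  obtain ⟨j, hj, hj', hc⟩ := hI.fresh i h1 h2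
  rcases hI.last j hj hj' with ⟨h0, he⟩ | ⟨h0, he⟩
  · exact .inl ⟨h0, he ▸ hc.2.2.lt⟩
  · exact .inr ⟨h0, he ▸ hc.2.2.lt⟩

theorem ReleaseInv.relax (hu : UpperCovers n p cnt up)
    (hI : ReleaseInv n p up na nb A B α β Q rem h₀ h c l t) (hl : h < l) (hc : c < cnt (Q h))
    {u : ℕ} (hx : up c (Q h) = u) :
    (Function.update rem u (rem u - 1) u = 0 →
      ReleaseInv n p up na nb A B (Function.update α u (max (α u) (α (Q h))))
        (Function.update β u (max (β u) (β (Q h)))) (Function.update Q t u)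
        (Function.update rem u (rem u - 1)) h₀ h (c + 1) l (t + 1)) ∧
    (Function.update rem u (rem u - 1) u ≠ 0 →
      ReleaseInv n p up na nb A B (Function.update α u (max (α u) (α (Q h))))
        (Function.update β u (max (β u) (β (Q h)))) Q
        (Function.update rem u (rem u - 1)) h₀ h (c + 1) l t) := by
  have ht := hI.le''
  have hQ := hI.queue.lt h (hl.trans_le ht)
  have hcov : LabelCov n p (Q h) u := (hu.cov _ _ hQ).2 ⟨c, hc, hx⟩
  have hnE : ¬ ReleasedPair n p up Q h c l (Q h) u := by
    rintro ⟨-, ⟨i, hi, he⟩ | ⟨-, -, d, hd, hd'⟩⟩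
    · have := hI.queue.inj i h (by omega) (by omega) he
      omega
    · have := hu.inj _ _ _ hQ (hd.trans hc) hc (hd'.trans hx.symm)
      omega
  -- A placed label belongs to the queue, so all its lower covers were released, but the pair under
  -- treatment was not.
  have hnL : ¬ ∃ i, i < l ∧ Q i = u := by
    rintro ⟨i, hi, he⟩
    exact hnE ((hI.queue.mem u hcov.2.1).1 ⟨i, by omega, he⟩ _ hcov)
  have hE : (fun y z => ReleasedPair n p up Q h c l y z ∨ y = Q h ∧ z = u) =
      ReleasedPair n p up Q h (c + 1) l := by
    funext y z
    apply propext
    constructor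
    · rintro (⟨h1, h2 | ⟨h2, h3, d, hd, h4⟩⟩ | ⟨rfl, rfl⟩)
      · exact ⟨h1, .inl h2⟩
      · exact ⟨h1, .inr ⟨h2, h3, d, by omega, h4⟩⟩
      · exact ⟨hcov, .inr ⟨hl, rfl, c, by omega, hx⟩⟩
    · rintro ⟨h1, h2 | ⟨h2, rfl, d, hd, h4⟩⟩
      · exact .inl ⟨h1, .inl h2⟩
      · rcases Nat.lt_succ_iff_lt_or_eq.1 hd with hd | rfl
        · exact .inl ⟨h1, .inr ⟨h2, rfl, d, hd, h4⟩⟩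
        · exact .inr ⟨rfl, h4.symm.trans hx⟩
  obtain ⟨h1, h2⟩ := hI.chains.relax hI.pending ⟨h, hl, rfl⟩ hnL hcov
  rw [hE] at h2
  constructor
  · intro h0
    have h3 := hI.queue.relax_push hcov hnE h0
    rw [hE] at h3
    have hQ' : ∀ i, i < t → Function.update Q t u i = Q i := fun i hi =>
      Function.update_of_ne (by omega) _ _
    have hL' : (fun x => ∃ i, i < l ∧ Function.update Q t u i = x) =
        fun x => ∃ i, i < l ∧ Q i = x := by
      funext x
      refine propext (exists_congr fun i => and_congr_right fun hi => ?_)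
      rw [hQ' i (by omega)]
    have hE' : ReleasedPair n p up (Function.update Q t u) h (c + 1) l =
        ReleasedPair n p up Q h (c + 1) l := by
      funext y z
      simp only [ReleasedPair, hQ' h (by omega)]
      refine propext (and_congr_right fun _ => or_congr (exists_congr fun i =>
        and_congr_right fun hi => ?_) Iff.rfl)
      rw [hQ' i (by omega)]
    refine ⟨hI.count, hI.le, hI.le', by omega, hL'.symm ▸ h1, ?_, hE'.symm ▸ h3,
      fun i hi hi' => ?_, fun i hi hi' => ?_⟩
    · rw [hL', hE']
      exact h2
    · rw [hQ' i (by omega)]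
      exact hI.last i hi hi'
    · rcases Nat.lt_succ_iff_lt_or_eq.1 hi' with hi' | rfl
      · obtain ⟨j, hj, hj', hc'⟩ := hI.fresh i hi hi'
        refine ⟨j, hj, hj', ?_⟩
        rw [hQ' i hi', hQ' j (by omega)]
        exact hc'
      · refine ⟨h, hI.le, hl, ?_⟩
        rw [hQ' h (by omega), Function.update_self]
        exact hcov
  · intro h0
    have h3 := hI.queue.relax_skip hcov hnE h0
    rw [hE] at h3
    exact ⟨hI.count, hI.le, hI.le', ht, h1, h2, h3, hI.last, hI.fresh⟩

/-- If labels remained, a minimal one among them would have all its lower covers placed and would be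
waiting in the queue, which is exhausted. -/
theorem LevelInv.all [Fintype P]
    (hI : LevelInv n p na nb A B α β Q rem h t) (hh : h = t) :
    na + nb = n ∧ Chains n p (fun x => x < n) na nb A B α β := by
  subst hh
  have hL : (fun x => ∃ i, i < h ∧ Q i = x) = fun x => x < n := by
    funext x
    refine propext ⟨fun hx => hI.chains.lt x hx, fun hx => ?_⟩
    by_contra hx'
    let Z : Set P := {a | ∃ x, x < n ∧ (¬ ∃ i, i < h ∧ Q i = x) ∧ p x = a}
    obtain ⟨m, hm⟩ := (Set.toFinite Z).exists_minimal ⟨p x, x, hx, hx', rfl⟩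
    obtain ⟨y, hy, hy', rfl⟩ := hm.1
    refine hy' ((hI.queue.mem y hy).2 fun z hz => ⟨hz, ?_⟩)
    by_contra hz'
    have hle := hm.2 (show p z ∈ Z from ⟨z, hz.1, hz', rfl⟩) hz.2.2.le
    exact hz.2.2.lt.not_ge hle
  refine ⟨?_, hL ▸ hI.chains⟩
  rw [hI.count]
  refine le_antisymm hI.queue.t_le ?_
  have := Finset.card_le_card_of_surjOn (s := Finset.range h) (t := Finset.range n) Q ?_
  · simpa using this
  · intro x hx
    have hx : x < n := by simpa using hx
    obtain ⟨i, hi, he⟩ := (congrFun hL x).mpr hx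
    exact ⟨i, by simpa using hi, he⟩

theorem LevelInv.init (hα : ∀ x, x < n → α x = 0) (hβ : ∀ x, x < n → β x = 0)
    (hrem : ∀ y, y < n → rem y = {x | LabelCov n p x y}.ncard)
    (hlt : ∀ i, i < t → Q i < n) (hinj : ∀ i j, i < t → j < t → Q i = Q j → i = j)
    (hmem : ∀ y, y < n → ((∃ i, i < t ∧ Q i = y) ↔ rem y = 0)) :
    LevelInv n p 0 0 A B α β Q rem 0 t := by
  have hfin : ∀ y, {x | LabelCov n p x y}.Finite := fun y =>
    (Set.finite_Iio n).subset fun x hx => hx.1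
  refine ⟨Nat.zero_le _, rfl, ?_, ?_, ?_, fun i _ _ => .inl rfl⟩
  · constructor <;> simp +contextual [hα, hβ]
  · constructor <;> simp +contextual
  · refine ⟨hlt, hinj, fun y hy => ?_, fun y hy => by simpa using hrem y hy⟩
    rw [hmem y hy, hrem y hy, Set.ncard_eq_zero (hfin y), Set.eq_empty_iff_forall_notMem]
    simp

end Levels

/-! ### The programs for the partition -/

/-- The relation `R` is represented by the successor lists `up 0 x, …, up (cnt x - 1) x` and the
in-degrees `rem y`. -/
structure Adjacency (R : ℕ → ℕ → Prop) (cnt : ℕ → ℕ) (up : ℕ → ℕ → ℕ) (rem : ℕ → ℕ) : Prop where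
  cov : ∀ x y, R x y ↔ ∃ c, c < cnt x ∧ up c x = y
  inj : ∀ x c c', c < cnt x → c' < cnt x → up c x = up c' x → c = c'
  le_two : ∀ x, cnt x ≤ 2
  fin : ∀ y, {x | R x y}.Finite
  rem_eq : ∀ y, rem y = {x | R x y}.ncard

/-- The function `up` with values `f` and `g` at `0` and `1`. -/
def twoArrays (f g : ℕ → ℕ) (c x : ℕ) : ℕ := if c = 0 then f x else g x

theorem Adjacency.insert {R : ℕ → ℕ → Prop} {cnt rem : ℕ → ℕ} {up up' : ℕ → ℕ → ℕ}
    (h : Adjacency R cnt up rem) {a b : ℕ} (hab : ¬ R a b) (hcnt : cnt a < 2)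
    (hup : ∀ c x, c < 2 → up' c x = if c = cnt a ∧ x = a then b else up c x) :
    Adjacency (fun x y => R x y ∨ x = a ∧ y = b) (Function.update cnt a (cnt a + 1)) up'
      (Function.update rem b (rem b + 1)) := by
  have hold : ∀ c x, c < cnt x → up' c x = up c x := fun c x hc => by
    rw [hup c x (by have := h.le_two x; omega), if_neg]
    rintro ⟨rfl, rfl⟩
    exact hc.false
  have hnew : up' (cnt a) a = b := by rw [hup _ _ hcnt, if_pos ⟨rfl, rfl⟩]
  have hset : {x | R x b ∨ x = a ∧ b = b} = Insert.insert a {x | R x b} := by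
    ext x
    simp [or_comm]
  refine ⟨fun x y => ?_, fun x c c' hc hc' he => ?_, fun x => ?_, fun y => ?_, fun y => ?_⟩
  · by_cases hx : x = a
    · subst hx
      rw [Function.update_self, h.cov]
      constructor
      · rintro (⟨c, hc, he⟩ | ⟨-, rfl⟩)
        · exact ⟨c, by omega, by rw [hold c _ hc, he]⟩
        · exact ⟨cnt x, by omega, hnew⟩
      · rintro ⟨c, hc, he⟩
        rcases Nat.lt_succ_iff_lt_or_eq.1 hc with hc | rfl
        · exact .inl ⟨c, hc, by rw [← hold c _ hc, he]⟩
        · exact .inr ⟨rfl, by rw [← he, hnew]⟩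
    · rw [Function.update_of_ne hx, h.cov]
      simp only [hx, false_and, or_false]
      exact exists_congr fun c => and_congr_right fun hc => by rw [hold c x hc]
  · by_cases hx : x = a
    · subst hx
      rw [Function.update_self] at hc hc'
      have key : ∀ c, c < cnt x → up' c x ≠ up' (cnt x) x := fun c hc he => by
        rw [hold c x hc, hnew] at he
        exact hab ((h.cov x b).2 ⟨c, hc, he⟩)
      rcases Nat.lt_succ_iff_lt_or_eq.1 hc with hc | rfl
      · rcases Nat.lt_succ_iff_lt_or_eq.1 hc' with hc' | rfl
        · rw [hold c x hc, hold c' x hc'] at he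
          exact h.inj x c c' hc hc' he
        · exact absurd he (key c hc)
      · rcases Nat.lt_succ_iff_lt_or_eq.1 hc' with hc' | rfl
        · exact absurd he.symm (key c' hc')
        · rfl
    · rw [Function.update_of_ne hx] at hc hc'
      rw [hold c x hc, hold c' x hc'] at he
      exact h.inj x c c' hc hc' he
  · by_cases hx : x = a
    · rw [hx, Function.update_self]
      omega
    · rw [Function.update_of_ne hx]
      exact h.le_two x
  · by_cases hy : y = b
    · subst hy
      rw [hset]
      exact (h.fin y).insert a
    · simpa [hy] using h.fin y
  · by_cases hy : y = b
    · subst hy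
      rw [hset, Function.update_self, Set.ncard_insert_of_notMem (s := {x | R x y}) hab (h.fin y), h.rem_eq]
    · simpa [hy] using h.rem_eq y

/-- Two recorded successors and the new one would be three distinct successors. This is what makes
two arrays enough for the upper covers. -/
theorem Adjacency.cnt_lt {R : ℕ → ℕ → Prop} {cnt rem : ℕ → ℕ} {up : ℕ → ℕ → ℕ}
    (h : Adjacency R cnt up rem) {a b : ℕ} (hab : ¬ R a b)
    (h3 : ∀ y z, R a y → R a z → y ≠ z → y ≠ b → z ≠ b → False) : cnt a < 2 := by
  by_contra hc
  have h0 : R a (up 0 a) := (h.cov _ _).2 ⟨0, by omega, rfl⟩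
  have h1 : R a (up 1 a) := (h.cov _ _).2 ⟨1, by omega, rfl⟩
  refine h3 _ _ h0 h1 (fun he => ?_) ?_ ?_
  · have := h.inj a 0 1 (by omega) (by omega) he
    omega
  · intro he
    exact hab (he ▸ h0)
  · intro he
    exact hab (he ▸ h1)

namespace RealRAM

/-- Read the covering pairs. -/
def parseProg : Prog :=
  .loop (.wlt (.var 47) (.var 1))
    (.setW 55 (.get 0 (.var 47)) ;; .setW 56 (.get 1 (.var 47)) ;;
      .cond (.weq (.get 2 (.var 55)) (.const 0)) (.putW 3 (.var 55) (.var 56))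
        (.putW 10 (.var 55) (.var 56)) ;;
      .putW 2 (.var 55) (.add (.get 2 (.var 55)) (.const 1)) ;;
      .putW 4 (.var 56) (.add (.get 4 (.var 56)) (.const 1)) ;; .inc 47)

theorem parseProg_wp {B n m : ℕ} {s : State} (hm : s.wvar 1 = m) (h47 : s.wvar 47 = 0)
    (h2 : s.warr 2 = 0) (h4 : s.warr 4 = 0) (hl : ∀ k, k < m → s.warr 0 k < n)
    (hu : ∀ k, k < m → s.warr 1 k < n)
    (hinj : ∀ k k', k < m → k' < m → s.warr 0 k = s.warr 0 k' → s.warr 1 k = s.warr 1 k' → k = k')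
    (h3 : ∀ x i j k, i < m → j < m → k < m → s.warr 0 i = x → s.warr 0 j = x → s.warr 0 k = x →
      s.warr 1 i ≠ s.warr 1 j → s.warr 1 i ≠ s.warr 1 k → s.warr 1 j ≠ s.warr 1 k → False)
    (hB : n + m + 3 ≤ B) :
    Wp B parseProg (100 * (m + 1))
      (fun s' => Adjacency (fun x y => ∃ k, k < m ∧ s.warr 0 k = x ∧ s.warr 1 k = y) (s'.warr 2)
        (twoArrays (s'.warr 3) (s'.warr 10)) (s'.warr 4)) s := by
  refine (Wp.loop_flat
    (fun s' => s'.wvar 1 = m ∧ s'.warr 0 = s.warr 0 ∧ s'.warr 1 = s.warr 1 ∧ s'.wvar 47 ≤ m ∧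
      -- An in-degree cannot exceed the number of pairs read; this keeps the stored word below the
      -- bound `B`.
      (∀ y, s'.warr 4 y ≤ s'.wvar 47) ∧
      Adjacency (fun x y => ∃ k, k < s'.wvar 47 ∧ s.warr 0 k = x ∧ s.warr 1 k = y) (s'.warr 2)
        (twoArrays (s'.warr 3) (s'.warr 10)) (s'.warr 4))
    (fun s' => m - s'.wvar 47) m ?_ (by omega) ?_).mono ?_ ?_
  · refine ⟨hm, rfl, rfl, by omega, by simp [h4], ?_⟩
    constructor <;> simp [h2, h4, h47]
  · rintro s' ⟨a1, a2, a3, a4, a5, a6⟩ hb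
    simp only [Test.Holds, WExp.val, a1] at hb
    have hk := hl _ hb
    have hk' := hu _ hb
    have hnR : ¬ ∃ k, k < s'.wvar 47 ∧ s.warr 0 k = s.warr 0 (s'.wvar 47) ∧
        s.warr 1 k = s.warr 1 (s'.wvar 47) := by
      rintro ⟨k, h1, h2, h3⟩
      have := hinj k _ (by omega) hb h2 h3
      omega
    have hcnt := a6.cnt_lt hnR (by
      rintro y z ⟨i, hi, hi', rfl⟩ ⟨j, hj, hj', rfl⟩ g1 g2 g3
      exact h3 _ i j _ (by omega) (by omega) hb hi' hj' rfl g1 g2 g3)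
    have hR : (fun x y => ∃ k, k ≤ s'.wvar 47 ∧ s.warr 0 k = x ∧ s.warr 1 k = y) =
        fun x y => (∃ k, k < s'.wvar 47 ∧ s.warr 0 k = x ∧ s.warr 1 k = y) ∨
          x = s.warr 0 (s'.wvar 47) ∧ y = s.warr 1 (s'.wvar 47) := by
      funext x y
      simp only [le_iff_lt_or_eq, or_and_right, exists_or, exists_eq_left]
      rw [eq_comm (a := x), eq_comm (a := y)]
    have hrem := a5 (s.warr 1 (s'.wvar 47))
    have hrem' : ∀ y, Function.update (s'.warr 4) (s.warr 1 (s'.wvar 47))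
        (s'.warr 4 (s.warr 1 (s'.wvar 47)) + 1) y ≤ s'.wvar 47 + 1 := fun y => by
      by_cases hy : y = s.warr 1 (s'.wvar 47)
      · rw [hy, Function.update_self]
        omega
      · rw [Function.update_of_ne hy]
        exact (a5 y).trans (Nat.le_succ _)
    simp only [Prog.Vc, Prog.inc, WExp.val, Test.Holds]
    simp [a1, a2, a3]
    refine ⟨by omega, by omega, fun h0 => ⟨by omega, by omega, by omega, by omega, by omega,
      by omega, by omega, ⟨by omega, hrem', ?_⟩, by omega⟩, fun h0 => ⟨by omega, by omega,
      by omega, by omega, by omega, by omega, by omega, ⟨by omega, hrem', ?_⟩, by omega⟩⟩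
    · rw [hR]
      refine a6.insert hnR hcnt fun c x hc => ?_
      rcases (by omega : c = 0 ∨ c = 1) with rfl | rfl <;>
        simp [twoArrays, h0, Function.update_apply]
    · rw [hR]
      refine a6.insert hnR hcnt fun c x hc => ?_
      rcases (by omega : c = 0 ∨ c = 1) with rfl | rfl <;>
        simp [twoArrays, show s'.warr 2 (s.warr 0 (s'.wvar 47)) = 1 by omega,
          Function.update_apply]
  · simp [Prog.flatCost, Test.cost, WExp.cost, Prog.inc]
    omega
  · rintro s' ⟨⟨a1, a2, a3, a4, a5, a6⟩, hb⟩
    simp only [Test.Holds, WExp.val, a1] at hb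
    rwa [show s'.wvar 47 = m by omega] at a6

/-- Push the minimal elements. -/
def initProg : Prog :=
  .setW 47 (.const 0) ;;
  .loop (.wlt (.var 47) (.var 0))
    (.cond (.weq (.get 4 (.var 47)) (.const 0)) (.putW 13 (.var 49) (.var 47) ;; .inc 49) .skip ;;
      .inc 47)

theorem initProg_wp {B n : ℕ} {s : State} (hn : s.wvar 0 = n) (h49 : s.wvar 49 = 0)
    (hB : n + 3 ≤ B) :
    Wp B initProg (100 * (n + 1))
      (fun s' => (∀ i, i < s'.wvar 49 → s'.warr 13 i < n) ∧
        (∀ i j, i < s'.wvar 49 → j < s'.wvar 49 → s'.warr 13 i = s'.warr 13 j → i = j) ∧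
        ∀ y, y < n → ((∃ i, i < s'.wvar 49 ∧ s'.warr 13 i = y) ↔ s.warr 4 y = 0)) s := by
  refine Wp.step (T₁ := 2) (T₂ := n * 60 + 3)
    (R := fun s' => s' = s.setW 47 0)
    (Wp.flat ⟨by simp only [WExp.val]; omega, rfl⟩ (by decide)) (fun s₁ hs₁ _ => ?_) (by omega)
  refine (Wp.loop_flat
    (fun s' => s'.wvar 0 = n ∧ s'.warr 4 = s.warr 4 ∧ s'.wvar 47 ≤ n ∧ s'.wvar 49 ≤ s'.wvar 47 ∧
      (∀ i, i < s'.wvar 49 → s'.warr 13 i < s'.wvar 47) ∧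
        (∀ i j, i < s'.wvar 49 → j < s'.wvar 49 → s'.warr 13 i = s'.warr 13 j → i = j) ∧
        ∀ y, y < s'.wvar 47 → ((∃ i, i < s'.wvar 49 ∧ s'.warr 13 i = y) ↔ s.warr 4 y = 0))
    (fun s' => n - s'.wvar 47) n ?_ ?_ ?_).mono ?_ ?_
  · subst hs₁
    simp [hn, h49]
  · omega
  · rintro s' ⟨a1, a2, a3, a4, a5, a6, a7⟩ hb
    simp only [Test.Holds, WExp.val, a1] at hb
    simp only [Prog.Vc, Prog.inc, WExp.val, Test.Holds]
    simp [a1, a2]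
    refine ⟨fun h0 => ⟨by omega, by omega, by omega, by omega, ⟨by omega, by omega,
      fun i hi => ?_, fun i j hi hj he => ?_, fun y hy => ?_⟩, by omega⟩,
      fun h0 => ⟨by omega, ⟨by omega, by omega, fun i hi => ?_, a6, fun y hy => ?_⟩, by omega⟩⟩
    · by_cases hi' : i = s'.wvar 49
      · simp [hi']
      · have := a5 i (by omega)
        simp [hi']
        omega
    · by_cases hi' : i = s'.wvar 49 <;> by_cases hj' : j = s'.wvar 49
      · omega
      · simp [hi', hj'] at he
        have := a5 j (by omega)
        omega
      · simp [hi', hj'] at he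
        have := a5 i (by omega)
        omega
      · simp [hi', hj'] at he
        exact a6 i j (by omega) (by omega) he
    · by_cases hy' : y = s'.wvar 47
      · subst hy'
        exact iff_of_true ⟨s'.wvar 49, by omega, by simp⟩ h0
      · rw [← a7 y (by omega)]
        constructor
        · rintro ⟨i, hi, he⟩
          by_cases hi' : i = s'.wvar 49
          · simp [hi'] at he
            omega
          · simp [hi'] at he
            exact ⟨i, by omega, he⟩
        · rintro ⟨i, hi, he⟩
          refine ⟨i, by omega, ?_⟩
          simp [show i ≠ s'.wvar 49 by omega, he]
    · have := a5 i hi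
      omega
    · by_cases hy' : y = s'.wvar 47
      · subst hy'
        refine iff_of_false ?_ h0
        rintro ⟨i, hi, he⟩
        have := a5 i hi
        omega
      · exact a7 y (by omega)
  · simp [Prog.flatCost, Test.cost, WExp.cost, Prog.inc]
    omega
  · rintro s' ⟨⟨a1, a2, a3, a4, a5, a6, a7⟩, hb⟩
    simp only [Test.Holds, WExp.val, a1] at hb
    have : s'.wvar 47 = n := by omega
    exact ⟨this ▸ a5, a6, this ▸ a7⟩

end RealRAM

theorem Queue.rem_le {P : Type u} [PartialOrder P] {n : ℕ} {p : ℕ → P} {E : ℕ → ℕ → Prop}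
    {Q rem : ℕ → ℕ} {t : ℕ} (h : Queue n p E Q rem t) {y : ℕ} (hy : y < n) : rem y ≤ n := by
  rw [h.rem_eq y hy]
  calc _ ≤ (Set.Iio n).ncard := Set.ncard_le_ncard (fun x hx => hx.1.1) (Set.finite_Iio n)
    _ = n := by simp [Set.ncard_eq_toFinset_card']

/-! ### The programs for the levels -/

namespace RealRAM

variable {P : Type u} [PartialOrder P] {B n h h₀ l : ℕ} {p : ℕ → P} {s : State}
  {cnt : ℕ → ℕ} {up : ℕ → ℕ → ℕ}

/-- Release one covering pair. -/
def releaseStep : Prog :=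
  .setW 55 (.get 13 (.var 48)) ;;
  .cond (.wlt (.var 50) (.get 2 (.var 55)))
    (.cond (.weq (.var 50) (.const 0)) (.setW 56 (.get 3 (.var 55)))
        (.setW 56 (.get 10 (.var 55))) ;;
      .putW 5 (.var 56) (.max (.get 5 (.var 56)) (.get 5 (.var 55))) ;;
      .putW 6 (.var 56) (.max (.get 6 (.var 56)) (.get 6 (.var 55))) ;;
      .putW 4 (.var 56) (.sub (.get 4 (.var 56)) (.const 1)) ;; .inc 50 ;;
      .cond (.weq (.get 4 (.var 56)) (.const 0)) (.putW 13 (.var 49) (.var 56) ;; .inc 49) .skip)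
    (.inc 48 ;; .setW 50 (.const 0))

/-- Release the covering pairs above the last level. -/
def releaseProg : Prog := .loop (.wlt (.var 48) (.var 51)) releaseStep

/-- The invariant of `releaseProg`. -/
def ReleaseSt (n : ℕ) (p : ℕ → P) (cnt : ℕ → ℕ) (up : ℕ → ℕ → ℕ) (h₀ l : ℕ) (s : State) : Prop :=
  s.wvar 51 = l ∧ s.warr 2 = cnt ∧ twoArrays (s.warr 3) (s.warr 10) = up ∧ s.wvar 50 ≤ 2 ∧
  ReleaseInv n p up (s.wvar 52) (s.wvar 53) (s.warr 11) (s.warr 12) (s.warr 5) (s.warr 6)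
    (s.warr 13) (s.warr 4) h₀ (s.wvar 48) (s.wvar 50) l (s.wvar 49)

/-- A treated pair increases `c`. Passing to the next label resets `c`, which is at most `2`, and
this loss is outweighed by the factor `3` on the number of labels left. -/
theorem releaseStep_vc (hu : UpperCovers n p cnt up) (hB : n + 3 ≤ B)
    (hs : ReleaseSt n p cnt up h₀ l s) (hl : s.wvar 48 < l) :
    releaseStep.Vc B (fun s' => ReleaseSt n p cnt up h₀ l s' ∧
      3 * (l - s'.wvar 48) + (2 - s'.wvar 50) < 3 * (l - s.wvar 48) + (2 - s.wvar 50)) s := by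
  obtain ⟨a1, a2, a3, a4, hI⟩ := hs
  have ht := hI.queue.t_le
  have hlt := hI.le''
  have hQ := hI.queue.lt _ (hl.trans_le hlt)
  have h2 := hu.le_two _ hQ
  have hα := hI.chains.α_le
  have hβ := hI.chains.β_le
  have hc := hI.count
  have hr := fun hlt => hI.relax (u := twoArrays (s.warr 3) (s.warr 10) (s.wvar 50)
    (s.warr 13 (s.wvar 48))) hu hl hlt (by rw [a3])
  have hn := hI.next hu hl
  have hrem : ∀ y, y < n → s.warr 4 y ≤ n := fun y hy => hI.queue.rem_le hy
  have huu : s.wvar 50 < cnt (s.warr 13 (s.wvar 48)) →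
      twoArrays (s.warr 3) (s.warr 10) (s.wvar 50) (s.warr 13 (s.wvar 48)) < n := fun hlt =>
    ((hu.cov _ _ hQ).2 ⟨_, hlt, by rw [a3]⟩).2.1
  simp only [releaseStep, Prog.Vc, Prog.inc, WExp.val, Test.Holds, WExp.max_val]
  simp [a2, ReleaseSt, a1, a3]
  refine ⟨by omega, fun hlt => ⟨fun h0 => ?_, fun h0 => ?_⟩, fun hlt => ?_⟩
  · have hr := hr hlt
    have huu := huu hlt
    simp only [twoArrays, h0, if_true] at hr huu
    have := hrem _ huu
    have := hα _ huu
    have := hα _ hQ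
    have := hβ _ huu
    have := hβ _ hQ
    simp only [Function.update_self] at hr
    refine ⟨by omega, by omega, by omega, by omega, by omega, by omega, by omega, fun h1 => ⟨by omega, by omega, by omega, ⟨by omega, ?_⟩, by omega⟩,
      fun h1 => ⟨⟨by omega, ?_⟩, by omega⟩⟩
    · simpa [h0] using hr.1 h1
    · simpa [h0] using hr.2 h1
  · have hr := hr hlt
    have huu := huu hlt
    simp only [twoArrays, h0, if_false] at hr huu
    have := hrem _ huu
    have := hα _ huu
    have := hα _ hQ
    have := hβ _ huu
    have := hβ _ hQ
    simp only [Function.update_self] at hr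
    refine ⟨by omega, by omega, by omega, by omega, by omega, by omega, by omega, fun h1 => ⟨by omega, by omega, by omega, ⟨by omega, ?_⟩, by omega⟩,
      fun h1 => ⟨⟨by omega, ?_⟩, by omega⟩⟩
    · exact hr.1 h1
    · exact hr.2 h1
  · exact ⟨by omega, by omega, hn hlt, by omega⟩

theorem releaseProg_wp (hu : UpperCovers n p cnt up) (hB : n + 3 ≤ B)
    (hs : ReleaseSt n p cnt up h₀ l s) (hl : l ≤ s.wvar 48 + 2) :
    Wp B releaseProg 2000 (fun s' => ReleaseSt n p cnt up h₀ l s' ∧ s'.wvar 48 = l) s := by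
  refine (Wp.loop_flat (ReleaseSt n p cnt up h₀ l)
    -- A level has at most two labels, so the measure starts at no more than `3 * 2 + 2 = 8`.
    (fun s' => 3 * (l - s'.wvar 48) + (2 - s'.wvar 50)) 8 hs (by omega) ?_).mono ?_ ?_
  · intro s' hs' hb
    simp only [Test.Holds, WExp.val, hs'.1] at hb
    exact releaseStep_vc hu hB hs' hb
  · decide
  · rintro s' ⟨hs', hb⟩
    simp only [Test.Holds, WExp.val, hs'.1] at hb
    exact ⟨hs', le_antisymm hs'.2.2.2.2.le' (by omega)⟩

/-- Append the label in word variable `q` to the chain `a`, whose length is in `v`. -/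
def place (q a v α : ℕ) : Prog :=
  .putW a (.var v) (.var q) ;; .inc v ;; .putW α (.var q) (.var v)

/-- Place a level. -/
def placeLevel : Prog :=
  .setW 55 (.get 13 (.var 48)) ;; .setW 51 (.var 49) ;; .setW 50 (.const 0) ;;
  .cond (.weq (.var 49) (.add (.var 48) (.const 1)))
    (.cond (.weq (.get 5 (.var 55)) (.var 52)) (place 55 11 52 5) (place 55 12 53 6))
    (.setW 56 (.get 13 (.add (.var 48) (.const 1))) ;;
      .cond (.conj (.weq (.get 5 (.var 55)) (.var 52)) (.weq (.get 6 (.var 56)) (.var 53)))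
        (place 55 11 52 5 ;; place 56 12 53 6) (place 56 11 52 5 ;; place 55 12 53 6))

/-- The invariant of the loop over the levels. -/
def LevelSt (n : ℕ) (p : ℕ → P) (cnt : ℕ → ℕ) (up : ℕ → ℕ → ℕ) (s : State) : Prop :=
  s.warr 2 = cnt ∧ twoArrays (s.warr 3) (s.warr 10) = up ∧
  LevelInv n p (s.wvar 52) (s.wvar 53) (s.warr 11) (s.warr 12) (s.warr 5) (s.warr 6)
    (s.warr 13) (s.warr 4) (s.wvar 48) (s.wvar 49)

theorem placeLevel_vc [Fintype P] (hp : Labelling n p) (hw : NoThreeAntichain P) (hB : n + 3 ≤ B)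
    (hs : LevelSt n p cnt up s) (hl : s.wvar 48 < s.wvar 49) :
    placeLevel.Vc B (fun s' => ReleaseSt n p cnt up (s.wvar 48) (s.wvar 49) s' ∧
      s'.wvar 48 = s.wvar 48) s := by
  obtain ⟨a1, a2, hI⟩ := hs
  have ht := hI.queue.t_le
  have hle := hI.le
  have hc := hI.count
  have hQ := hI.queue.lt _ hl
  have hsz := hI.size_le hp hw
  simp only [placeLevel, place, Prog.Vc, Prog.inc, WExp.val, Test.Holds]
  simp [a1, a2, ReleaseSt]
  refine ⟨by omega, by omega, by omega, fun h1 => ⟨fun h2 => ?_, fun h2 => ?_⟩, fun h1 =>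
    ⟨?_, fun h2 h3 => ?_, fun h2 => ?_⟩⟩
  · exact ⟨by omega, by omega, by omega, by omega, by omega, (hI.place_one hp h1 h2).release hle⟩
  · refine ⟨by omega, by omega, by omega, by omega, by omega, ?_⟩
    exact (hI.swap.place_one hp h1 ((hI.single hp h1).resolve_left h2)).swap.release hle
  · have := hI.queue.lt (s.wvar 48 + 1) (by omega)
    omega
  · have h4 : s.wvar 49 = s.wvar 48 + 2 := by omega
    have := hI.queue.lt (s.wvar 48 + 1) (by omega)
    refine ⟨by omega, by omega, by omega, by omega, by omega, by omega, by omega, by omega,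
      by omega, by omega, ?_⟩
    exact (hI.place_two hp h4 le_rfl (by omega) (by omega) (by omega) (by omega) h2 h3).release hle
  · have h4 : s.wvar 49 = s.wvar 48 + 2 := by omega
    have := hI.queue.lt (s.wvar 48 + 1) (by omega)
    refine ⟨by omega, by omega, by omega, by omega, by omega, by omega, by omega, by omega,
      by omega, by omega, ?_⟩
    -- If the tested assignment to the chains fails, the opposite one must be possible, so the
    -- program need not test it.
    have hpair := (hI.pair hp hw h4).resolve_left (by rintro ⟨h5, h6⟩; exact h2 h5 h6)
    exact (hI.place_two hp h4 (by omega) (by omega) le_rfl (by omega) (by omega) hpair.2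
      hpair.1).release hle

/-- Partition the elements into two chains. -/
def levelProg : Prog := .loop (.wlt (.var 48) (.var 49)) (placeLevel ;; releaseProg)

/-- Each round places at least one label and takes bounded time, since a level has at most two
labels with at most two upper covers each. -/
theorem levelProg_wp [Fintype P] (hp : Labelling n p) (hw : NoThreeAntichain P)
    (hu : UpperCovers n p cnt up) (hB : n + 3 ≤ B) (hs : LevelSt n p cnt up s) :
    Wp B levelProg (3000 * (n + 1)) (fun s' => s'.wvar 52 + s'.wvar 53 = n ∧
      Chains n p (fun x => x < n) (s'.wvar 52) (s'.wvar 53) (s'.warr 11) (s'.warr 12) (s'.warr 5)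
        (s'.warr 6)) s := by
  refine (Wp.loop_const (LevelSt n p cnt up) (fun s' => n - s'.wvar 48) 2500 n hs (by omega)
    ?_).mono ?_ ?_
  · intro s' hs' hb
    simp only [Test.Holds, WExp.val] at hb
    refine Wp.step (Wp.flat (placeLevel_vc hp hw hB hs' hb) (T := 100) (by decide))
      (fun s₁ h₁ _ => (releaseProg_wp hu hB h₁.1 ?_).imp ?_) (by omega)
    · have := hs'.2.2.size_le hp hw
      omega
    · rintro s₂ ⟨⟨b1, b2, b3, b4, b5⟩, b6⟩
      have := hs'.2.2.queue.t_le
      rw [b6] at b5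
      exact ⟨⟨b2, b3, b6 ▸ b5.level⟩, by omega⟩
  · simp [Test.cost, WExp.cost]
    omega
  · rintro s' ⟨hs', hb⟩
    simp only [Test.Holds, WExp.val] at hb
    exact hs'.2.2.all (le_antisymm hs'.2.2.le (by omega))

end RealRAM

/-! ### Lower sets as pairs of prefixes -/

section Prefixes

/-- The pairs `(i, j)` with `Feas F G i j` are the pairs of prefixes of the two chains that form a
lower set. -/
structure PrefixBounds (na nb S : ℕ) (A B α β F G : ℕ → ℕ) : Prop where
  lt : nb + 1 < S
  F_zero : F 0 = 0
  F_succ : ∀ j, j < nb → F (j + 1) = α (B j)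
  F_end : ∀ j, nb < j → j ≤ S → F j = na + 1
  G_pos : ∀ j, j ≤ S → 0 < G j
  G_le : ∀ j, j ≤ S → G j ≤ na + 1
  lt_G : ∀ j i, j ≤ S → i < na → (i + 1 < G j ↔ β (A i) ≤ j)
  G_end : ∀ j, S < j → G j = 0

variable {P : Type u} [PartialOrder P] {n : ℕ} {p : ℕ → P} {na nb S : ℕ}
  {A B α β F G : ℕ → ℕ}

theorem Chains.A_lt_n (h : Chains n p (fun x => x < n) na nb A B α β) {i : ℕ} (hi : i < na) :
    A i < n := (h.mem _).2 (.inl ⟨i, hi, rfl⟩)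

theorem Chains.α_mono (h : Chains n p (fun x => x < n) na nb A B α β) {x y : ℕ} (hx : x < n)
    (hy : y < n) (hle : p x ≤ p y) : α x ≤ α y := by
  by_contra hc
  have hα := h.α_le x hx
  have h1 := (h.α_iff x hx (α y) (by omega)).1 (by omega)
  have h2 := (h.α_iff y hy (α y) (by omega)).2 (h1.trans hle)
  omega

theorem Chains.A_le (h : Chains n p (fun x => x < n) na nb A B α β) {i j : ℕ} (hij : i ≤ j)
    (hj : j < na) : p (A i) ≤ p (A j) := by
  rcases hij.lt_or_eq with hlt | rfl
  · exact (h.A_lt i j hlt hj).le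
  · exact le_rfl

theorem PrefixBounds.F_le_of_le (hb : PrefixBounds na nb S A B α β F G)
    (h : Chains n p (fun x => x < n) na nb A B α β) {x : ℕ} (hx : x ≤ S) : F x ≤ na + 1 := by
  rcases x with _ | x
  · rw [hb.F_zero]
    omega
  · by_cases hxb : x < nb
    · rw [hb.F_succ x hxb]
      exact (h.α_le _ (h.swap.A_lt_n hxb)).trans (Nat.le_succ _)
    · rw [hb.F_end _ (by omega) hx]

theorem PrefixBounds.F_mono (hb : PrefixBounds na nb S A B α β F G)
    (h : Chains n p (fun x => x < n) na nb A B α β) {x y : ℕ} (hxy : x ≤ y) (hy : y ≤ S) :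
    F x ≤ F y := by
  rcases x with _ | x
  · rw [hb.F_zero]
    omega
  rcases y with _ | y
  · omega
  by_cases hyb : y < nb
  · rw [hb.F_succ x (by omega), hb.F_succ y hyb]
    exact h.α_mono (h.swap.A_lt_n (by omega)) (h.swap.A_lt_n hyb) (h.swap.A_le (by omega) hyb)
  · rw [hb.F_end (y + 1) (by omega) hy]
    exact hb.F_le_of_le h (by omega)

theorem PrefixBounds.staircase (hb : PrefixBounds na nb S A B α β F G)
    (h : Chains n p (fun x => x < n) na nb A B α β) : Staircase F G S (na + 1) where
  F_mono _ _ := hb.F_mono h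
  G_mono x y hxy hy := by
    by_contra hc
    have h1 := hb.G_le x (by omega)
    have h2 := hb.G_pos y hy
    have h3 := (hb.lt_G x (G y - 1) (by omega) (by omega)).1 (by omega)
    have h4 := (hb.lt_G y (G y - 1) hy (by omega)).2 (by omega)
    omega
  F_le _ := hb.F_le_of_le h
  G_le := hb.G_le
  F_last := by
    have := hb.lt
    rw [hb.F_end (S - 1) (by omega) (by omega)]

/-- The rows after `nb` are padding: up to `S` they have `F j = na + 1 ≥ G j`, and beyond `S` the
value `G j = 0` makes them infeasible. -/
theorem PrefixBounds.feas_le (hb : PrefixBounds na nb S A B α β F G) {i j : ℕ}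
    (hf : Feas F G i j) : i ≤ na ∧ j ≤ nb ∧ j < S := by
  have hlt := hb.lt
  have hj : j ≤ S := by
    by_contra hc
    have := hb.G_end j (by omega)
    have := hf.2
    omega
  have := hb.G_le j hj
  have := hf.1
  have := hf.2
  refine ⟨by omega, ?_⟩
  by_contra hc
  have := hb.F_end j (by omega) hj
  omega

theorem PrefixBounds.feas_zero (hb : PrefixBounds na nb S A B α β F G) : Feas F G 0 0 :=
  ⟨hb.F_zero.le, hb.G_pos 0 (Nat.zero_le _)⟩

/-- A lower set meets a chain in a prefix. -/
theorem exists_prefix (f : ℕ → P) (m : ℕ) (hf : ∀ i j, i < j → j < m → f i < f j) {L : Set P}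
    (hL : IsLowerSet L) : ∃ k, k ≤ m ∧ ∀ i, i < m → (f i ∈ L ↔ i < k) := by
  induction m with
  | zero => exact ⟨0, le_rfl, fun i hi => absurd hi (Nat.not_lt_zero i)⟩
  | succ m ih =>
    obtain ⟨k, hk, hk'⟩ := ih fun i j h1 h2 => hf i j h1 (by omega)
    by_cases hm : f m ∈ L
    · refine ⟨m + 1, le_rfl, fun i hi => iff_of_true ?_ hi⟩
      rcases Nat.lt_succ_iff_lt_or_eq.1 hi with hi | rfl
      · exact hL (hf i m hi (by omega)).le hm
      · exact hm
    · refine ⟨k, by omega, fun i hi => ?_⟩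
      rcases Nat.lt_succ_iff_lt_or_eq.1 hi with hi | rfl
      · exact hk' i hi
      · exact iff_of_false hm (by omega)

/-- The set formed by two prefixes. -/
def prefixSet [DecidableEq P] (p : ℕ → P) (A B : ℕ → ℕ) (i j : ℕ) : Finset P :=
  (Finset.range i).image (fun k => p (A k)) ∪ (Finset.range j).image (fun k => p (B k))

theorem Chains.sum_prefixSet [DecidableEq P] (hp : Labelling n p)
    (h : Chains n p (fun x => x < n) na nb A B α β) {i j : ℕ} (hi : i ≤ na) (hj : j ≤ nb)
    (w : P → ℝ × ℝ) : ∑ a ∈ prefixSet p A B i j, w a =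
      ∑ k ∈ Finset.range i, w (p (A k)) + ∑ k ∈ Finset.range j, w (p (B k)) := by
  have inj : ∀ (na nb : ℕ) (A B α β : ℕ → ℕ) (_ : Chains n p (fun x => x < n) na nb A B α β)
      (i : ℕ) (_ : i ≤ na), Set.InjOn (fun k => p (A k)) (Finset.range i : Set ℕ) := by
    intro na nb A B α β h i hi k hk l hl he
    simp only [Finset.coe_range, Set.mem_Iio] at hk hl
    rcases lt_trichotomy k l with hlt | heq | hlt
    · exact absurd he (h.A_lt k l hlt (by omega)).ne
    · exact heq
    · exact absurd he (h.A_lt l k hlt (by omega)).ne'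
  rw [prefixSet, Finset.sum_union, Finset.sum_image (inj _ _ _ _ _ _ h i hi),
    Finset.sum_image (inj _ _ _ _ _ _ h.swap j hj)]
  rw [Finset.disjoint_left]
  intro a ha hb
  simp only [Finset.mem_image, Finset.mem_range] at ha hb
  obtain ⟨k, hk, rfl⟩ := ha
  obtain ⟨l, hl, he⟩ := hb
  exact h.ne k l (by omega) (by omega) (hp.inj _ _ (h.A_lt_n (by omega))
    (h.swap.A_lt_n (by omega)) he.symm)

theorem Chains.isLowerSet_prefixSet [DecidableEq P] (hp : Labelling n p)
    (h : Chains n p (fun x => x < n) na nb A B α β) {i j : ℕ} (hi : i ≤ na) (hj : j ≤ nb)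
    (h1 : ∀ k, k < i → β (A k) ≤ j) (h2 : ∀ k, k < j → α (B k) ≤ i) :
    IsLowerSet (prefixSet p A B i j : Set P) := by
  intro a b hba ha
  simp only [prefixSet, Finset.mem_coe, Finset.mem_union, Finset.mem_image,
    Finset.mem_range] at ha ⊢
  obtain ⟨y, hy, rfl⟩ := hp.surj b
  rcases (h.mem y).1 hy with ⟨l, hl, rfl⟩ | ⟨l, hl, rfl⟩
  · refine .inl ⟨l, ?_, rfl⟩
    rcases ha with ⟨k, hk, rfl⟩ | ⟨k, hk, rfl⟩
    · by_contra hc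
      exact (h.A_lt k l (by omega) hl).not_ge hba
    · exact ((h.α_iff _ (h.swap.A_lt_n (by omega)) l hl).2 hba).trans_le (h2 k hk)
  · refine .inr ⟨l, ?_, rfl⟩
    rcases ha with ⟨k, hk, rfl⟩ | ⟨k, hk, rfl⟩
    · exact ((h.β_iff _ (h.A_lt_n (by omega)) l hl).2 hba).trans_le (h1 k hk)
    · by_contra hc
      exact (h.B_lt k l (by omega) hl).not_ge hba

/-- A pair of prefixes is a lower set when each prefix contains the elements of its chain that lie
below the other prefix. By monotonicity only the last elements matter: `F j ≤ i` is the condition of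
the prefix of `B`, and `i < G j` that of the prefix of `A`. -/
theorem PrefixBounds.projectFamily_eq [Fintype P] (hb : PrefixBounds na nb S A B α β F G)
    (hp : Labelling n p) (h : Chains n p (fun x => x < n) na nb A B α β) (w : P → ℝ × ℝ) :
    projectFamily w {L : Set P | IsLowerSet L} = {z | ∃ i j, Feas F G i j ∧
      ∑ k ∈ Finset.range i, w (p (A k)) + ∑ k ∈ Finset.range j, w (p (B k)) = z} := by
  classical
  have hS := hb.lt
  have hsum : ∀ i j, i ≤ na → j ≤ nb → ∑ a : P, (prefixSet p A B i j : Set P).indicator w a =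
      ∑ k ∈ Finset.range i, w (p (A k)) + ∑ k ∈ Finset.range j, w (p (B k)) := by
    intro i j hi hj
    rw [← h.sum_prefixSet hp hi hj]
    exact Finset.sum_indicator_subset w (Finset.subset_univ _)
  apply Set.Subset.antisymm
  · rintro _ ⟨L, hL, rfl⟩
    have hL : IsLowerSet L := hL
    obtain ⟨i, hi, hi'⟩ := exists_prefix (fun k => p (A k)) na h.A_lt hL
    obtain ⟨j, hj, hj'⟩ := exists_prefix (fun k => p (B k)) nb h.B_lt hL
    have hLeq : L = (prefixSet p A B i j : Set P) := by
      ext a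
      simp only [prefixSet, Finset.coe_union, Finset.coe_image, Finset.coe_range, Set.mem_union,
        Set.mem_image, Set.mem_Iio]
      constructor
      · intro ha
        obtain ⟨y, hy, rfl⟩ := hp.surj a
        rcases (h.mem y).1 hy with ⟨l, hl, rfl⟩ | ⟨l, hl, rfl⟩
        · exact .inl ⟨l, (hi' l hl).1 ha, rfl⟩
        · exact .inr ⟨l, (hj' l hl).1 ha, rfl⟩
      · rintro (⟨k, hk, rfl⟩ | ⟨k, hk, rfl⟩)
        · exact (hi' k (by omega)).2 hk
        · exact (hj' k (by omega)).2 hk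
    refine ⟨i, j, ⟨?_, ?_⟩, ?_⟩
    · rcases j with _ | j
      · rw [hb.F_zero]
        omega
      · rw [hb.F_succ j (by omega)]
        by_contra hc
        have hα := h.α_le _ (h.swap.A_lt_n (i := j) (by omega))
        have h1 := (h.α_iff _ (h.swap.A_lt_n (i := j) (by omega)) i (by omega)).1 (by omega)
        have h2 := (hi' i (by omega)).1 (hL h1 ((hj' j (by omega)).2 (by omega)))
        omega
    · rcases i with _ | i
      · exact hb.G_pos j (by omega)
      · rw [hb.lt_G j i (by omega) (by omega)]
        by_contra hc
        have hβ := h.β_le _ (h.A_lt_n (i := i) (by omega))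
        have h1 := (h.β_iff _ (h.A_lt_n (i := i) (by omega)) j (by omega)).1 (by omega)
        have h2 := (hj' j (by omega)).1 (hL h1 ((hi' i (by omega)).2 (by omega)))
        omega
    · rw [← hsum i j hi hj]
      simp only [hLeq]
  · rintro _ ⟨i, j, hf, rfl⟩
    obtain ⟨hi, hj, hjS⟩ := hb.feas_le hf
    refine ⟨(prefixSet p A B i j : Set P), ?_, hsum i j hi hj⟩
    refine h.isLowerSet_prefixSet hp hi hj (fun k hk => ?_) fun k hk => ?_
    · have := hf.2
      exact (hb.lt_G j k (by omega) (by omega)).1 (by omega)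
    · rw [← hb.F_succ k (by omega)]
      exact (hb.F_mono h (by omega) (by omega)).trans hf.1

end Prefixes

/-! ### The program for the prefixes -/

namespace RealRAM

/-- Compute a power of two that exceeds `n + 1`. -/
def sizeProg : Prog :=
  .setW 27 (.const 1) ;;
  .loop (.wlt (.var 27) (.add (.var 0) (.const 2))) (.setW 27 (.mul (.var 27) (.const 2)))

/-- The doubling loop is charged one round per unit of `n + 2`, which is generous but still linear.
-/
theorem sizeProg_wp {B n : ℕ} {s : State} (hn : s.wvar 0 = n) (hB : 2 * n + 6 ≤ B) :
    Wp B sizeProg (20 * (n + 3)) (fun s' => ∃ K, s'.wvar 27 = 2 ^ K ∧ n + 2 ≤ 2 ^ K ∧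
      2 ^ K < 2 * (n + 2)) s := by
  refine Wp.step (T₁ := 2) (T₂ := (n + 2) * 10 + 5)
    (R := fun s' => s' = s.setW 27 1)
    (Wp.flat ⟨by simp only [WExp.val]; omega, rfl⟩ (by decide)) (fun s₁ hs₁ _ => ?_) (by omega)
  refine (Wp.loop_flat (fun s' => s'.wvar 0 = n ∧ ∃ K, s'.wvar 27 = 2 ^ K ∧ 2 ^ K < 2 * (n + 2))
    (fun s' => n + 2 - s'.wvar 27) (n + 2) ?_ (by omega) ?_).mono ?_ ?_
  · subst hs₁
    exact ⟨by simp [hn], 0, by simp, by omega⟩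
  · rintro s' ⟨a1, K, a2, a3⟩ hb
    simp only [Test.Holds, WExp.val, a1] at hb
    have : 0 < 2 ^ K := by positivity
    simp only [Prog.Vc, WExp.val]
    refine ⟨by omega, ⟨by simp [a1], K + 1, by simp [a2, pow_succ], ?_⟩, ?_⟩
    · rw [pow_succ]
      omega
    · simp
      omega
  · simp [Prog.flatCost, Test.cost, WExp.cost]
  · rintro s' ⟨⟨a1, K, a2, a3⟩, hb⟩
    simp only [Test.Holds, WExp.val, a1] at hb
    exact ⟨K, a2, by omega, a3⟩

/-- Sum up the weights along the chain in array `e`, whose length is in `v`, and copy the values of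
array `g` to array `f`. -/
def chainProg (e v x y f g : ℕ) : Prog :=
  .setW 54 (.const 0) ;;
  .loop (.wlt (.var 54) (.var v))
    (.setW 55 (.get e (.var 54)) ;;
      .putR x (.add (.var 54) (.const 1)) (.add (.get x (.var 54)) (.get 0 (.var 55))) ;;
      .putR y (.add (.var 54) (.const 1)) (.add (.get y (.var 54)) (.get 1 (.var 55))) ;;
      .putW f (.add (.var 54) (.const 1)) (.get g (.var 55)) ;; .inc 54)

theorem chainProg_wp {B n m e v x y f g : ℕ} {s : State} (hv : s.wvar v = m) (h54 : v ≠ 54)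
    (h55 : v ≠ 55) (hx0 : x ≠ 0) (hx1 : x ≠ 1) (hy0 : y ≠ 0) (hy1 : y ≠ 1) (hxy : x ≠ y)
    (hfe : f ≠ e) (hfg : f ≠ g) (he : ∀ i, i < m → s.warr e i < n)
    (hg : ∀ i, i < m → s.warr g (s.warr e i) ≤ n) (hmn : m ≤ n) (h0 : s.pt x y 0 = 0)
    (hB : n + 3 ≤ B) :
    Wp B (chainProg e v x y f g) (60 * (n + 1))
      (fun s' => (∀ i, i ≤ m → s'.pt x y i = ∑ k ∈ Finset.range i, s.pt 0 1 (s.warr e k)) ∧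
        s'.warr f 0 = s.warr f 0 ∧ ∀ i, i < m → s'.warr f (i + 1) = s.warr g (s.warr e i)) s := by
  refine Wp.step (T₁ := 2) (T₂ := m * 50 + 3)
    (R := fun s' => s' = s.setW 54 0)
    (Wp.flat ⟨by simp only [WExp.val]; omega, rfl⟩ (by simp [Prog.flatCost, WExp.cost]))
    (fun s₁ hs₁ _ => ?_) (by omega)
  refine (Wp.loop_flat
    (fun s' => s'.wvar v = m ∧ s'.warr e = s.warr e ∧ s'.warr g = s.warr g ∧
      s'.rarr 0 = s.rarr 0 ∧ s'.rarr 1 = s.rarr 1 ∧ s'.wvar 54 ≤ m ∧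
      (∀ i, i ≤ s'.wvar 54 → s'.pt x y i = ∑ k ∈ Finset.range i, s.pt 0 1 (s.warr e k)) ∧
        s'.warr f 0 = s.warr f 0 ∧
        ∀ i, i < s'.wvar 54 → s'.warr f (i + 1) = s.warr g (s.warr e i))
    (fun s' => m - s'.wvar 54) m ?_ (by omega) ?_).mono ?_ ?_
  · subst hs₁
    simp [hv, h54, h0]
  · rintro s' ⟨a1, a2, a3, a4, a5, a6, a7, a8, a9⟩ hb
    simp only [Test.Holds, WExp.val, a1] at hb
    have b1 := he _ hb
    have b2 := hg _ hb
    have b3 := a7 _ le_rfl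
    simp only [Prog.Vc, Prog.inc, WExp.val, RExp.val]
    simp [a1, a2, a3, a4, a5, h54, h55, hx0.symm, hx1.symm, hy0.symm, hy1.symm, hxy.symm,
      hfe.symm, hfg.symm]
    refine ⟨by omega, by omega, by omega, by omega, ⟨by omega, fun i hi => ?_, a8,
      fun i hi => ?_⟩, by omega⟩
    · by_cases hi' : i = s'.wvar 54 + 1
      · subst hi'
        rw [Finset.sum_range_succ, ← b3]
        simp [State.pt, hxy, hxy.symm]
      · rw [← a7 i (by omega)]
        simp [State.pt, hxy, hxy.symm, hi']
    · by_cases hi' : i = s'.wvar 54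
      · simp [hi']
      · simp [hi', a9 i (by omega)]
  · simp [Prog.flatCost, Test.cost, WExp.cost, RExp.cost, Prog.inc]
    omega
  · rintro s' ⟨⟨a1, a2, a3, a4, a5, a6, a7, a8, a9⟩, hb⟩
    simp only [Test.Holds, WExp.val, a1] at hb
    have : s'.wvar 54 = m := by omega
    exact ⟨this ▸ a7, a8, this ▸ a9⟩

/-- Extend the lower staircase. -/
def padProg : Prog :=
  .setW 54 (.add (.var 53) (.const 1)) ;;
  .loop (.wlt (.var 54) (.add (.var 27) (.const 1)))
    (.putW 7 (.var 54) (.add (.var 52) (.const 1)) ;; .inc 54)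

theorem padProg_wp {B na nb S : ℕ} {s : State} (ha : s.wvar 52 = na) (hb : s.wvar 53 = nb)
    (hS : s.wvar 27 = S) (hna : na < S) (hnb : nb < S) (hB : S + 3 ≤ B) :
    Wp B padProg (30 * (S + 1)) (fun s' => (∀ j, j ≤ nb → s'.warr 7 j = s.warr 7 j) ∧
      ∀ j, nb < j → j ≤ S → s'.warr 7 j = na + 1) s := by
  refine Wp.step (T₁ := 4) (T₂ := S * 20 + 5)
    (R := fun s' => s' = s.setW 54 (nb + 1))
    (Wp.flat ⟨by simp only [WExp.val]; omega, by simp [WExp.val, hb]⟩ (by decide))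
    (fun s₁ hs₁ _ => ?_) (by omega)
  refine (Wp.loop_flat
    (fun s' => s'.wvar 52 = na ∧ s'.wvar 27 = S ∧ nb < s'.wvar 54 ∧ s'.wvar 54 ≤ S + 1 ∧
      (∀ j, j ≤ nb → s'.warr 7 j = s.warr 7 j) ∧
      ∀ j, nb < j → j < s'.wvar 54 → s'.warr 7 j = na + 1)
    (fun s' => S + 1 - s'.wvar 54) S ?_ ?_ ?_).mono ?_ ?_
  · subst hs₁
    simp [ha, hS]
    exact ⟨by omega, fun j h1 h2 => by omega⟩
  · simp [hs₁]
  · rintro s' ⟨a1, a2, a3, a4, a5, a6⟩ hb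
    simp only [Test.Holds, WExp.val, a2] at hb
    simp only [Prog.Vc, Prog.inc, WExp.val]
    simp [a1, a2]
    refine ⟨by omega, by omega, by omega, ⟨by omega, by omega, fun j hj => ?_,
      fun j hj hj' => ?_⟩, by omega⟩
    · simp [show j ≠ s'.wvar 54 by omega, a5 j hj]
    · by_cases hje : j = s'.wvar 54
      · simp [hje]
      · simp [hje, a6 j hj (by omega)]
  · simp [Prog.flatCost, Test.cost, WExp.cost, Prog.inc]
    omega
  · rintro s' ⟨⟨a1, a2, a3, a4, a5, a6⟩, hb⟩
    simp only [Test.Holds, WExp.val, a2] at hb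
    exact ⟨a5, fun j h1 h2 => a6 j h1 (by omega)⟩

/-- Compute the upper staircase. -/
def upperProg : Prog :=
  (.setW 54 (.const 0) ;; .setW 56 (.const 0)) ;;
  .loop (.wlt (.var 54) (.add (.var 27) (.const 1)))
    (.cond (.conj (.wlt (.var 56) (.add (.var 52) (.const 1)))
        (.neg (.wlt (.var 54) (.get 8 (.var 56)))))
      (.inc 56) (.putW 9 (.var 54) (.var 56) ;; .inc 54))

/-- Array `8` is nondecreasing, so the number of its entries that are at most `j` can be tracked by
one pointer while `j` grows. Each round advances one of the two, which gives linear time. The zeros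
beyond row `S` are left from the start. -/
theorem upperProg_wp {B na S : ℕ} {s : State} (ha : s.wvar 52 = na) (hS : s.wvar 27 = S)
    (hna : na < S) (hH : ∀ i j, i ≤ j → j ≤ na → s.warr 8 i ≤ s.warr 8 j)
    (h9 : s.warr 9 = 0) (hB : S + 3 ≤ B) :
    Wp B upperProg (100 * (S + 1)) (fun s' => (∀ j, j ≤ S → s'.warr 9 j ≤ na + 1) ∧
      (∀ j i, j ≤ S → i ≤ na → (i < s'.warr 9 j ↔ s.warr 8 i ≤ j)) ∧
      ∀ j, S < j → s'.warr 9 j = 0) s := by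
  refine Wp.step (T₁ := 4) (T₂ := (2 * S + 2) * 40 + 5)
    (R := fun s' => s' = (s.setW 54 0).setW 56 0)
    (Wp.flat ⟨by simp only [WExp.val]; omega, by simp only [WExp.val]; omega, rfl⟩ (by decide))
    (fun s₁ hs₁ _ => ?_) (by omega)
  refine (Wp.loop_flat
    (fun s' => s'.wvar 52 = na ∧ s'.wvar 27 = S ∧ s'.warr 8 = s.warr 8 ∧ s'.wvar 54 ≤ S + 1 ∧
      s'.wvar 56 ≤ na + 1 ∧ (∀ i, i < s'.wvar 56 → s.warr 8 i ≤ s'.wvar 54) ∧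
      (∀ j, j < s'.wvar 54 → s'.warr 9 j ≤ na + 1) ∧
      (∀ j i, j < s'.wvar 54 → i ≤ na → (i < s'.warr 9 j ↔ s.warr 8 i ≤ j)) ∧
      ∀ j, s'.wvar 54 ≤ j → s'.warr 9 j = 0)
    (fun s' => (S + 1 - s'.wvar 54) + (na + 1 - s'.wvar 56)) (2 * S + 2) ?_ (by omega) ?_).mono ?_ ?_
  · subst hs₁
    simp [ha, hS, h9]
  · rintro s' ⟨a1, a2, a3, a4, a5, a6, a7, a8, a9⟩ hb
    simp only [Test.Holds, WExp.val, a2] at hb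
    simp only [Prog.Vc, Prog.inc, WExp.val, Test.Holds]
    simp [a1, a2, a3]
    refine ⟨fun h1 h2 => ⟨by omega, ⟨by omega, by omega, fun i hi => ?_, a7, a8, a9⟩, by omega⟩,
      fun h1 => ⟨by omega, by omega, by omega, ⟨by omega, by omega, fun i hi => ?_,
        fun j hj => ?_, fun j i hj hi => ?_, fun j hj => ?_⟩, by omega⟩⟩
    · by_cases hie : i = s'.wvar 56
      · rwa [hie]
      · exact a6 i (by omega)
    · exact (a6 i hi).trans (Nat.le_succ _)
    · by_cases hje : j = s'.wvar 54
      · simpa [hje] using a5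
      · simpa [hje] using a7 j (by omega)
    · by_cases hje : j = s'.wvar 54
      · subst hje
        rw [Function.update_self]
        refine ⟨a6 i, fun hle => ?_⟩
        by_contra hc
        have h3 := h1 (by omega)
        have := hH (s'.wvar 56) i (by omega) hi
        omega
      · simpa [hje] using a8 j i (by omega) hi
    · simpa [show j ≠ s'.wvar 54 by omega] using a9 j (by omega)
  · simp [Prog.flatCost, Test.cost, WExp.cost, Prog.inc]
  · rintro s' ⟨⟨a1, a2, a3, a4, a5, a6, a7, a8, a9⟩, hb⟩
    simp only [Test.Holds, WExp.val, a2] at hb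
    exact ⟨fun j hj => a7 j (by omega), fun j i hj hi => a8 j i (by omega) hi,
      fun j hj => a9 j (by omega)⟩

/-- Compute the sums of the prefixes of the two chains and the staircases. -/
def prefixProg : Prog :=
  sizeProg ;; chainProg 11 52 4 5 8 6 ;; chainProg 12 53 6 7 7 5 ;; padProg ;; upperProg

/-- The two calls of `chainProg` exchange the roles of the chains: `α` read along `B` and shifted by
one is the lower staircase in array `7`, while `β` read along `A` is stored in array `8` and
inverted by `upperProg` into the upper staircase. -/
theorem prefixProg_wp {P : Type u} [PartialOrder P] {B n na nb : ℕ} {p : ℕ → P} {s : State}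
    (hn : s.wvar 0 = n) (ha : s.wvar 52 = na) (hb : s.wvar 53 = nb) (hab : na + nb = n)
    (hc : Chains n p (fun x => x < n) na nb (s.warr 11) (s.warr 12) (s.warr 5) (s.warr 6))
    (h7 : s.warr 7 0 = 0) (h8 : s.warr 8 0 = 0) (h9 : s.warr 9 = 0) (hp4 : s.pt 4 5 0 = 0)
    (hp6 : s.pt 6 7 0 = 0) (hB : 2 * n + 7 ≤ B) :
    Wp B prefixProg (1000 * (n + 3)) (fun s' => ∃ K, s'.wvar 27 = 2 ^ K ∧ n + 2 ≤ 2 ^ K ∧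
      2 ^ K < 2 * (n + 2) ∧
      PrefixBounds na nb (2 ^ K) (s.warr 11) (s.warr 12) (s.warr 5) (s.warr 6) (s'.warr 7)
        (s'.warr 9) ∧
      (∀ i, i ≤ na → s'.pt 4 5 i = ∑ k ∈ Finset.range i, s.pt 0 1 (s.warr 11 k)) ∧
      ∀ i, i ≤ nb → s'.pt 6 7 i = ∑ k ∈ Finset.range i, s.pt 0 1 (s.warr 12 k)) s := by
  refine Wp.step (T₂ := 60 * (n + 1) + (60 * (n + 1) + (30 * (2 * n + 5) + 100 * (2 * n + 5))))
    (sizeProg_wp hn (by omega)) (fun s₁ h₁ f₁ => ?_) (by omega)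
  obtain ⟨K, k1, k2, k3⟩ := h₁
  have pt1 : ∀ a b, s₁.pt a b = s.pt a b := fun a b => by
    funext i
    simp only [State.pt, f₁.rarr a (by simp [sizeProg, Prog.ra]),
      f₁.rarr b (by simp [sizeProg, Prog.ra])]
  have w1 : ∀ a, s₁.warr a = s.warr a := fun a => f₁.warr a (by simp [sizeProg, Prog.wa])
  refine Wp.step (chainProg_wp (n := n) (m := na) (by rw [f₁.wvar 52 (by decide), ha]) (by decide)
    (by decide) (by decide) (by decide) (by decide) (by decide) (by decide) (by decide) (by decide)
    (fun i hi => by rw [w1]; exact hc.A_lt_n hi)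
    (fun i hi => by
      rw [w1, w1]
      have := hc.β_le _ (hc.A_lt_n hi)
      omega) (by omega) (by rw [pt1, hp4]) (by omega)) (fun s₂ h₂ f₂ => ?_) le_rfl
  obtain ⟨b1, b2, b3⟩ := h₂
  rw [pt1] at b1
  simp only [w1] at b1 b2 b3
  have p61 : s₂.pt 6 7 = s.pt 6 7 := by
    rw [← pt1]
    funext i
    simp only [State.pt, f₂.rarr 6 (by decide), f₂.rarr 7 (by decide)]
  have p01 : s₂.pt 0 1 = s.pt 0 1 := by
    rw [← pt1]
    funext i
    simp only [State.pt, f₂.rarr 0 (by decide), f₂.rarr 1 (by decide)]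
  have e12 : s₂.warr 12 = s.warr 12 := by rw [f₂.warr 12 (by decide), w1]
  have e5 : s₂.warr 5 = s.warr 5 := by rw [f₂.warr 5 (by decide), w1]
  have e7 : s₂.warr 7 = s.warr 7 := by rw [f₂.warr 7 (by decide), w1]
  refine Wp.step (chainProg_wp (n := n) (m := nb)
    (by rw [f₂.wvar 53 (by decide), f₁.wvar 53 (by decide), hb]) (by decide)
    (by decide) (by decide) (by decide) (by decide) (by decide) (by decide) (by decide) (by decide)
    (fun i hi => by rw [e12]; exact hc.swap.A_lt_n hi)
    (fun i hi => by
      rw [e12, e5]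
      have := hc.α_le _ (hc.swap.A_lt_n hi)
      omega) (by omega) (by rw [p61, hp6]) (by omega)) (fun s₃ h₃ f₃ => ?_) le_rfl
  obtain ⟨c1, c2, c3⟩ := h₃
  rw [p01] at c1
  simp only [e12, e5, e7] at c1 c2 c3
  refine Wp.step (T₁ := 30 * (2 ^ K + 1)) (T₂ := 100 * (2 ^ K + 1)) (padProg_wp (na := na) (nb := nb) (S := 2 ^ K)
    (by rw [f₃.wvar 52 (by decide), f₂.wvar 52 (by decide), f₁.wvar 52 (by decide), ha])
    (by rw [f₃.wvar 53 (by decide), f₂.wvar 53 (by decide), f₁.wvar 53 (by decide), hb])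
    (by rw [f₃.wvar 27 (by decide), f₂.wvar 27 (by decide), k1]) (by omega) (by omega) (by omega))
    (fun s₄ h₄ f₄ => ?_) (by omega)
  obtain ⟨d1, d2⟩ := h₄
  have e8 : s₄.warr 8 = s₂.warr 8 := by rw [f₄.warr 8 (by decide), f₃.warr 8 (by decide)]
  have hH : ∀ i, i < na → s₄.warr 8 (i + 1) = s.warr 6 (s.warr 11 i) := fun i hi => by
    rw [e8, b3 i hi]
  have hH0 : s₄.warr 8 0 = 0 := by rw [e8, b2, h8]
  refine (upperProg_wp (na := na) (S := 2 ^ K)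
    (by rw [f₄.wvar 52 (by decide), f₃.wvar 52 (by decide), f₂.wvar 52 (by decide),
      f₁.wvar 52 (by decide), ha])
    (by rw [f₄.wvar 27 (by decide), f₃.wvar 27 (by decide), f₂.wvar 27 (by decide), k1])
    (by omega) ?_
    (by rw [f₄.warr 9 (by decide), f₃.warr 9 (by decide), f₂.warr 9 (by decide), w1, h9])
    (by omega)).framed.imp ?_
  · intro i j hij hj
    rcases i with _ | i
    · rw [hH0]
      omega
    rcases j with _ | j
    · omega
    rw [hH i (by omega), hH j (by omega)]
    exact hc.swap.α_mono (hc.A_lt_n (by omega)) (hc.A_lt_n (by omega)) (hc.A_le (by omega) hj)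
  · rintro s₅ ⟨⟨g1, g2, g3⟩, f₅⟩
    have e57 : s₅.warr 7 = s₄.warr 7 := f₅.warr 7 (by decide)
    refine ⟨K, ?_, k2, k3, ⟨by omega, ?_, fun j hj => ?_, fun j hj hj' => ?_, fun j hj => ?_, g1,
      fun j i hj hi => ?_, g3⟩, fun i hi => ?_, fun i hi => ?_⟩
    · rw [f₅.wvar 27 (by decide), f₄.wvar 27 (by decide), f₃.wvar 27 (by decide),
        f₂.wvar 27 (by decide), k1]
    · rw [e57, d1 0 (by omega), c2, h7]
    · rw [e57, d1 _ hj, c3 j hj]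
    · rw [e57, d2 j hj hj']
    · exact (g2 j 0 hj (Nat.zero_le _)).2 (by rw [hH0]; omega)
    · rw [g2 j (i + 1) hj hi, hH i hi]
    · rw [← b1 i hi]
      simp only [State.pt, f₅.rarr 4 (by decide), f₅.rarr 5 (by decide), f₄.rarr 4 (by decide),
        f₄.rarr 5 (by decide), f₃.rarr 4 (by decide), f₃.rarr 5 (by decide)]
    · rw [← c1 i hi]
      simp only [State.pt, f₅.rarr 6 (by decide), f₅.rarr 7 (by decide), f₄.rarr 6 (by decide),
        f₄.rarr 7 (by decide)]

end RealRAM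

/-! ### The partition and the prefixes of a partial order -/

/-- The labelling by natural numbers that extends `e`. -/
def extendLabels {P : Type u} {n : ℕ} (e : Fin n ≃ P) (a : P) (x : ℕ) : P := if h : x < n then e ⟨x, h⟩ else a

theorem extendLabels_of_lt {P : Type u} {n : ℕ} (e : Fin n ≃ P) (a : P) {x : ℕ} (h : x < n) :
    extendLabels e a x = e ⟨x, h⟩ := dif_pos h

theorem labelling_extendLabels {P : Type u} {n : ℕ} (e : Fin n ≃ P) (a : P) :
    Labelling n (extendLabels e a) where
  inj x y hx hy he := by
    rw [extendLabels_of_lt e a hx, extendLabels_of_lt e a hy] at he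
    simpa using e.injective he
  surj b := ⟨e.symm b, (e.symm b).2, by simp [extendLabels]⟩

section Width

variable {P : Type u} [PartialOrder P]

theorem HasWidth.noThreeAntichain (h : HasWidth P 2) : NoThreeAntichain P := by
  classical
  intro a b c h1 h2 h3 h4 h5 h6
  have hab : a ≠ b := fun he => h1 he.le
  have hac : a ≠ c := fun he => h3 he.le
  have hbc : b ≠ c := fun he => h5 he.le
  have := h.2 (show (3 : ℕ) ∈ _ from ⟨{a, b, c}, ?_, Finset.card_eq_three.2
    ⟨a, b, c, hab, hac, hbc, rfl⟩⟩)
  · omega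
  · intro x hx y hy hxy
    simp only [Finset.coe_insert, Finset.coe_singleton, Set.mem_insert_iff,
      Set.mem_singleton_iff] at hx hy
    rcases hx with rfl | rfl | rfl <;> rcases hy with rfl | rfl | rfl <;>
      first | exact absurd rfl hxy | assumption

theorem HasWidth.two_le_card [Fintype P] (h : HasWidth P 2) : 2 ≤ Fintype.card P := by
  obtain ⟨A, -, hA⟩ := h.1
  rw [← hA]
  exact Finset.card_le_univ A

theorem CovBy.not_le_of_ne {a x y : P} (hx : a ⋖ x) (hy : a ⋖ y) (hxy : x ≠ y) : ¬ x ≤ y :=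
  fun hle => hy.2 hx.lt (hle.lt_of_ne hxy)

/-- Distinct covers of one element are incomparable, so three of them would be an antichain. -/
theorem NoThreeAntichain.covBy (h : NoThreeAntichain P) {a x y z : P} (hx : a ⋖ x) (hy : a ⋖ y)
    (hz : a ⋖ z) (hxy : x ≠ y) (hxz : x ≠ z) (hyz : y ≠ z) : False :=
  h x y z (hx.not_le_of_ne hy hxy) (hy.not_le_of_ne hx hxy.symm) (hx.not_le_of_ne hz hxz)
    (hz.not_le_of_ne hx hxz.symm) (hy.not_le_of_ne hz hyz) (hz.not_le_of_ne hy hyz.symm)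

theorem IsCoverList.length_le {n : ℕ} {e : Fin n ≃ P} {covers : List (Fin n × Fin n)}
    (h : IsCoverList e covers) (hw : NoThreeAntichain P) : covers.length ≤ 2 * n := by
  classical
  rw [← List.toFinset_card_of_nodup h.1]
  have := Finset.card_le_mul_card_image_of_maps_to (s := covers.toFinset)
    (t := (Finset.univ : Finset (Fin n))) (f := Prod.fst) (fun a _ => Finset.mem_univ _) 2 ?_
  · simpa using this
  · intro i _
    by_contra! hlt
    obtain ⟨a, b, c, ha, hb, hc, hab, hac, hbc⟩ := Finset.two_lt_card_iff.1 hlt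
    obtain ⟨a1, a2⟩ := a
    obtain ⟨b1, b2⟩ := b
    obtain ⟨c1, c2⟩ := c
    simp only [Finset.mem_filter, List.mem_toFinset, h.2] at ha hb hc
    obtain ⟨ha, rfl⟩ := ha
    obtain ⟨hb, rfl⟩ := hb
    obtain ⟨hc, rfl⟩ := hc
    refine hw.covBy ha hb hc ?_ ?_ ?_ <;>
    · intro he
      simp_all

end Width

/-! ### Running the preprocessing on the input -/

namespace RealRAM

variable {P : Type u} [PartialOrder P]

theorem inputState_pt {n : ℕ} (covers : List (Fin n × Fin n)) (w : Fin n → ℝ × ℝ) {x : ℕ}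
    (hx : x < n) : (inputState covers w).pt 0 1 x = w ⟨x, hx⟩ := by
  simp [State.pt, inputState, hx]

theorem inputState_pt_of_ne {n : ℕ} (covers : List (Fin n × Fin n)) (w : Fin n → ℝ × ℝ)
    {a b x : ℕ} (ha : 1 < a) (hb : 1 < b) : (inputState covers w).pt a b x = 0 := by
  have h1 : a ≠ 0 := by omega
  have h2 : a ≠ 1 := by omega
  have h3 : b ≠ 0 := by omega
  have h4 : b ≠ 1 := by omega
  simp [State.pt, inputState, h1, h2, h3, h4]

theorem inputState_warr {n : ℕ} (covers : List (Fin n × Fin n)) (w : Fin n → ℝ × ℝ) {a : ℕ}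
    (ha : 1 < a) : (inputState covers w).warr a = 0 := by
  have h1 : a ≠ 0 := by omega
  have h2 : a ≠ 1 := by omega
  funext i
  simp [inputState, h1, h2]

theorem inputState_wvar {n : ℕ} (covers : List (Fin n × Fin n)) (w : Fin n → ℝ × ℝ) {x : ℕ}
    (hx : 1 < x) : (inputState covers w).wvar x = 0 := by
  have h1 : x ≠ 0 := by omega
  have h2 : x ≠ 1 := by omega
  simp [inputState, h1, h2]

/-- Compute the partition into two chains, the sums of the prefixes, and the staircases. -/
def preProg : Prog := parseProg ;; initProg ;; levelProg ;; prefixProg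

/-- The result of `preProg`. -/
structure Prepared {n : ℕ} (p : ℕ → P) (w : P → ℝ × ℝ) (s : State) (K na nb : ℕ)
    (A B α β : ℕ → ℕ) : Prop where
  size : s.wvar 27 = 2 ^ K
  le_size : n + 2 ≤ 2 ^ K
  size_lt : 2 ^ K < 2 * (n + 2)
  count : na + nb = n
  chains : Chains n p (fun x => x < n) na nb A B α β
  bounds : PrefixBounds na nb (2 ^ K) A B α β (s.warr 7) (s.warr 9)
  sum_A : ∀ i, i ≤ na → s.pt 4 5 i = ∑ k ∈ Finset.range i, w (p (A k))
  sum_B : ∀ i, i ≤ nb → s.pt 6 7 i = ∑ k ∈ Finset.range i, w (p (B k))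

/-- Everything before the geometry takes linear time, because the number of covering pairs is at
most `2 * n`. The initial zeros of the memory serve as the empty chains, the zero counts and the
prefix sums at `0`. -/
theorem preProg_wp [Fintype P] (hw : NoThreeAntichain P) {n c : ℕ} {e : Fin n ≃ P} (a₀ : P)
    {covers : List (Fin n × Fin n)} (hcov : IsCoverList e covers) (w : P → ℝ × ℝ)
    (hc : 3 * n + 7 ≤ c) :
    Wp c preProg (5000 * (n + 3)) (fun s' => s'.wvar 26 = 0 ∧ ∃ K na nb A B α β,
      Prepared (n := n) (extendLabels e a₀) w s' K na nb A B α β)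
      (inputState covers (fun i => w (e i))) := by
  have hm := hcov.length_le hw
  set s := inputState covers (fun i => w (e i)) with hs
  set p := extendLabels e a₀ with hp
  have hlab : Labelling n p := labelling_extendLabels e a₀
  have l0 : ∀ k (hk : k < covers.length), s.warr 0 k = (covers[k]).1 := fun k hk => by
    simp [hs, inputState, hk]
  have l1 : ∀ k (hk : k < covers.length), s.warr 1 k = (covers[k]).2 := fun k hk => by
    simp [hs, inputState, hk]
  have hcv : ∀ k (hk : k < covers.length), e (covers[k]).1 ⋖ e (covers[k]).2 := fun k hk =>
    (hcov.2 _ _).1 (List.getElem_mem hk)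
  have hR : (fun x y => ∃ k, k < covers.length ∧ s.warr 0 k = x ∧ s.warr 1 k = y) =
      LabelCov n p := by
    funext x y
    apply propext
    constructor
    · rintro ⟨k, hk, rfl, rfl⟩
      rw [l0 k hk, l1 k hk]
      refine ⟨Fin.is_lt _, Fin.is_lt _, ?_⟩
      rw [hp, extendLabels_of_lt e a₀ (Fin.is_lt _), extendLabels_of_lt e a₀ (Fin.is_lt _)]
      exact hcv k hk
    · rintro ⟨hx, hy, hxy⟩
      rw [hp, extendLabels_of_lt e a₀ hx, extendLabels_of_lt e a₀ hy, ← hcov.2] at hxy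
      obtain ⟨k, hk, he⟩ := List.mem_iff_getElem.1 hxy
      refine ⟨k, hk, ?_, ?_⟩
      · rw [l0 k hk, he]
      · rw [l1 k hk, he]
  refine Wp.step (T₁ := 100 * (covers.length + 1))
    (T₂ := 100 * (n + 1) + (3000 * (n + 1) + 1000 * (n + 3)))
    (parseProg_wp (n := n) (m := covers.length) (by simp [hs, inputState])
      (inputState_wvar _ _ (by decide)) (inputState_warr _ _ (by decide))
      (inputState_warr _ _ (by decide)) (fun k hk => by rw [l0 k hk]; exact Fin.is_lt _)
      (fun k hk => by rw [l1 k hk]; exact Fin.is_lt _) ?_ ?_ (by omega))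
    (fun s₁ h₁ f₁ => ?_) (by omega)
  · intro k k' hk hk' h1 h2
    rw [l0 k hk, l0 k' hk'] at h1
    rw [l1 k hk, l1 k' hk'] at h2
    exact (List.Nodup.getElem_inj_iff hcov.1).1 (Prod.ext (Fin.ext h1) (Fin.ext h2))
  · intro x i j k hi hj hk h1 h2 h3 g1 g2 g3
    rw [l0 _ hi] at h1
    rw [l0 _ hj] at h2
    rw [l0 _ hk] at h3
    rw [l1 _ hi] at g1 g2
    rw [l1 _ hj] at g1 g3
    rw [l1 _ hk] at g2 g3
    have c1 := hcv i hi
    have c2 := hcv j hj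
    have c3 := hcv k hk
    rw [show (covers[j]).1 = (covers[i]).1 from Fin.ext (h2.trans h1.symm)] at c2
    rw [show (covers[k]).1 = (covers[i]).1 from Fin.ext (h3.trans h1.symm)] at c3
    refine hw.covBy c1 c2 c3 (fun he => g1 ?_) (fun he => g2 ?_) (fun he => g3 ?_) <;>
      rw [e.injective he]
  · rw [hR] at h₁
    have hu : UpperCovers n p (s₁.warr 2) (twoArrays (s₁.warr 3) (s₁.warr 10)) :=
      ⟨fun x y _ => h₁.cov x y, fun x c c' _ => h₁.inj x c c', fun x _ => h₁.le_two x⟩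
    have v1 : ∀ x, 1 < x → x ∉ parseProg.wv → s₁.wvar x = 0 := fun x h1 h2 => by
      rw [f₁.wvar x h2, hs, inputState_wvar _ _ h1]
    have a1 : ∀ x, 1 < x → x ∉ parseProg.wa → s₁.warr x = 0 := fun x h1 h2 => by
      rw [f₁.warr x h2, hs, inputState_warr _ _ h1]
    refine Wp.step (initProg_wp (n := n) (by rw [f₁.wvar 0 (by decide)]; simp [hs, inputState])
      (v1 49 (by decide) (by decide)) (by omega)) (fun s₂ h₂ f₂ => ?_) le_rfl
    obtain ⟨b1, b2, b3⟩ := h₂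
    have e4 : s₂.warr 4 = s₁.warr 4 := f₂.warr 4 (by decide)
    have hlev : LevelSt n p (s₁.warr 2) (twoArrays (s₁.warr 3) (s₁.warr 10)) s₂ := by
      refine ⟨f₂.warr 2 (by decide), by rw [f₂.warr 3 (by decide), f₂.warr 10 (by decide)], ?_⟩
      rw [f₂.wvar 52 (by decide), f₂.wvar 53 (by decide), f₂.wvar 48 (by decide),
        v1 52 (by decide) (by decide), v1 53 (by decide) (by decide),
        v1 48 (by decide) (by decide), e4]
      refine LevelInv.init (fun x _ => ?_) (fun x _ => ?_) (fun y _ => h₁.rem_eq y) b1 b2 b3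
      · rw [f₂.warr 5 (by decide), a1 5 (by decide) (by decide)]
        rfl
      · rw [f₂.warr 6 (by decide), a1 6 (by decide) (by decide)]
        rfl
    refine Wp.step (levelProg_wp hlab hw hu (by omega) hlev) (fun s₃ h₃ f₃ => ?_) le_rfl
    have a3 : ∀ x, 1 < x → x ∉ parseProg.wa → x ∉ initProg.wa → x ∉ levelProg.wa →
        s₃.warr x = 0 := fun x h1 h2 h3 h4 => by
      rw [f₃.warr x h4, f₂.warr x h3, a1 x h1 h2]
    have r3 : s₃.rarr = s.rarr := by
      funext x
      rw [f₃.rarr x (by simp [levelProg, Prog.ra, placeLevel, place, releaseProg, releaseStep,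
          Prog.inc]),
        f₂.rarr x (by simp [initProg, Prog.ra, Prog.inc]),
        f₁.rarr x (by simp [parseProg, Prog.ra, Prog.inc])]
    have p3 : ∀ a b, s₃.pt a b = s.pt a b := fun a b => by
      funext i
      simp only [State.pt, r3]
    refine (prefixProg_wp (n := n) (p := p) (by
        rw [f₃.wvar 0 (by decide), f₂.wvar 0 (by decide), f₁.wvar 0 (by decide)]
        simp [hs, inputState]) rfl rfl h₃.1 h₃.2
      (by rw [a3 7 (by decide) (by decide) (by decide) (by decide)]; rfl)
      (by rw [a3 8 (by decide) (by decide) (by decide) (by decide)]; rfl)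
      (a3 9 (by decide) (by decide) (by decide) (by decide))
      (by rw [p3, hs, inputState_pt_of_ne _ _ (by decide) (by decide)])
      (by rw [p3, hs, inputState_pt_of_ne _ _ (by decide) (by decide)]) (by omega)).framed.imp ?_
    rintro s₄ ⟨⟨K, k1, k2, k3, k4, k5, k6⟩, f₄⟩
    have hpt : ∀ x, x < n → s.pt 0 1 x = w (p x) := fun x hx => by
      rw [hs, inputState_pt _ _ hx, hp, extendLabels_of_lt e a₀ hx]
    refine ⟨?_, K, _, _, _, _, _, _, k1, k2, k3, h₃.1, h₃.2, k4, fun i hi => ?_, fun i hi => ?_⟩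
    · rw [f₄.wvar 26 (by decide), f₃.wvar 26 (by decide), f₂.wvar 26 (by decide),
        v1 26 (by decide) (by decide)]
    · rw [k5 i hi, p3]
      refine Finset.sum_congr rfl fun k hk => hpt _ (h₃.2.A_lt_n ?_)
      have := Finset.mem_range.1 hk
      omega
    · rw [k6 i hi, p3]
      refine Finset.sum_congr rfl fun k hk => hpt _ (h₃.2.swap.A_lt_n ?_)
      have := Finset.mem_range.1 hk
      omega

end RealRAM

/-! ### The main program -/

namespace RealRAM

variable {P : Type u} [PartialOrder P]

/-- Construct the polygon of the lower sets. -/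
def mainProg : Prog := preProg ;; candidates 1 ;; candidates (-1) ;; outProg

/-- The points of the first run dominate on the upper side and persist in the array; the second run
takes care of the lower side. All of them belong to `Z`, so both hulls agree. -/
theorem convexHull_eq_of_covered {F G : ℕ → ℕ} {A C T T₁ : ℕ → ℝ × ℝ} {N N₁ : ℕ}
    {Z : Set (ℝ × ℝ)} (hZ : Z = {z | ∃ i j, Feas F G i j ∧ A i + C j = z})
    (h₁ : ∀ x, x < N₁ → T₁ x ∈ Z) (hg : Generated A C F G T₁ T N₁ N)
    (hc₁ : ∀ q ∈ Z, Covered 1 T₁ N₁ q) (hc : ∀ q ∈ Z, Covered (-1) T N q) :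
    convexHull ℝ (T '' Set.Iio N) = convexHull ℝ Z := by
  apply Set.Subset.antisymm
  · refine convexHull_mono ?_
    rintro _ ⟨x, hx, rfl⟩
    by_cases hx1 : x < N₁
    · rw [hg.old x hx1]
      exact h₁ x hx1
    · obtain ⟨i, j, hf, he⟩ := hg.new x (by omega) hx
      rw [hZ]
      exact ⟨i, j, hf, he.symm⟩
  · refine convexHull_min (subset_convexHull_of_dirVal ((Set.finite_Iio N).image T)
      (fun u q hq => ?_) fun u q hq => ?_) (convex_convexHull ℝ _)
    · obtain ⟨x, hx, hle⟩ := hc₁ q hq u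
      refine ⟨T x, ⟨x, hx.trans_le hg.le, rfl⟩, ?_⟩
      rw [hg.old x hx]
      simpa using hle
    · obtain ⟨x, hx, hle⟩ := hc q hq u
      exact ⟨T x, ⟨x, hx, rfl⟩, by simpa using hle⟩

theorem mainProg_wp [Fintype P] (hw : HasWidth P 2) {n : ℕ} {e : Fin n ≃ P}
    {covers : List (Fin n × Fin n)} (hcov : IsCoverList e covers) (w : P → ℝ × ℝ) :
    ∃ K, n + 2 ≤ 2 ^ K ∧ 2 ^ K < 2 * (n + 2) ∧
      Wp ((n + 1) ^ 7) mainProg (100000 * (2 ^ K * K ^ 2))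
        (fun s' => s'.wvar 2 ≤ 12 * (K * 2 ^ K) ∧ Outputs s' (closurePolygon w))
        (inputState covers (fun i => w (e i))) := by
  have hn : 2 ≤ n := by
    have := hw.two_le_card
    rwa [← Fintype.card_congr e, Fintype.card_fin] at this
  obtain ⟨K, hK1, hK2⟩ : ∃ K, n + 2 ≤ 2 ^ K ∧ 2 ^ K < 2 * (n + 2) := by
    refine ⟨Nat.clog 2 (n + 2), Nat.le_pow_clog (by norm_num) _, ?_⟩
    have := Nat.pow_pred_clog_lt_self (b := 2) (by norm_num) (x := n + 2) (by omega)
    have h0 : 0 < Nat.clog 2 (n + 2) := Nat.clog_pos (by norm_num) (by omega)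
    obtain ⟨k, hk⟩ : ∃ k, Nat.clog 2 (n + 2) = k + 1 := ⟨_, (Nat.succ_pred h0.ne').symm⟩
    rw [hk] at this ⊢
    simp only [Nat.pred_succ] at this
    rw [pow_succ]
    omega
  have hKpos : 2 ≤ K := by
    by_contra hc
    have : 2 ^ K ≤ 2 ^ 1 := Nat.pow_le_pow_right (by norm_num) (by omega)
    omega
  refine ⟨K, hK1, hK2, ?_⟩
  set S := 2 ^ K with hS
  have hKS : K < S := Nat.lt_two_pow_self
  -- As `S ≤ 3 * (n + 1)` and `K < S`, the left side is at most a constant times `(n + 1) ^ 2`. The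
  -- constant is below `3 ^ 5`, and `n + 1 ≥ 3`; hence the exponent `7`.
  have hB1 : 12 * (K * S) + 9 * S + 7 ≤ (n + 1) ^ 7 := by
    have h1 : S ≤ 3 * (n + 1) := by omega
    have h2 : K * S ≤ 9 * (n + 1) ^ 2 := by
      calc K * S ≤ S * S := Nat.mul_le_mul_right _ hKS.le
        _ ≤ (3 * (n + 1)) * (3 * (n + 1)) := Nat.mul_le_mul h1 h1
        _ = 9 * (n + 1) ^ 2 := by ring
    have h3 : 3 ^ 5 * (n + 1) ^ 2 ≤ (n + 1) ^ 7 := by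
      rw [show (n + 1) ^ 7 = (n + 1) ^ 5 * (n + 1) ^ 2 by ring]
      exact Nat.mul_le_mul_right _ (Nat.pow_le_pow_left (by omega) 5)
    have h4 : n + 1 ≤ (n + 1) ^ 2 := Nat.le_self_pow (by norm_num) _
    omega
  have hB2 : 3 * n + 7 ≤ (n + 1) ^ 7 := by omega
  have a₀ : P := e ⟨0, by omega⟩
  refine Wp.step (T₂ := (K * (7000 * S * (K + 1) + 20) + 10) +
    ((K * (7000 * S * (K + 1) + 20) + 10) + 2000 * (6 * K * S + 1) * ((2 * K + 3) + 1)))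
    (preProg_wp hw.noThreeAntichain a₀ hcov w hB2) (fun s₁ h₁ _ => ?_) ?_
  · obtain ⟨h26, K', na, nb, A, B, α, β, hpr⟩ := h₁
    -- The program computes a power of two in `[n + 2, 2 * (n + 2))`, and there is only one.
    obtain rfl : K' = K := by
      have h1 := hpr.le_size
      have h2 := hpr.size_lt
      have h3 : 2 ^ K' < 2 ^ (K + 1) := by rw [pow_succ]; omega
      have h4 : 2 ^ K < 2 ^ (K' + 1) := by rw [pow_succ]; omega
      have h5 := (Nat.pow_lt_pow_iff_right (by norm_num)).1 h3
      have h6 := (Nat.pow_lt_pow_iff_right (by norm_num)).1 h4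
      omega
    have hcount := hpr.count
    have hst := hpr.bounds.staircase hpr.chains
    have hZ : projectFamily w {L : Set P | IsLowerSet L} =
        {z | ∃ i j, Feas (s₁.warr 7) (s₁.warr 9) i j ∧ s₁.pt 4 5 i + s₁.pt 6 7 j = z} := by
      rw [hpr.bounds.projectFamily_eq (labelling_extendLabels e a₀) hpr.chains w]
      ext z
      refine exists_congr fun i => exists_congr fun j => and_congr_right fun hf => ?_
      obtain ⟨hi, hj, -⟩ := hpr.bounds.feas_le hf
      rw [hpr.sum_A i hi, hpr.sum_B j hj]
    have e1 : 3 * K' * S = 3 * (K' * S) := by ring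
    have e2 : 6 * K' * S = 6 * (K' * S) := by ring
    refine Wp.step (candidates_wp (M := na + 1) (N := 0) (k := K') (S := S) (by norm_num)
      ⟨rfl, rfl, rfl, rfl, hpr.size⟩ hst hS (by omega) h26 (by omega)) (fun s₂ h₂ _ => ?_) le_rfl
    obtain ⟨b1, b2, b3, b4⟩ := h₂
    refine Wp.step (candidates_wp (M := na + 1) (k := K') (S := S) (by norm_num)
      b4 hst hS (by omega) rfl (by omega)) (fun s₃ h₃ _ => ?_) le_rfl
    obtain ⟨c1, c2, c3, c4⟩ := h₃
    have hN : s₃.wvar 26 ≤ 6 * (K' * S) := by omega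
    have hZ0 : (s₁.pt 4 5 0 + s₁.pt 6 7 0) ∈ projectFamily w {L : Set P | IsLowerSet L} := by
      rw [hZ]
      exact ⟨0, 0, hpr.bounds.feas_zero, rfl⟩
    have hc1 : ∀ q ∈ projectFamily w {L : Set P | IsLowerSet L},
        Covered 1 (s₂.pt 16 17) (s₂.wvar 26) q := by
      rw [hZ]
      rintro _ ⟨i, j, hf, rfl⟩
      simpa using b3 i j (hpr.bounds.feas_le hf).2.2 hf
    have hc2 : ∀ q ∈ projectFamily w {L : Set P | IsLowerSet L},
        Covered (-1) (s₃.pt 16 17) (s₃.wvar 26) q := by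
      rw [hZ]
      rintro _ ⟨i, j, hf, rfl⟩
      simpa using c3 i j (hpr.bounds.feas_le hf).2.2 hf
    have hN0 : 0 < s₃.wvar 26 := by
      obtain ⟨x, hx, -⟩ := hc2 _ hZ0 0
      omega
    -- The number of candidates is at most `6 * K * S ≤ 8 * S ^ 2`, so sorting all of them takes
    -- `O(K)` passes.
    have hpow : s₃.wvar 26 ≤ 2 ^ (2 * K' + 3) := by
      rw [show 2 ^ (2 * K' + 3) = 8 * (S * S) by rw [hS]; ring]
      have : K' * S ≤ S * S := Nat.mul_le_mul_right _ hKS.le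
      omega
    have hhull : convexHull ℝ (s₃.pt 16 17 '' Set.Iio (s₃.wvar 26)) = closurePolygon w := by
      refine convexHull_eq_of_covered hZ (fun x hx => ?_) c2 hc1 hc2
      obtain ⟨i, j, hf, he⟩ := b2.new x (Nat.zero_le _) hx
      rw [hZ]
      exact ⟨i, j, hf, he.symm⟩
    refine (outProg_wp rfl hN0 hpow (by omega)).mono ?_ ?_
    · exact Nat.mul_le_mul_right _ (Nat.mul_le_mul_left _ (by omega))
    · rintro s' ⟨d1, d2⟩
      rw [hhull] at d2
      exact ⟨by omega, d2⟩
  · have h1 : 2 * S ≤ S * K := by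
      rw [mul_comm]
      exact Nat.mul_le_mul_left _ hKpos
    have h2 : 2 * (S * K) ≤ S * K ^ 2 := by
      rw [show S * K ^ 2 = S * K * K by ring, mul_comm 2]
      exact Nat.mul_le_mul_left (S * K) hKpos
    have h3 : K ≤ S * K := Nat.le_mul_of_pos_left _ (by omega)
    have h4 : K * (7000 * S * (K + 1) + 20) = 7000 * (S * K ^ 2) + 7000 * (S * K) + 20 * K := by
      ring
    have h5 : 2000 * (6 * K * S + 1) * ((2 * K + 3) + 1) =
      24000 * (S * K ^ 2) + 48000 * (S * K) + 4000 * K + 8000 := by ring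
    omega

end RealRAM

/-- From `n ≥ 2` one gets `2 * (n + 2) ≤ 4 * n ≤ n ^ 3`, hence `K * log 2 ≤ 3 * log n`, and `log 2 >
1 / 2`. -/
theorem log_bounds {n K : ℕ} (hn : 2 ≤ n) (h : 2 ^ K < 2 * (n + 2)) :
    (2 : ℝ) ^ K ≤ 4 * n ∧ (K : ℝ) ≤ 6 * Real.log n := by
  have h1 : 2 ^ K ≤ 4 * n := by omega
  have h2 : (2 : ℝ) ^ K ≤ 4 * n := by exact_mod_cast h1
  refine ⟨h2, ?_⟩
  have h3 : (2 : ℝ) ^ K ≤ (n : ℝ) ^ 3 := by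
    have : 4 * n ≤ n ^ 3 := by
      rw [pow_succ]
      exact Nat.mul_le_mul_right _ (Nat.pow_le_pow_left hn 2)
    exact h2.trans (by exact_mod_cast this)
  have h4 := Real.log_le_log (by positivity) h3
  rw [Real.log_pow, Real.log_pow] at h4
  have h5 := Real.log_two_gt_d9
  push_cast at h4
  nlinarith [(Nat.cast_nonneg K : (0 : ℝ) ≤ K)]

theorem exists_coverList {P : Type u} [PartialOrder P] {n : ℕ} (e : Fin n ≃ P) :
    ∃ covers, IsCoverList e covers := by
  classical
  refine ⟨(Finset.univ.filter fun q : Fin n × Fin n => e q.1 ⋖ e q.2).toList,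
    Finset.nodup_toList _, fun i j => ?_⟩
  simp

theorem IsVertexCycle.ncard_le {K : Set (ℝ × ℝ)} {k : ℕ} {v : ℕ → ℝ × ℝ}
    (h : IsVertexCycle K k v) : (polygonVertices K).Finite ∧ (polygonVertices K).ncard ≤ k := by
  rw [← h.image_eq]
  refine ⟨(Set.finite_Iio k).image v, (Set.ncard_image_le (Set.finite_Iio k)).trans ?_⟩
  simp [Set.ncard_eq_toFinset_card']

theorem mainTheorem7 :
    (∃ C : ℝ, ∀ (P : Type u) [PartialOrder P] [Fintype P], HasWidth P 2 →
      ∀ w : P → ℝ × ℝ,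
        (polygonVertices (closurePolygon w)).Finite ∧
        ((polygonVertices (closurePolygon w)).ncard : ℝ) ≤
          C * (Fintype.card P : ℝ) * Real.log (Fintype.card P : ℝ)) ∧
    (∃ (prog : RealRAM.Prog) (c : ℕ) (C : ℝ),
      ∀ (P : Type u) [PartialOrder P] [Fintype P], HasWidth P 2 →
      ∀ (w : P → ℝ × ℝ) (n : ℕ) (e : Fin n ≃ P) (covers : List (Fin n × Fin n)),
        IsCoverList e covers →
        ∃ (t : ℕ) (s : RealRAM.State),
          RealRAM.Exec ((n + 1) ^ c) prog (RealRAM.inputState covers (fun i => w (e i))) t s ∧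
          (t : ℝ) ≤ C * (n : ℝ) * Real.log (n : ℝ) ^ 2 ∧
          RealRAM.Outputs s (closurePolygon w)) := by
  constructor
  -- `288 = 12 * 4 * 6`: at most `12 * K * 2 ^ K` vertices, with `2 ^ K ≤ 4 * n` and `K ≤ 6 * log
  -- n`. The count is that of the list which the program outputs.
  · refine ⟨288, fun P _ _ hw w => ?_⟩
    have hn := hw.two_le_card
    obtain ⟨covers, hcov⟩ := exists_coverList (Fintype.equivFin P).symm
    obtain ⟨K, -, hK, t, s, -, -, h1, h2⟩ := RealRAM.mainProg_wp hw hcov w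
    obtain ⟨h3, h4⟩ := IsVertexCycle.ncard_le h2
    obtain ⟨h5, h6⟩ := log_bounds hn hK
    refine ⟨h3, ?_⟩
    have h7 : ((polygonVertices (closurePolygon w)).ncard : ℝ) ≤ 12 * (K * 2 ^ K) := by
      exact_mod_cast h4.trans h1
    have h8 : (K : ℝ) * 2 ^ K ≤ 6 * Real.log (Fintype.card P) * (4 * Fintype.card P) :=
      mul_le_mul h6 h5 (by positivity) ((Nat.cast_nonneg K).trans h6)
    linarith
  -- `14400000 = 100000 * 4 * 6 ^ 2`, from the bound `100000 * 2 ^ K * K ^ 2` on the time.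
  · refine ⟨RealRAM.mainProg, 7, 14400000, fun P _ _ hw w n e covers hcov => ?_⟩
    have hn := hw.two_le_card
    rw [← Fintype.card_congr e, Fintype.card_fin] at hn
    obtain ⟨K, -, hK, t, s, h0, ht, -, h2⟩ := RealRAM.mainProg_wp hw hcov w
    obtain ⟨h5, h6⟩ := log_bounds hn hK
    refine ⟨t, s, h0, ?_, h2⟩
    have h7 : (t : ℝ) ≤ 100000 * (2 ^ K * K ^ 2) := by exact_mod_cast ht
    have h8 : (2 : ℝ) ^ K * K ^ 2 ≤ 4 * n * (6 * Real.log n) ^ 2 :=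
      mul_le_mul h5 (pow_le_pow_left₀ (Nat.cast_nonneg K) h6 2) (by positivity) (by positivity)
    calc (t : ℝ) ≤ 100000 * (4 * n * (6 * Real.log n) ^ 2) := h7.trans (by linarith)
      _ = 14400000 * n * Real.log n ^ 2 := by ring
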